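/- **Theorem 4.5.** Let $\alpha\in\mathbb C$ and $h\in(0,1]$. *The source.* Let $V_1,V_2,V_3$ be two-dimensional complex spaces with bases $(e_1,e_2)$, $(f_1,f_2)$, $(h_1,h_2)$ and skew forms $\psi_i$ with $\psi_1(e_1,e_2)=\psi_2(f_1,f_2)=\psi_3(h_1,h_2)=1$, and let $\mathcal P_i(x,y)z=\psi_i(y,z)x-\psi_i(z,x)y$. For $\sigma_1+\sigma_2+\sigma_3=0$, $\Gamma(\sigma_1,\sigma_2,\sigma_3)$ is the Lie superalgebra with even part $sp(\psi_1)\oplus sp(\psi_2)\oplus sp(\psi_3)$, odd part $V_1\otimes V_2\otimes V_3$ (tensor product of the standard representations) and $$[x_1\otimes x_2\otimes x_3,\,y_1\otimes y_2\otimes y_3]=\sigma_1\psi_2(x_2,y_2)\psi_3(x_3,y_3)\mathcal P_1(x_1,y_1)+\sigma_2\psi_1(x_1,y_1)\psi_3(x_3,y_3)\mathcal P_2(x_2,y_2)+\sigma_3\psi_1(x_1,y_1)\psi_2(x_2,y_2)\mathcal P_3(x_3,y_3).$$ Put $\Gamma=\Gamma(2,-1-\alpha,\alpha-1)$. *The target.*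 Let $P^+_h=\mathbb C[t,t^{-1}][\tau]$ with the product $A\circ_h B=\sum_{n\ge0}\frac{h^n}{n!}\,\partial_\tau^nA\,\partial_t^nB$, let $\Lambda_h(4)$ be the associative superalgebra with odd generators $\xi_1,\xi_2,\eta_1,\eta_2$ and relations $\xi_i\xi_j=-\xi_j\xi_i$, $\eta_i\eta_j=-\eta_j\eta_i$, $\eta_i\xi_j=h\delta_{ij}-\xi_j\eta_i$, and let $P^+_h(4)=P^+_h\otimes\Lambda_h(4)$ with product $(A\otimes X)(B\otimes Y)=(A\circ_hB)\otimes XY$ and Lie superbracket $[A,B]_h=\frac1h\bigl(AB-(-1)^{p(A)p(B)}BA\bigr)$. *The embedding.* In $P_h^+(4)$ put $$\begin{aligned} &E^1=t^2,\quad H^1=t\tau+\tfrac{\alpha+1}2h,\quad F^1=\tau^2-\alpha\bigl(2t^{-2}\xi_1\xi_2\eta_1\eta_2+t^{-2}(\xi_1\eta_1+\xi_2\eta_2)h-t^{-1}\tau h\bigr),\\ &E^2=\xi_1\xi_2,\quad H^2=\xi_1\eta_1+\xi_2\eta_2-h,\quad F^2=\eta_1\eta_2,\qquad E^3=\xi_1\eta_2,\quad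 H^3=\xi_1\eta_1-\xi_2\eta_2,\quad F^3=\xi_2\eta_1,\\ &T^1=t\eta_1,\quad T^2=t\eta_2,\quad T^3=t\xi_1,\quad T^4=t\xi_2,\\ &D^1=\tau\xi_1+\alpha t^{-1}\xi_1\xi_2\eta_2,\quad D^2=\tau\xi_2-\alpha t^{-1}\xi_1\xi_2\eta_1,\quad D^3=\tau\eta_1+\alpha t^{-1}\eta_1\eta_2\xi_2,\quad D^4=\tau\eta_2-\alpha t^{-1}\eta_1\eta_2\xi_1 . \end{aligned}$$ Let $\rho_{\alpha,h}:\Gamma\to P_h^+(4)$ be the linear map with $$\begin{aligned} &\mathcal P_1(e_1,e_1)\mapsto-E^1,\quad \mathcal P_1(e_2,e_2)\mapsto-F^1,\quad \mathcal P_1(e_1,e_2)\mapsto-H^1,\\ &\mathcal P_2(f_1,f_1)\mapsto-2F^2,\quad \mathcal P_2(f_2,f_2)\mapsto-2E^2,\quad \mathcal P_2(f_1,f_2)\mapsto H^2,\\ &\mathcal P_3(h_1,h_1)\mapsto-2F^3,\quad \mathcal P_3(h_2,h_2)\mapsto 2E^3,\quad \mathcal P_3(h_1,h_2)\mapsto H^3,\\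 &e_1\otimes f_1\otimes h_1\mapsto\sqrt2\,i\,T^1,\quad e_1\otimes f_1\otimes h_2\mapsto\sqrt2\,i\,T^2,\quad e_1\otimes f_2\otimes h_1\mapsto-\sqrt2\,i\,T^4,\quad e_1\otimes f_2\otimes h_2\mapsto\sqrt2\,i\,T^3,\\ &e_2\otimes f_1\otimes h_1\mapsto\sqrt2\,i\,D^3,\quad e_2\otimes f_1\otimes h_2\mapsto\sqrt2\,i\,D^4,\quad e_2\otimes f_2\otimes h_1\mapsto-\sqrt2\,i\,D^2,\quad e_2\otimes f_2\otimes h_2\mapsto\sqrt2\,i\,D^1 . \end{aligned}$$ Then $\rho_{\alpha,h}$ is an embedding of Lie superalgebras. Identify $\Gamma$ with its image under $\rho_{\alpha,h}$, and regard $P_h^+(4)$ as a $\Gamma$-module through $\rho_{\alpha,h}$ and the bracket. Then the following hold. 1. $\dim H^1(\Gamma,P_h^+(4))=1$, where $H^1$ is the full first cohomology space (even and odd cochains). It is spanned by the class of the $1$-cocycle $\bar\theta_1$ given by $$\bar\theta_1(D^1)=t^{-1}\xi_1,\quad \bar\theta_1(D^2)=t^{-1}\xi_2,\quad \bar\theta_1(D^3)=t^{-1}\eta_1,\quad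 \bar\theta_1(D^4)=t^{-1}\eta_2,$$ $$\bar\theta_1(F^1)=2t^{-1}\tau+(\alpha-1)t^{-2}h,\quad \bar\theta_1(H^1)=1,$$ and $\bar\theta_1=0$ on the remaining basis elements listed above. 2. Let $\rho_2:\Gamma\to P_h^+(4)$ be the linear map with $\rho_2(F^1)=t^{-2}$ and $\rho_2=0$ on the other basis elements. Then $\rho_{\alpha,h}+\beta\bar\theta_1+\beta^2\rho_2$ is a formal deformation of $\rho_{\alpha,h}$: its coefficients are even linear maps, and it is compatible with the brackets as an identity of formal power series in $\beta$. -/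

import Mathlib

open scoped TensorProduct

set_option maxSynthPendingDepth 3

noncomputable section

namespace DTwoOne

/-- The sign `(-1)^p` of a parity `p ∈ ℤ/2`. -/
def sgn (p : ZMod 2) : ℂ := if p = 0 then 1 else -1

/-! ### First cohomology and formal deformations for Lie superalgebras

`𝒢`, `ℋ` are the parity decompositions of `G`, `H`; `brG`, `brH` are the brackets; `H` is a
`G`-module through `ρ : G → H`, that is, `X ∈ G` acts by `[ρ X, ·]`. -/

section General

variable {G H : Type*} [AddCommGroup G] [Module ℂ G] [AddCommGroup H] [Module ℂ H]

/-- Linear maps `G → H` that are homogeneous of parity `p`. -/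
def cochains (𝒢 : ZMod 2 → Submodule ℂ G) (ℋ : ZMod 2 → Submodule ℂ H) (p : ZMod 2) :
    Submodule ℂ (G →ₗ[ℂ] H) where
  carrier := {c | ∀ q : ZMod 2, ∀ x ∈ 𝒢 q, c x ∈ ℋ (p + q)}
  add_mem' ha hb q x hx := (ℋ (p + q)).add_mem (ha q x hx) (hb q x hx)
  zero_mem' q _ _ := (ℋ (p + q)).zero_mem
  smul_mem' r _ ha q x hx := (ℋ (p + q)).smul_mem r (ha q x hx)

/-- The coboundary of a 1-cochain `c` of parity `p`, evaluated at `X` of parity `q` and `Y` of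
parity `r`. -/
def coboundary (brG : G → G → G) (brH : H →ₗ[ℂ] H →ₗ[ℂ] H) (ρ : G →ₗ[ℂ] H) (p q r : ZMod 2)
    (c : G →ₗ[ℂ] H) (X Y : G) : H :=
  sgn (p * q) • brH (ρ X) (c Y) - sgn (r * (p + q)) • brH (ρ Y) (c X) - c (brG X Y)

/-- 1-cocycles of parity `p`. -/
def homCocycles (𝒢 : ZMod 2 → Submodule ℂ G) (brG : G → G → G) (ℋ : ZMod 2 → Submodule ℂ H)
    (brH : H →ₗ[ℂ] H →ₗ[ℂ] H) (ρ : G →ₗ[ℂ] H) (p : ZMod 2) : Submodule ℂ (G →ₗ[ℂ] H) where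
  carrier := {c | c ∈ cochains 𝒢 ℋ p ∧
    ∀ q r : ZMod 2, ∀ X ∈ 𝒢 q, ∀ Y ∈ 𝒢 r, coboundary brG brH ρ p q r c X Y = 0}
  add_mem' {a b} ha hb := by
    refine ⟨Submodule.add_mem _ ha.1 hb.1, fun q r X hX Y hY => ?_⟩
    have h1 := ha.2 q r X hX Y hY
    have h2 := hb.2 q r X hX Y hY
    have h3 : coboundary brG brH ρ p q r (a + b) X Y =
        coboundary brG brH ρ p q r a X Y + coboundary brG brH ρ p q r b X Y := by
      simp only [coboundary, LinearMap.add_apply, map_add, smul_add]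
      abel
    rw [h3, h1, h2, add_zero]
  zero_mem' := ⟨Submodule.zero_mem _, fun q r X _ Y _ => by simp [coboundary]⟩
  smul_mem' s a ha := by
    refine ⟨Submodule.smul_mem _ s ha.1, fun q r X hX Y hY => ?_⟩
    have h1 := ha.2 q r X hX Y hY
    have h3 : coboundary brG brH ρ p q r (s • a) X Y = s • coboundary brG brH ρ p q r a X Y := by
      simp only [coboundary, LinearMap.smul_apply, map_smul, smul_sub, smul_comm s]
    rw [h3, h1, smul_zero]

/-- The space `Z¹(G, H)` of all 1-cocycles: the sum of the even and the odd ones. -/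
def Z1 (𝒢 : ZMod 2 → Submodule ℂ G) (brG : G → G → G) (ℋ : ZMod 2 → Submodule ℂ H)
    (brH : H →ₗ[ℂ] H →ₗ[ℂ] H) (ρ : G →ₗ[ℂ] H) : Submodule ℂ (G →ₗ[ℂ] H) :=
  homCocycles 𝒢 brG ℋ brH ρ 0 ⊔ homCocycles 𝒢 brG ℋ brH ρ 1

/-- The space `B¹(G, H)` of 1-coboundaries `dm`, `m ∈ H`. For homogeneous `m` and `X` one has
`dm(X) = (-1)^{p(m)p(X)}[ρ X, m] = -[m, ρ X]`. By the Jacobi identity they are cocycles. -/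
def B1 (brH : H →ₗ[ℂ] H →ₗ[ℂ] H) (ρ : G →ₗ[ℂ] H) : Submodule ℂ (G →ₗ[ℂ] H) :=
  LinearMap.range (brH.compl₂ ρ)

/-- The first cohomology space `H¹(G, H) = Z¹(G, H) / B¹(G, H)`. -/
abbrev H1 (𝒢 : ZMod 2 → Submodule ℂ G) (brG : G → G → G) (ℋ : ZMod 2 → Submodule ℂ H)
    (brH : H →ₗ[ℂ] H →ₗ[ℂ] H) (ρ : G →ₗ[ℂ] H) : Type _ :=
  Z1 𝒢 brG ℋ brH ρ ⧸ (B1 brH ρ).submoduleOf (Z1 𝒢 brG ℋ brH ρ)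

/-- `ρ` is an embedding of Lie superalgebras: an injective even homomorphism. -/
structure IsEmbedding (𝒢 : ZMod 2 → Submodule ℂ G) (brG : G → G → G)
    (ℋ : ZMod 2 → Submodule ℂ H) (brH : H →ₗ[ℂ] H →ₗ[ℂ] H) (ρ : G →ₗ[ℂ] H) : Prop where
  even : ρ ∈ cochains 𝒢 ℋ 0
  map_br : ∀ X Y : G, ρ (brG X Y) = brH (ρ X) (ρ Y)
  injective : Function.Injective ρ

/-- The formal series `∑ₖ βᵏ ρₖ` is a formal deformation of `ρ`: `ρ₀ = ρ`, all `ρₖ` are even, and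
`∑ₖ βᵏ ρₖ([X, Y]) = [∑ᵢ βⁱ ρᵢ(X), ∑ⱼ βʲ ρⱼ(Y)]` coefficientwise in the formal parameter `β`. -/
structure IsFormalDeformation (𝒢 : ZMod 2 → Submodule ℂ G) (brG : G → G → G)
    (ℋ : ZMod 2 → Submodule ℂ H) (brH : H →ₗ[ℂ] H →ₗ[ℂ] H) (ρ : G →ₗ[ℂ] H)
    (r : ℕ → (G →ₗ[ℂ] H)) : Prop where
  zero : r 0 = ρ
  even : ∀ k, r k ∈ cochains 𝒢 ℋ 0
  map_br : ∀ (k : ℕ) (X Y : G),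
    r k (brG X Y) = ∑ ij ∈ Finset.HasAntidiagonal.antidiagonal k, brH (r ij.1 X) (r ij.2 Y)

end General

/-! ### The Lie superalgebra `Γ(σ₁, σ₂, σ₃)` -/

/-- The two-dimensional space `Vᵢ` (the same coordinate space for `i = 1, 2, 3`). -/
abbrev V : Type := Fin 2 → ℂ

/-- The standard basis vectors of `V`; `e 0`, `e 1` play the roles of `e₁, e₂`, of `f₁, f₂` and
of `h₁, h₂`. -/
def e (i : Fin 2) : V := Pi.single i 1

/-- The skew-symmetric form `ψ` with `ψ(e₁, e₂) = 1`. -/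
def psi : V →ₗ[ℂ] V →ₗ[ℂ] ℂ :=
  LinearMap.mk₂ ℂ (fun x y => x 0 * y 1 - x 1 * y 0)
    (fun _ _ _ => by simp only [Pi.add_apply]; ring)
    (fun _ _ _ => by simp only [Pi.smul_apply, smul_eq_mul]; ring)
    (fun _ _ _ => by simp only [Pi.add_apply]; ring)
    (fun _ _ _ => by simp only [Pi.smul_apply, smul_eq_mul]; ring)

/-- `sp(ψ)`, the endomorphisms of `V` that leave `ψ` invariant. -/
def sp : Submodule ℂ (Module.End ℂ V) where
  carrier := {A | ∀ x y, psi (A x) y + psi x (A y) = 0}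
  add_mem' {a b} ha hb x y := by
    have h1 := ha x y
    have h2 := hb x y
    simp only [LinearMap.add_apply, map_add]
    linear_combination h1 + h2
  zero_mem' x y := by simp
  smul_mem' r a ha x y := by
    have h1 := ha x y
    simp only [LinearMap.smul_apply, map_smul, smul_eq_mul]
    linear_combination r * h1

/-- The commutator on `sp(ψ)`. -/
def spBr (A B : sp) : sp :=
  ⟨A.1 * B.1 - B.1 * A.1, fun x y => by
    have h1 := A.2 (B.1 x) y
    have h2 := B.2 x (A.1 y)
    have h3 := B.2 (A.1 x) y
    have h4 := A.2 x (B.1 y)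
    simp only [LinearMap.sub_apply, Module.End.mul_apply, map_sub]
    linear_combination h1 - h2 - h3 + h4⟩

/-- The map `𝒫(x, y) z = ψ(y, z) x - ψ(z, x) y`. -/
def pMap : V →ₗ[ℂ] V →ₗ[ℂ] sp :=
  LinearMap.mk₂ ℂ
    (fun x y => ⟨(psi y).smulRight x - (psi.flip x).smulRight y, fun u v => by
      simp [psi]; ring⟩)
    (fun _ _ _ => by ext : 1; simp only [Submodule.coe_add]; ext; simp [psi]; ring)
    (fun _ _ _ => by ext : 1; simp only [Submodule.coe_smul]; ext; simp [psi]; ring)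
    (fun _ _ _ => by ext : 1; simp only [Submodule.coe_add]; ext; simp [psi]; ring)
    (fun _ _ _ => by ext : 1; simp only [Submodule.coe_smul]; ext; simp [psi]; ring)

/-- The odd part `V₁ ⊗ V₂ ⊗ V₃`. -/
abbrev OddPart : Type := (V ⊗[ℂ] V) ⊗[ℂ] V

/-- The underlying space `(sp(ψ₁) ⊕ sp(ψ₂) ⊕ sp(ψ₃)) ⊕ V₁ ⊗ V₂ ⊗ V₃` of `Γ(σ₁, σ₂, σ₃)`. -/
abbrev Gam : Type := (sp × sp × sp) × OddPart

/-- The even and the odd part of `Γ(σ₁, σ₂, σ₃)`. -/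
def gamPart (p : ZMod 2) : Submodule ℂ Gam :=
  if p = 0 then LinearMap.ker (LinearMap.snd ℂ (sp × sp × sp) OddPart)
  else LinearMap.ker (LinearMap.fst ℂ (sp × sp × sp) OddPart)

/-- The action of the even part on the odd part: the tensor product of the standard
representations. -/
def act (A : sp × sp × sp) : OddPart →ₗ[ℂ] OddPart :=
  TensorProduct.map (TensorProduct.map A.1.1 .id) .id +
  TensorProduct.map (TensorProduct.map .id A.2.1.1) .id +
  TensorProduct.map (TensorProduct.map .id .id) A.2.2.1

/-- `ψ₂(x₂, y₂) ψ₃(x₃, y₃) 𝒫₁(x₁, y₁)`. -/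
def pOne : OddPart →ₗ[ℂ] OddPart →ₗ[ℂ] sp :=
  (TensorProduct.map₂ (TensorProduct.map₂ pMap psi) psi).compr₂
    ((TensorProduct.rid ℂ sp).toLinearMap ∘ₗ (TensorProduct.rid ℂ (sp ⊗[ℂ] ℂ)).toLinearMap)

/-- `ψ₁(x₁, y₁) ψ₃(x₃, y₃) 𝒫₂(x₂, y₂)`. -/
def pTwo : OddPart →ₗ[ℂ] OddPart →ₗ[ℂ] sp :=
  (TensorProduct.map₂ (TensorProduct.map₂ psi pMap) psi).compr₂
    ((TensorProduct.lid ℂ sp).toLinearMap ∘ₗ (TensorProduct.rid ℂ (ℂ ⊗[ℂ] sp)).toLinearMap)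

/-- `ψ₁(x₁, y₁) ψ₂(x₂, y₂) 𝒫₃(x₃, y₃)`. -/
def pThree : OddPart →ₗ[ℂ] OddPart →ₗ[ℂ] sp :=
  (TensorProduct.map₂ (TensorProduct.map₂ psi psi) pMap).compr₂
    ((TensorProduct.lid ℂ sp).toLinearMap ∘ₗ
      LinearMap.rTensor sp (TensorProduct.lid ℂ ℂ).toLinearMap)

/-- The bracket `𝒫 : Γ₁ × Γ₁ → Γ₀` of odd elements. -/
def pOdd (σ₁ σ₂ σ₃ : ℂ) (u v : OddPart) : sp × sp × sp :=
  (σ₁ • pOne u v, σ₂ • pTwo u v, σ₃ • pThree u v)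

theorem pOdd_tmul (σ₁ σ₂ σ₃ : ℂ) (x₁ x₂ x₃ y₁ y₂ y₃ : V) :
    pOdd σ₁ σ₂ σ₃ ((x₁ ⊗ₜ x₂) ⊗ₜ x₃) ((y₁ ⊗ₜ y₂) ⊗ₜ y₃) =
      (σ₁ • psi x₂ y₂ • psi x₃ y₃ • pMap x₁ y₁, σ₂ • psi x₁ y₁ • psi x₃ y₃ • pMap x₂ y₂,
        σ₃ • psi x₁ y₁ • psi x₂ y₂ • pMap x₃ y₃) := by
  simp [pOdd, pOne, pTwo, pThree, smul_smul, mul_comm]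

/-- The bracket of `Γ(σ₁, σ₂, σ₃)`. -/
def gamBr (σ₁ σ₂ σ₃ : ℂ) (X Y : Gam) : Gam :=
  ((spBr X.1.1 Y.1.1, spBr X.1.2.1 Y.1.2.1, spBr X.1.2.2 Y.1.2.2) + pOdd σ₁ σ₂ σ₃ X.2 Y.2,
    act X.1 Y.2 - act Y.1 X.2)

/-- Labels of the 17 standard basis elements of `Γ(σ₁, σ₂, σ₃)`. -/
inductive Gen : Type
  | E1 | H1 | F1 | E2 | H2 | F2 | E3 | H3 | F3
  | T1 | T2 | T3 | T4 | D1 | D2 | D3 | D4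

/-- `√2 i`. -/
def sqrtTwoI : ℂ := (Real.sqrt 2 : ℂ) * Complex.I

/-- The pure tensor `eᵢ ⊗ fⱼ ⊗ hₖ` as an element of `Γ(σ₁, σ₂, σ₃)`. -/
def oddVec (i j k : Fin 2) : Gam := (0, (e i ⊗ₜ e j) ⊗ₜ e k)

/-- The 17 standard basis elements of `Γ(σ₁, σ₂, σ₃)`. -/
def gen : Gen → Gam
  | .E1 => ((-pMap (e 0) (e 0), 0, 0), 0)
  | .H1 => ((-pMap (e 0) (e 1), 0, 0), 0)
  | .F1 => ((-pMap (e 1) (e 1), 0, 0), 0)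
  | .E2 => ((0, -(2⁻¹ : ℂ) • pMap (e 1) (e 1), 0), 0)
  | .H2 => ((0, pMap (e 0) (e 1), 0), 0)
  | .F2 => ((0, -(2⁻¹ : ℂ) • pMap (e 0) (e 0), 0), 0)
  | .E3 => ((0, 0, (2⁻¹ : ℂ) • pMap (e 1) (e 1)), 0)
  | .H3 => ((0, 0, pMap (e 0) (e 1)), 0)
  | .F3 => ((0, 0, -(2⁻¹ : ℂ) • pMap (e 0) (e 0)), 0)
  | .T1 => sqrtTwoI⁻¹ • oddVec 0 0 0
  | .T2 => sqrtTwoI⁻¹ • oddVec 0 0 1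
  | .T3 => sqrtTwoI⁻¹ • oddVec 0 1 1
  | .T4 => -sqrtTwoI⁻¹ • oddVec 0 1 0
  | .D1 => sqrtTwoI⁻¹ • oddVec 1 1 1
  | .D2 => -sqrtTwoI⁻¹ • oddVec 1 1 0
  | .D3 => sqrtTwoI⁻¹ • oddVec 1 0 0
  | .D4 => sqrtTwoI⁻¹ • oddVec 1 0 1

section LinearExtension

variable {W : Type*} [AddCommGroup W] [Module ℂ W]

/-- Matrix entry `(i, j)` of an element of `sp(ψ)`. -/
def entry (i j : Fin 2) : sp →ₗ[ℂ] ℂ :=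
  (LinearMap.proj i ∘ₗ LinearMap.applyₗ (e j)) ∘ₗ sp.subtype

/-- The basis `eᵢ ⊗ fⱼ ⊗ hₖ` of the odd part. -/
def oddBasis : Module.Basis ((Fin 2 × Fin 2) × Fin 2) ℂ OddPart :=
  ((Pi.basisFun ℂ (Fin 2)).tensorProduct (Pi.basisFun ℂ (Fin 2))).tensorProduct
    (Pi.basisFun ℂ (Fin 2))

/-- The values of `ofGen v` on the basis of the odd part. -/
def ofGenOdd (v : Gen → W) : (Fin 2 × Fin 2) × Fin 2 → W
  | ((0, 0), 0) => sqrtTwoI • v .T1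
  | ((0, 0), 1) => sqrtTwoI • v .T2
  | ((0, 1), 0) => -sqrtTwoI • v .T4
  | ((0, 1), 1) => sqrtTwoI • v .T3
  | ((1, 0), 0) => sqrtTwoI • v .D3
  | ((1, 0), 1) => sqrtTwoI • v .D4
  | ((1, 1), 0) => -sqrtTwoI • v .D2
  | ((1, 1), 1) => sqrtTwoI • v .D1

/-- The linear map on `Γ(σ₁, σ₂, σ₃)` with prescribed values `v g` on the 17 basis elements
`gen g`, see `ofGen_gen`. -/
def ofGen (v : Gen → W) : Gam →ₗ[ℂ] W :=
  LinearMap.coprod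
    (LinearMap.coprod
      ((entry 0 0).smulRight (v .H1) - (entry 0 1).smulRight ((2⁻¹ : ℂ) • v .E1) +
        (entry 1 0).smulRight ((2⁻¹ : ℂ) • v .F1))
      (LinearMap.coprod
        ((entry 1 0).smulRight (v .E2) - (entry 0 0).smulRight (v .H2) -
          (entry 0 1).smulRight (v .F2))
        (-(entry 1 0).smulRight (v .E3) - (entry 0 0).smulRight (v .H3) -
          (entry 0 1).smulRight (v .F3))))
    (oddBasis.constr ℂ (ofGenOdd v))

theorem sqrtTwoI_ne_zero : sqrtTwoI ≠ 0 := by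
  simp [sqrtTwoI]

theorem ofGen_oddVec (v : Gen → W) (i j k : Fin 2) :
    ofGen v (oddVec i j k) = ofGenOdd v ((i, j), k) := by
  have h : (e i ⊗ₜ[ℂ] e j) ⊗ₜ[ℂ] e k = oddBasis ((i, j), k) := by
    simp [oddBasis, e, Module.Basis.tensorProduct_apply]
  rw [oddVec, h]
  simp only [ofGen, LinearMap.coprod_apply, map_zero, zero_add, Module.Basis.constr_basis]

theorem ofGen_gen (v : Gen → W) (g : Gen) : ofGen v (gen g) = v g := by
  have hs := sqrtTwoI_ne_zero
  cases g <;>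
  first
  | (simp only [gen, map_smul, ofGen_oddVec, ofGenOdd, smul_smul, neg_mul_neg,
      inv_mul_cancel₀ hs, one_smul]; done)
  | (simp [gen, ofGen, entry, pMap, psi, e, smul_smul]; done)
  | (simp [gen, ofGen, entry, pMap, psi, e, smul_smul]; module)

end LinearExtension

/-! ### The quantized superalgebra `P⁺_h(4)` of differential operators on `S^{1|2}` -/

/-- The space `P⁺ = ℂ[t, t⁻¹][τ]`; `single (a, b) 1` is the monomial `tᵃ τᵇ`. The ring structure of
this type is the commutative one; the product `∘_h` is `starH h` below. -/
abbrev PPlus : Type := AddMonoidAlgebra ℂ (ℤ × ℕ)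

/-- The monomial `tᵃ τᵇ`. -/
def mon (a : ℤ) (b : ℕ) : PPlus := AddMonoidAlgebra.single (a, b) 1

/-- The basis of monomials of `P⁺`. -/
def monBasis : Module.Basis (ℤ × ℕ) ℂ PPlus :=
  Module.Basis.ofRepr (AddMonoidAlgebra.coeffLinearEquiv ℂ)

theorem monBasis_apply (a : ℤ) (b : ℕ) : monBasis (a, b) = mon a b := rfl

/-- `∂_t`. -/
def dt : PPlus →ₗ[ℂ] PPlus := monBasis.constr ℂ fun ab => (ab.1 : ℂ) • mon (ab.1 - 1) ab.2

/-- `∂_τ`. -/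
def dtau : PPlus →ₗ[ℂ] PPlus := monBasis.constr ℂ fun ab => (ab.2 : ℂ) • mon ab.1 (ab.2 - 1)

/-- The product `A ∘_h B = ∑ₙ (hⁿ / n!) ∂_τⁿ A ∂_tⁿ B`, given for monomials `A = tᵃ τᵇ`, where the
terms with `n > b` vanish, and extended linearly in `A`. -/
def starH (h : ℂ) : PPlus →ₗ[ℂ] PPlus →ₗ[ℂ] PPlus :=
  monBasis.constr ℂ fun ab => ∑ n ∈ Finset.range (ab.2 + 1),
    (h ^ n / (n.factorial : ℂ)) •
      (LinearMap.mul ℂ PPlus ((dtau ^ n) (mon ab.1 ab.2)) ∘ₗ (dt ^ n))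

/-- The quadratic form `(x, y) ↦ h (x₁ y₁ + x₂ y₂)`. -/
def quad (h : ℂ) : QuadraticForm ℂ ((Fin 2 → ℂ) × (Fin 2 → ℂ)) :=
  LinearMap.BilinMap.toQuadraticMap
    (LinearMap.mk₂ ℂ (fun u v => h * (u.1 0 * v.2 0 + u.1 1 * v.2 1))
      (fun _ _ _ => by simp only [Prod.fst_add, Pi.add_apply]; ring)
      (fun _ _ _ => by simp only [Prod.smul_fst, Pi.smul_apply, smul_eq_mul]; ring)
      (fun _ _ _ => by simp only [Prod.snd_add, Pi.add_apply]; ring)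
      (fun _ _ _ => by simp only [Prod.smul_snd, Pi.smul_apply, smul_eq_mul]; ring))

/-- `Λ_h(4)`, the superalgebra with odd generators `ξ₁, ξ₂, η₁, η₂` and relations
`ξᵢξⱼ = -ξⱼξᵢ`, `ηᵢηⱼ = -ηⱼηᵢ`, `ηᵢξⱼ = h δᵢⱼ - ξⱼηᵢ`. These are the defining relations
`(∑ xᵢξᵢ + yᵢηᵢ)² = h ∑ xᵢyᵢ` of a Clifford algebra. -/
abbrev Lam (h : ℂ) : Type := CliffordAlgebra (quad h)

/-- The generators `ξᵢ`. -/
def xi (h : ℂ) (i : Fin 2) : Lam h := CliffordAlgebra.ι (quad h) (Pi.single i 1, 0)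

/-- The generators `ηᵢ`. -/
def eta (h : ℂ) (i : Fin 2) : Lam h := CliffordAlgebra.ι (quad h) (0, Pi.single i 1)

theorem xi_mul_xi (h : ℂ) (i j : Fin 2) : xi h i * xi h j = -(xi h j * xi h i) := by
  have h0 : QuadraticMap.polar (quad h) (Pi.single i 1, 0) (Pi.single j 1, 0) = 0 := by
    simp [QuadraticMap.polar, quad]
  rw [eq_neg_iff_add_eq_zero, xi, xi, CliffordAlgebra.ι_mul_ι_add_swap, h0, map_zero]

theorem eta_mul_eta (h : ℂ) (i j : Fin 2) : eta h i * eta h j = -(eta h j * eta h i) := by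
  have h0 : QuadraticMap.polar (quad h) (0, Pi.single i 1) (0, Pi.single j 1) = 0 := by
    simp [QuadraticMap.polar, quad]
  rw [eq_neg_iff_add_eq_zero, eta, eta, CliffordAlgebra.ι_mul_ι_add_swap, h0, map_zero]

theorem eta_mul_xi (h : ℂ) (i j : Fin 2) :
    eta h i * xi h j = algebraMap ℂ (Lam h) (if i = j then h else 0) - xi h j * eta h i := by
  rw [eq_sub_iff_add_eq, xi, eta, CliffordAlgebra.ι_mul_ι_add_swap]
  congr 1
  fin_cases i <;> fin_cases j <;> simp [QuadraticMap.polar, quad]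

/-- The space `P⁺_h(4) = P⁺_h ⊗ Λ_h(4)`. -/
abbrev PH (h : ℂ) : Type := PPlus ⊗[ℂ] Lam h

/-- The associative product `(A ⊗ X)(B ⊗ Y) = (A ∘_h B) ⊗ XY` of `P⁺_h(4)`. -/
def mulH (h : ℂ) : PH h →ₗ[ℂ] PH h →ₗ[ℂ] PH h :=
  TensorProduct.map₂ (starH h) (LinearMap.mul ℂ (Lam h))

/-- The parity involution of `P⁺_h(4)`: `+1` on even and `-1` on odd elements. -/
def parity (h : ℂ) : PH h →ₗ[ℂ] PH h :=
  LinearMap.lTensor PPlus (CliffordAlgebra.involute (Q := quad h)).toLinearMap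

/-- The even and the odd part of `P⁺_h(4)`. -/
def phPart (h : ℂ) (p : ZMod 2) : Submodule ℂ (PH h) :=
  LinearMap.ker (parity h - sgn p • LinearMap.id)

/-- The projection of `P⁺_h(4)` onto its odd part. -/
def oddProj (h : ℂ) : PH h →ₗ[ℂ] PH h := (2⁻¹ : ℂ) • (LinearMap.id - parity h)

/-- The Lie superbracket `[A, B]_h = h⁻¹ (AB - (-1)^{p(A)p(B)} BA)` of `P⁺_h(4)`, written for
arbitrary elements with odd components `A₁`, `B₁` as `h⁻¹ (AB - BA + 2 B₁ A₁)`. -/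
def brH (h : ℂ) : PH h →ₗ[ℂ] PH h →ₗ[ℂ] PH h :=
  h⁻¹ • (mulH h - (mulH h).flip + (2 : ℂ) • (mulH h).flip.compl₁₂ (oddProj h) (oddProj h))

theorem brH_of_mem (h : ℂ) (p q : ZMod 2) (A B : PH h) (hA : A ∈ phPart h p)
    (hB : B ∈ phPart h q) :
    brH h A B = h⁻¹ • (mulH h A B - sgn (p * q) • mulH h B A) := by
  have hA' : parity h A = sgn p • A := by simpa [phPart, sub_eq_zero] using hA
  have hB' : parity h B = sgn q • B := by simpa [phPart, sub_eq_zero] using hB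
  have h01 : ∀ r : ZMod 2, r = 0 ∨ r = 1 := by decide
  have hA1 : oddProj h A = ((1 - sgn p) / 2) • A := by
    simp only [oddProj, LinearMap.smul_apply, LinearMap.sub_apply, LinearMap.id_apply, hA']
    module
  have hB1 : oddProj h B = ((1 - sgn q) / 2) • B := by
    simp only [oddProj, LinearMap.smul_apply, LinearMap.sub_apply, LinearMap.id_apply, hB']
    module
  simp only [brH, LinearMap.smul_apply, LinearMap.sub_apply, LinearMap.add_apply,
    LinearMap.flip_apply, LinearMap.compl₁₂_apply, hA1, hB1, map_smul]
  congr 1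
  rcases h01 p with rfl | rfl <;> rcases h01 q with rfl | rfl <;>
    (simp [sgn]; try module)

/-- The element `tᵃ τᵇ ⊗ X` of `P⁺_h(4)`. -/
def el (h : ℂ) (a : ℤ) (b : ℕ) (X : Lam h) : PH h := mon a b ⊗ₜ[ℂ] X

/-! ### The embedding `ρ_{α,h}`, the cocycle and the deformation -/

/-- The elements `E¹_{α,h}, …, D⁴_{α,h}` of `P⁺_h(4)`. -/
def rhoVal (α h : ℂ) : Gen → PH h
  | .E1 => el h 2 0 1
  | .H1 => el h 1 1 1 + ((α + 1) / 2 * h) • el h 0 0 1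
  | .F1 => el h 0 2 1 - α • ((2 : ℂ) • el h (-2) 0 (xi h 0 * xi h 1 * eta h 0 * eta h 1) +
      h • el h (-2) 0 (xi h 0 * eta h 0 + xi h 1 * eta h 1) - h • el h (-1) 1 1)
  | .E2 => el h 0 0 (xi h 0 * xi h 1)
  | .H2 => el h 0 0 (xi h 0 * eta h 0 + xi h 1 * eta h 1) - h • el h 0 0 1
  | .F2 => el h 0 0 (eta h 0 * eta h 1)
  | .E3 => el h 0 0 (xi h 0 * eta h 1)
  | .H3 => el h 0 0 (xi h 0 * eta h 0 - xi h 1 * eta h 1)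
  | .F3 => el h 0 0 (xi h 1 * eta h 0)
  | .T1 => el h 1 0 (eta h 0)
  | .T2 => el h 1 0 (eta h 1)
  | .T3 => el h 1 0 (xi h 0)
  | .T4 => el h 1 0 (xi h 1)
  | .D1 => el h 0 1 (xi h 0) + α • el h (-1) 0 (xi h 0 * xi h 1 * eta h 1)
  | .D2 => el h 0 1 (xi h 1) - α • el h (-1) 0 (xi h 0 * xi h 1 * eta h 0)
  | .D3 => el h 0 1 (eta h 0) + α • el h (-1) 0 (eta h 0 * eta h 1 * xi h 1)
  | .D4 => el h 0 1 (eta h 1) - α • el h (-1) 0 (eta h 0 * eta h 1 * xi h 0)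

/-- The embedding `ρ_{α,h} : Γ(2, -1-α, α-1) → P⁺_h(4)`. -/
def rho (α h : ℂ) : Gam →ₗ[ℂ] PH h := ofGen (rhoVal α h)

/-- The values of the cocycle `θ̄₁` on the basis. -/
def thetaVal (α h : ℂ) : Gen → PH h
  | .D1 => el h (-1) 0 (xi h 0)
  | .D2 => el h (-1) 0 (xi h 1)
  | .D3 => el h (-1) 0 (eta h 0)
  | .D4 => el h (-1) 0 (eta h 1)
  | .F1 => (2 : ℂ) • el h (-1) 1 1 + ((α - 1) * h) • el h (-2) 0 1
  | .H1 => el h 0 0 1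
  | _ => 0

/-- The cocycle `θ̄₁`, as a linear map on `Γ(2, -1-α, α-1)`. -/
def theta (α h : ℂ) : Gam →ₗ[ℂ] PH h := ofGen (thetaVal α h)

/-- The values of `ρ₂` on the basis. -/
def rhoTwoVal (h : ℂ) : Gen → PH h
  | .F1 => el h (-2) 0 1
  | _ => 0

/-- The linear map `ρ₂`. -/
def rhoTwo (h : ℂ) : Gam →ₗ[ℂ] PH h := ofGen (rhoTwoVal h)

/-- The coefficients of the series `ρ_{α,h} + β θ̄₁ + β² ρ₂`. -/
def deformation (α h : ℂ) : ℕ → (Gam →ₗ[ℂ] PH h)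
  | 0 => rho α h
  | 1 => theta α h
  | 2 => rhoTwo h
  | _ => 0

/-- The bracket of `Γ(2, -1-α, α-1)`. -/
abbrev gamAlphaBr (α : ℂ) : Gam → Gam → Gam := gamBr 2 (-1 - α) (α - 1)

/-- The cocycles `Z¹(Γ(2, -1-α, α-1), P⁺_h(4))` with respect to `ρ_{α,h}`. -/
abbrev cocyclesAlpha (α h : ℂ) : Submodule ℂ (Gam →ₗ[ℂ] PH h) :=
  Z1 gamPart (gamAlphaBr α) (phPart h) (brH h) (rho α h)

/-- The cohomology space `H¹(Γ(2, -1-α, α-1), P⁺_h(4))` with respect to `ρ_{α,h}`. -/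
abbrev cohomologyAlpha (α h : ℂ) : Type :=
  H1 gamPart (gamAlphaBr α) (phPart h) (brH h) (rho α h)

/-- The class in `H¹(Γ(2, -1-α, α-1), P⁺_h(4))` of a cocycle. -/
abbrev classOf (α h : ℂ) (c : cocyclesAlpha α h) : cohomologyAlpha α h :=
  Submodule.Quotient.mk c

end DTwoOne

end

open scoped TensorProduct

set_option maxSynthPendingDepth 3

noncomputable section

namespace DTwoOne

/-! ### The product `∘_h` is associative -/

/-! Everything is computed in the left regular representation `mulH`, which is multiplicative
(associativity, `mulH_mulH`) and faithful because there is a unit (`mulH_injective`). `Λ_h(4)` is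
the Clifford algebra of `V₂ ⊗ V₃` with the form `ψ₂ ⊗ ψ₃`, so `sp(ψ₂) ⊕ sp(ψ₃) = so(4)` sits in its
quadratic elements. Let `p` be the idempotent `evenProj`, the projection onto even spinors. With `∇
= τ + αh t⁻¹p` and `∇' = τ + αh t⁻¹(1 - p)` the embedding takes a uniform shape: `F¹ = ∇∇'`, and `x
⊗ y ⊗ z` goes to `√2 i (x₁t + x₂∇) v`, where `v` is the Clifford vector of `y ⊗ z`. Since `v∇ = ∇'v`
and `[∇, t] = [∇', t] = h`, all brackets of `Γ(2, -1-α, α-1)` follow (`WeylData.spOne_commutator`,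
`WeylData.spOne_odd`, `WeylData.odd_mul_odd_add_swap`).

This computation uses only the commutation relations recorded in `WeylData`, and these survive the
substitution `τ ↦ τ + βt⁻¹`. The substitution turns `ρ` into `ρ + βθ̄₁ + β²ρ₂`, so this map
preserves brackets for every complex `β` (`rhoDef_br`). Comparing coefficients of `β` gives the
formal deformation, and the coefficient of `β` says that `θ̄₁` is a cocycle.

For the cohomology, a cocycle `c` is normalized by coboundaries. Bracketing with `E¹ = t²` is the
operator `(2t + h∂_τ)∂_τ`, which is surjective with kernel `ker ∂_τ`, so `c(E¹) = 0` can be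
arranged. The values on the `Tⁱ` then lie in `ker ∂_τ` and satisfy a Koszul cocycle condition for
four annihilation operators. The Koszul complex is exact in degree one, so these values can be
removed too (`exists_normalize`). The elements supercommuting with `t²` and all `tv` are the Laurent
polynomials in `t` (`exists_eq_tmul_one`), which restricts the remaining values: `c` vanishes on the
perfect algebra `sp(ψ₂) ⊕ sp(ψ₃)`, and is determined by the Laurent polynomial `c(H¹)`
(`eq_zero_of_normalized`). A Laurent polynomial `B` still acts as a coboundary with value `-tB'` on
`H¹`, so only the constant term of `c(H¹)` survives. It is the coefficient of `θ̄₁`, and it shows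
that `θ̄₁` is not a coboundary. -/

theorem mon_mul_mon (a c : ℤ) (b d : ℕ) : mon a b * mon c d = mon (a + c) (b + d) := by
  simp [mon, AddMonoidAlgebra.single_mul_single]

theorem mon_zero_zero : mon 0 0 = 1 := rfl

theorem dt_mon (a : ℤ) (b : ℕ) : dt (mon a b) = (a : ℂ) • mon (a - 1) b := by
  rw [← monBasis_apply, dt, Module.Basis.constr_basis]

theorem dtau_mon (a : ℤ) (b : ℕ) : dtau (mon a b) = (b : ℂ) • mon a (b - 1) := by
  rw [← monBasis_apply, dtau, Module.Basis.constr_basis]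

/-- Linear maps out of `P⁺` that agree on monomials are equal. -/
theorem pplus_hom_ext {W : Type*} [AddCommGroup W] [Module ℂ W] {f g : PPlus →ₗ[ℂ] W}
    (hfg : ∀ a b, f (mon a b) = g (mon a b)) : f = g :=
  monBasis.ext fun ab => hfg ab.1 ab.2

theorem dtau_pow_mon (n : ℕ) (a : ℤ) (b : ℕ) :
    (dtau ^ n) (mon a b) = (b.descFactorial n : ℂ) • mon a (b - n) := by
  induction n with
  | zero => simp
  | succ n ih =>
    rw [pow_succ', Module.End.mul_apply, ih, map_smul, dtau_mon, smul_smul,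
      Nat.descFactorial_succ, Nat.sub_sub]
    push_cast
    rw [mul_comm]

/-- Left multiplication by `A` in the commutative algebra `P⁺`. -/
abbrev mulL : PPlus →ₗ[ℂ] Module.End ℂ PPlus := LinearMap.mul ℂ PPlus

/-- Left multiplication by `τ` with respect to `∘_h`. -/
def tauOp (h : ℂ) : Module.End ℂ PPlus := mulL (mon 0 1) + h • dt

theorem tauOp_mon (h : ℂ) (a : ℤ) (b : ℕ) :
    tauOp h (mon a b) = mon a (b + 1) + (h * a) • mon (a - 1) b := by
  simp [tauOp, dt_mon, mon_mul_mon, smul_smul, add_comm]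

theorem mulL_mon_pow (n : ℕ) : mulL (mon 0 1) ^ n = mulL (mon 0 n) := by
  induction n with
  | zero => exact LinearMap.ext fun x => by simp [mon_zero_zero]
  | succ n ih =>
    rw [pow_succ, ih]
    refine LinearMap.ext fun x => ?_
    simp [Module.End.mul_apply, ← mul_assoc, mon_mul_mon]

theorem commute_dt_mulL_tau (n : ℕ) : Commute dt (mulL (mon 0 n)) := by
  refine pplus_hom_ext fun a b => ?_
  simp [Module.End.mul_apply, mon_mul_mon, dt_mon]

/-- Since `∂_t` commutes with multiplication by `τ`, the defining sum is the binomial expansion of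
`(τ + h∂_t)^b`. Thus `∘_h` is composition of differential operators, which makes associativity
accessible. -/
theorem starH_mon (h : ℂ) (a : ℤ) (b : ℕ) :
    starH h (mon a b) = mulL (mon a 0) * tauOp h ^ b := by
  rw [← monBasis_apply, starH, Module.Basis.constr_basis, tauOp, add_comm (mulL _),
    Commute.add_pow ((commute_dt_mulL_tau 1).smul_left h), Finset.mul_sum]
  refine Finset.sum_congr rfl fun n _ => ?_
  rw [dtau_pow_mon, mulL_mon_pow, smul_pow, smul_mul_assoc,
    ((commute_dt_mulL_tau (b - n)).pow_left n).eq]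
  have hc : h ^ n / (n.factorial : ℂ) * (b.descFactorial n : ℂ) = h ^ n * (b.choose n : ℂ) := by
    have : (n.factorial : ℂ) ≠ 0 := by exact_mod_cast n.factorial_ne_zero
    rw [Nat.descFactorial_eq_factorial_mul_choose]
    push_cast
    field_simp
  have hcast : ((b.choose n : ℕ) : Module.End ℂ PPlus) = (b.choose n : ℂ) • 1 := by
    rw [Nat.cast_smul_eq_nsmul, nsmul_one]
  rw [hcast]
  refine LinearMap.ext fun x => ?_
  have hm : mon a (b - n) = mon a 0 * mon 0 (b - n) := by simp [mon_mul_mon]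
  simp only [LinearMap.smul_apply, LinearMap.comp_apply, map_smul, Module.End.mul_apply,
    LinearMap.mul_apply', smul_smul, hc, hm, Module.End.one_apply, mul_assoc]
  rw [mul_comm (h ^ n)]

theorem starH_mon_zero (h : ℂ) (a : ℤ) (B : PPlus) : starH h (mon a 0) B = mon a 0 * B := by
  simp [starH_mon]

theorem starH_tau (h : ℂ) (B : PPlus) : starH h (mon 0 1) B = tauOp h B := by
  simp [starH_mon, mon_zero_zero]

theorem starH_mulL (h : ℂ) (a : ℤ) (B : PPlus) :
    starH h (mon a 0 * B) = mulL (mon a 0) * starH h B := by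
  have : (starH h) ∘ₗ mulL (mon a 0) = LinearMap.mulLeft ℂ (mulL (mon a 0)) ∘ₗ starH h := by
    refine pplus_hom_ext fun c d => ?_
    have hm : mulL (mon (a + c) 0) = mulL (mon a 0) * mulL (mon c 0) := by
      refine LinearMap.ext fun x => ?_
      simp [Module.End.mul_apply, ← mul_assoc, mon_mul_mon]
    simp [mon_mul_mon, starH_mon, hm, mul_assoc]
  exact LinearMap.congr_fun this B

theorem tauOp_mul_mulL (h : ℂ) (a : ℤ) :
    tauOp h * mulL (mon a 0) = mulL (mon a 0) * tauOp h + (h * a) • mulL (mon (a - 1) 0) := by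
  refine pplus_hom_ext fun c d => ?_
  simp only [Module.End.mul_apply, LinearMap.mul_apply', LinearMap.add_apply, LinearMap.smul_apply,
    mon_mul_mon, tauOp_mon, mul_add, mul_smul_comm, zero_add]
  rw [show a - 1 + c = a + c - 1 by ring, show a + (c - 1) = a + c - 1 by ring]
  push_cast
  module

theorem starH_tauOp (h : ℂ) (B : PPlus) : starH h (tauOp h B) = tauOp h * starH h B := by
  have : (starH h) ∘ₗ tauOp h = LinearMap.mulLeft ℂ (tauOp h) ∘ₗ starH h := by
    refine pplus_hom_ext fun c d => ?_
    simp only [LinearMap.comp_apply, tauOp_mon, map_add, map_smul, starH_mon,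
      LinearMap.mulLeft_apply]
    rw [← mul_assoc, tauOp_mul_mulL, add_mul, mul_assoc, smul_mul_assoc, pow_succ']
  exact LinearMap.congr_fun this B

/-- Associativity of `∘_h`. It is enough to let `A` be `tᵃ` or `τ`, since `starH_mon` builds every
left multiplication from these two. -/
theorem starH_starH (h : ℂ) (A B : PPlus) : starH h (starH h A B) = starH h A * starH h B := by
  have key : ∀ (b : ℕ) (B : PPlus), starH h ((tauOp h ^ b) B) = tauOp h ^ b * starH h B := by
    intro b
    induction b with
    | zero => simp
    | succ b ih =>
      intro B
      rw [pow_succ', Module.End.mul_apply, starH_tauOp, ih, mul_assoc]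
  have : (starH h) ∘ₗ (starH h).flip B = LinearMap.mulRight ℂ (starH h B) ∘ₗ starH h := by
    refine pplus_hom_ext fun a b => ?_
    simp only [LinearMap.comp_apply, LinearMap.flip_apply, LinearMap.mulRight_apply, starH_mon,
      Module.End.mul_apply, mul_assoc, ← key]
    exact starH_mulL h a _
  exact LinearMap.congr_fun this A

/-! ### The associative algebra `P⁺_h(4)` -/

theorem mulH_tmul (h : ℂ) (A B : PPlus) (X Y : Lam h) :
    mulH h (A ⊗ₜ X) (B ⊗ₜ Y) = starH h A B ⊗ₜ (X * Y) := by
  simp [mulH]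

/-- Left multiplication `A ↦ (B ↦ AB)` is multiplicative, i.e. `P⁺_h(4)` is associative. -/
theorem mulH_mulH (h : ℂ) (A B : PH h) :
    mulH h (mulH h A B) = (mulH h A * mulH h B : Module.End ℂ (PH h)) := by
  induction A using TensorProduct.induction_on with
  | zero => simp
  | add A A' hA hA' => simp only [map_add, LinearMap.add_apply, hA, hA', add_mul]
  | tmul A X =>
    induction B using TensorProduct.induction_on with
    | zero => simp
    | add B B' hB hB' => simp only [map_add, hB, hB', mul_add]
    | tmul B Y =>
      refine TensorProduct.ext' fun C Z => ?_
      simp only [Module.End.mul_apply, mulH_tmul, starH_starH, mul_assoc]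

theorem mulH_assoc (h : ℂ) (A B C : PH h) :
    mulH h (mulH h A B) C = mulH h A (mulH h B C) := by
  rw [mulH_mulH, Module.End.mul_apply]

theorem mulH_el_zero (h : ℂ) (a c : ℤ) (d : ℕ) (X Y : Lam h) :
    mulH h (el h a 0 X) (el h c d Y) = el h (a + c) d (X * Y) := by
  simp [el, mulH_tmul, starH_mon_zero, mon_mul_mon]

theorem mulH_el_tau (h : ℂ) (c : ℤ) (d : ℕ) (X Y : Lam h) :
    mulH h (el h 0 1 X) (el h c d Y) =
      el h c (d + 1) (X * Y) + (h * c) • el h (c - 1) d (X * Y) := by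
  simp [el, mulH_tmul, starH_tau, tauOp_mon, TensorProduct.add_tmul, TensorProduct.smul_tmul']

theorem mulH_one_left (h : ℂ) : mulH h (el h 0 0 1) = (1 : Module.End ℂ (PH h)) := by
  refine TensorProduct.ext' fun C Z => ?_
  rw [el, mulH_tmul, starH_mon_zero]
  simp [mon_zero_zero]

theorem starH_one_right (h : ℂ) (A : PPlus) : starH h A (mon 0 0) = A := by
  have h1 : ∀ b : ℕ, (tauOp h ^ b) (mon 0 0) = mon 0 b := by
    intro b
    induction b with
    | zero => simp
    | succ b ih => simp [pow_succ', Module.End.mul_apply, ih, tauOp_mon]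
  have h2 : (starH h).flip (mon 0 0) = LinearMap.id := by
    refine pplus_hom_ext fun a b => ?_
    simp [starH_mon, Module.End.mul_apply, h1, mon_mul_mon]
  exact LinearMap.congr_fun h2 A

theorem mulH_one_right (h : ℂ) (A : PH h) : mulH h A (el h 0 0 1) = A := by
  have : (mulH h).flip (el h 0 0 1) = LinearMap.id := by
    refine TensorProduct.ext' fun B Y => ?_
    simp [el, mulH_tmul, starH_one_right]
  exact LinearMap.congr_fun this A

/-- The left regular representation of `P⁺_h(4)` is faithful. -/
theorem mulH_injective (h : ℂ) : Function.Injective (mulH h) := fun A B hAB => by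
  rw [← mulH_one_right h A, hAB, mulH_one_right]

/-! ### Normal ordering in `Λ_h(4)` -/

section NormalOrder

variable (h : ℂ)

@[simp]
theorem xi_mul_self (i : Fin 2) : xi h i * xi h i = 0 := by
  have h0 : quad h (Pi.single i 1, 0) = 0 := by simp [quad]
  rw [xi, CliffordAlgebra.ι_sq_scalar, h0, map_zero]

@[simp]
theorem eta_mul_self (i : Fin 2) : eta h i * eta h i = 0 := by
  have h0 : quad h (0, Pi.single i 1) = 0 := by simp [quad]
  rw [eta, CliffordAlgebra.ι_sq_scalar, h0, map_zero]

-- The variants with a trailing factor `z` let normal ordering act inside right-associated products.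
-- The rules push words towards the order `ξ₁, ξ₂, η₁, η₂`.
@[simp]
theorem xi_mul_self_mul (i : Fin 2) (z : Lam h) : xi h i * (xi h i * z) = 0 := by
  rw [← mul_assoc, xi_mul_self, zero_mul]

@[simp]
theorem eta_mul_self_mul (i : Fin 2) (z : Lam h) : eta h i * (eta h i * z) = 0 := by
  rw [← mul_assoc, eta_mul_self, zero_mul]

@[simp]
theorem xi_one_mul_xi_zero : xi h 1 * xi h 0 = -(xi h 0 * xi h 1) := xi_mul_xi h 1 0

@[simp]
theorem xi_one_mul_xi_zero_mul (z : Lam h) :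
    xi h 1 * (xi h 0 * z) = -(xi h 0 * (xi h 1 * z)) := by
  rw [← mul_assoc, xi_one_mul_xi_zero, neg_mul, mul_assoc]

@[simp]
theorem eta_one_mul_eta_zero : eta h 1 * eta h 0 = -(eta h 0 * eta h 1) := eta_mul_eta h 1 0

@[simp]
theorem eta_one_mul_eta_zero_mul (z : Lam h) :
    eta h 1 * (eta h 0 * z) = -(eta h 0 * (eta h 1 * z)) := by
  rw [← mul_assoc, eta_one_mul_eta_zero, neg_mul, mul_assoc]

@[simp]
theorem eta_mul_xi_self (i : Fin 2) : eta h i * xi h i = h • 1 - xi h i * eta h i := by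
  rw [eta_mul_xi, if_pos rfl, Algebra.algebraMap_eq_smul_one]

@[simp]
theorem eta_mul_xi_self_mul (i : Fin 2) (z : Lam h) :
    eta h i * (xi h i * z) = h • z - xi h i * (eta h i * z) := by
  rw [← mul_assoc, eta_mul_xi_self, sub_mul, mul_assoc, smul_mul_assoc, one_mul]

theorem eta_mul_xi_of_ne {i j : Fin 2} (hij : i ≠ j) :
    eta h i * xi h j = -(xi h j * eta h i) := by
  rw [eta_mul_xi, if_neg hij, map_zero, zero_sub]

@[simp]
theorem eta_zero_mul_xi_one : eta h 0 * xi h 1 = -(xi h 1 * eta h 0) :=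
  eta_mul_xi_of_ne h (by decide)

@[simp]
theorem eta_one_mul_xi_zero : eta h 1 * xi h 0 = -(xi h 0 * eta h 1) :=
  eta_mul_xi_of_ne h (by decide)

@[simp]
theorem eta_zero_mul_xi_one_mul (z : Lam h) :
    eta h 0 * (xi h 1 * z) = -(xi h 1 * (eta h 0 * z)) := by
  rw [← mul_assoc, eta_zero_mul_xi_one, neg_mul, mul_assoc]

@[simp]
theorem eta_one_mul_xi_zero_mul (z : Lam h) :
    eta h 1 * (xi h 0 * z) = -(xi h 0 * (eta h 1 * z)) := by
  rw [← mul_assoc, eta_one_mul_xi_zero, neg_mul, mul_assoc]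

end NormalOrder

/-! ### The spin representation of `sp(ψ₂) ⊕ sp(ψ₃)` in `Λ_h(4)` -/

theorem entry_one_one (A : sp) : entry 1 1 A = -entry 0 0 A := by
  have := A.2 (e 0) (e 1)
  simp [psi, e] at this
  simp [entry, e]
  linear_combination this

theorem sp_apply_zero (A : sp) (x : V) : A.1 x 0 = entry 0 0 A * x 0 + entry 0 1 A * x 1 := by
  have hx : x = x 0 • e 0 + x 1 • e 1 := by
    ext i; fin_cases i <;> simp [e]
  conv_lhs => rw [hx]
  simp [entry, mul_comm]

theorem sp_apply_one (A : sp) (x : V) : A.1 x 1 = entry 1 0 A * x 0 - entry 0 0 A * x 1 := by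
  have hx : x = x 0 • e 0 + x 1 • e 1 := by
    ext i; fin_cases i <;> simp [e]
  have h1 := entry_one_one A
  conv_lhs => rw [hx]
  simp [entry, mul_comm] at h1 ⊢
  rw [h1]
  ring

theorem entry_spBr (A B : sp) :
    entry 0 0 (spBr A B) = entry 0 1 A * entry 1 0 B - entry 0 1 B * entry 1 0 A ∧
    entry 0 1 (spBr A B) = 2 * (entry 0 0 A * entry 0 1 B - entry 0 0 B * entry 0 1 A) ∧
    entry 1 0 (spBr A B) = 2 * (entry 1 0 A * entry 0 0 B - entry 1 0 B * entry 0 0 A) := by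
  have hd : ∀ i j, entry i j (spBr A B) = A.1 (B.1 (e j)) i - B.1 (A.1 (e j)) i := fun i j => rfl
  refine ⟨?_, ?_, ?_⟩ <;> rw [hd] <;> simp only [sp_apply_zero, sp_apply_one] <;> simp [e] <;> ring

theorem entry_pMap (x y : V) :
    entry 0 0 (pMap x y) = -(x 0 * y 1 + x 1 * y 0) ∧
    entry 0 1 (pMap x y) = 2 * (x 0 * y 0) ∧ entry 1 0 (pMap x y) = -(2 * (x 1 * y 1)) := by
  refine ⟨?_, ?_, ?_⟩ <;> simp [entry, pMap, psi, e] <;> ring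

theorem psi_apply (x y : V) : psi x y = x 0 * y 1 - x 1 * y 0 := rfl

section Spin

variable (h : ℂ)

/-- The image of `A ∈ sp(ψ₂)` in `Λ_h(4)`. -/
def spinTwo (A : sp) : Lam h :=
  entry 1 0 A • (xi h 0 * xi h 1) -
    entry 0 0 A • (xi h 0 * eta h 0 + xi h 1 * eta h 1 - h • 1) - entry 0 1 A • (eta h 0 * eta h 1)

/-- The image of `A ∈ sp(ψ₃)` in `Λ_h(4)`. -/
def spinThree (A : sp) : Lam h :=
  -(entry 1 0 A • (xi h 0 * eta h 1)) -
    entry 0 0 A • (xi h 0 * eta h 0 - xi h 1 * eta h 1) - entry 0 1 A • (xi h 1 * eta h 0)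

/-- The image of `y ⊗ z ∈ V₂ ⊗ V₃` in the span of the generators of `Λ_h(4)`. -/
def vec (y z : V) : Lam h :=
  (y 0 * z 0) • eta h 0 + (y 0 * z 1) • eta h 1 - (y 1 * z 0) • xi h 1 + (y 1 * z 1) • xi h 0

/-- The projection onto the even part of the Fock space `ℂ[ξ₁, ξ₂]`. -/
def evenProj : Lam h :=
  1 - h⁻¹ • (xi h 0 * eta h 0 + xi h 1 * eta h 1) -
    (2 * h⁻¹ ^ 2) • (xi h 0 * xi h 1 * eta h 0 * eta h 1)

/-- The Clifford relation of the quadratic space `V₂ ⊗ V₃`, whose symmetric form is the product of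
the two skew forms. -/
theorem vec_mul_vec_add_swap (y z y' z' : V) :
    vec h y z * vec h y' z' + vec h y' z' * vec h y z = (h * (psi y y' * psi z z')) • 1 := by
  simp only [vec, psi_apply, mul_add, add_mul, mul_sub, sub_mul, smul_mul_smul_comm, xi_mul_self,
    eta_mul_self, xi_one_mul_xi_zero, eta_one_mul_eta_zero, eta_mul_xi_self, eta_zero_mul_xi_one,
    eta_one_mul_xi_zero]
  module

theorem spinTwo_commutator (A B : sp) :
    spinTwo h A * spinTwo h B - spinTwo h B * spinTwo h A = h • spinTwo h (spBr A B) := by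
  obtain ⟨h0, h1, h2⟩ := entry_spBr A B
  simp [spinTwo, h0, h1, h2, mul_add, add_mul, mul_sub, sub_mul, mul_assoc]
  module

theorem spinThree_commutator (A B : sp) :
    spinThree h A * spinThree h B - spinThree h B * spinThree h A =
      h • spinThree h (spBr A B) := by
  obtain ⟨h0, h1, h2⟩ := entry_spBr A B
  simp [spinThree, h0, h1, h2, mul_add, mul_sub, sub_mul, mul_assoc]
  module

theorem spinTwo_mul_spinThree (A B : sp) :
    spinTwo h A * spinThree h B = spinThree h B * spinTwo h A := by
  simp only [spinTwo, spinThree, mul_add, add_mul, mul_sub, sub_mul, mul_assoc, smul_mul_assoc,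
    mul_smul_comm, mul_neg, neg_mul, mul_one, one_mul, xi_mul_self, eta_mul_self, xi_mul_self_mul,
    eta_mul_self_mul, xi_one_mul_xi_zero, xi_one_mul_xi_zero_mul, eta_one_mul_eta_zero,
    eta_one_mul_eta_zero_mul, eta_mul_xi_self, eta_mul_xi_self_mul, eta_zero_mul_xi_one,
    eta_zero_mul_xi_one_mul, eta_one_mul_xi_zero_mul, mul_zero]
  module

theorem spinTwo_vec (A : sp) (y z : V) :
    spinTwo h A * vec h y z - vec h y z * spinTwo h A = h • vec h (A.1 y) z := by
  simp [spinTwo, vec, sp_apply_zero, sp_apply_one, mul_add, add_mul, mul_sub, sub_mul, mul_assoc]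
  module

theorem spinThree_vec (A : sp) (y z : V) :
    spinThree h A * vec h y z - vec h y z * spinThree h A = h • vec h y (A.1 z) := by
  simp [spinThree, vec, sp_apply_zero, sp_apply_one, mul_add, add_mul, mul_sub, sub_mul, mul_assoc]
  module

variable {h}

theorem evenProj_mul_self (hh : h ≠ 0) : evenProj h * evenProj h = evenProj h := by
  simp [evenProj, mul_add, add_mul, mul_sub, sub_mul, mul_assoc]
  match_scalars <;> field_simp <;> ring

/-- A Clifford vector exchanges even and odd spinors. -/
theorem evenProj_mul_vec (hh : h ≠ 0) (y z : V) :
    evenProj h * vec h y z = vec h y z * (1 - evenProj h) := by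
  simp [evenProj, vec, mul_add, add_mul, mul_sub, sub_mul, mul_assoc]
  match_scalars <;> field_simp <;> ring

/-- Commutators of Clifford vectors span `so(4) = sp(ψ₂) ⊕ sp(ψ₃)`. The first ideal acts only on
even spinors and the second only on odd ones, so multiplying by `p` isolates the `sp(ψ₂)` component
and multiplying by `1 - p` the other. -/
theorem evenProj_mul_vec_commutator (hh : h ≠ 0) (y z y' z' : V) :
    evenProj h * (vec h y' z' * vec h y z - vec h y z * vec h y' z') =
      psi z z' • spinTwo h (pMap y y') := by
  obtain ⟨h0, h1, h2⟩ := entry_pMap y y'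
  simp [evenProj, vec, spinTwo, psi_apply, h0, h1, h2, mul_add, add_mul, mul_sub, sub_mul, mul_assoc]
  match_scalars <;> field_simp <;> ring

theorem one_sub_evenProj_mul_vec_commutator (hh : h ≠ 0) (y z y' z' : V) :
    (1 - evenProj h) * (vec h y' z' * vec h y z - vec h y z * vec h y' z') =
      psi y y' • spinThree h (pMap z z') := by
  obtain ⟨h0, h1, h2⟩ := entry_pMap z z'
  simp [evenProj, vec, spinThree, psi_apply, h0, h1, h2, mul_add, add_mul, mul_sub, sub_mul,
    mul_assoc]
  match_scalars <;> field_simp <;> ring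

end Spin

/-! ### Homomorphisms from `Γ(2, -1-α, α-1)` to associative algebras -/

theorem oddPart_induction {motive : OddPart → Prop} (zero : motive 0)
    (add : ∀ u v, motive u → motive v → motive (u + v))
    (tmul : ∀ x y z : V, motive ((x ⊗ₜ y) ⊗ₜ z)) (u : OddPart) : motive u := by
  induction u using TensorProduct.induction_on with
  | zero => exact zero
  | add u v hu hv => exact add u v hu hv
  | tmul w z =>
    induction w using TensorProduct.induction_on with
    | zero => simpa using zero
    | add w w' hw hw' => simpa [TensorProduct.add_tmul] using add _ _ hw hw'
    | tmul x y => exact tmul x y z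

/-- The even element `A + B + C` of `Γ`. -/
def ev (A B C : sp) : Gam := ((A, B, C), 0)

/-- The odd element `u` of `Γ`. -/
def od (u : OddPart) : Gam := (0, u)

theorem evenProj_commute_spinTwo {h : ℂ} (hh : h ≠ 0) (A : sp) :
    evenProj h * spinTwo h A = spinTwo h A * evenProj h := by
  simp [evenProj, spinTwo, mul_add, add_mul, mul_sub, sub_mul, mul_assoc]
  match_scalars <;> field_simp <;> ring

theorem evenProj_commute_spinThree {h : ℂ} (hh : h ≠ 0) (A : sp) :
    evenProj h * spinThree h A = spinThree h A * evenProj h := by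
  simp [evenProj, spinThree, mul_add, add_mul, mul_sub, sub_mul, mul_assoc]
  match_scalars <;> field_simp <;> ring

theorem gamBr_ev_ev (σ₁ σ₂ σ₃ : ℂ) (A B C A' B' C' : sp) :
    gamBr σ₁ σ₂ σ₃ (ev A B C) (ev A' B' C') = ev (spBr A A') (spBr B B') (spBr C C') := by
  simp [gamBr, ev, pOdd]

theorem gamBr_ev_od (σ₁ σ₂ σ₃ : ℂ) (A B C : sp) (u : OddPart) :
    gamBr σ₁ σ₂ σ₃ (ev A B C) (od u) = od (act (A, B, C) u) := by
  have h0 : ∀ A : sp, spBr A 0 = 0 := fun A => by ext1; simp [spBr]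
  simp [gamBr, ev, od, pOdd, h0]

theorem gamBr_od_od (σ₁ σ₂ σ₃ : ℂ) (u v : OddPart) :
    gamBr σ₁ σ₂ σ₃ (od u) (od v) = ev (σ₁ • pOne u v) (σ₂ • pTwo u v) (σ₃ • pThree u v) := by
  have h0 : spBr 0 0 = 0 := by ext1; simp [spBr]
  have h1 : ∀ u, act 0 u = 0 := fun u => by
    simp [act]
  simp [gamBr, ev, od, pOdd, h0, h1]

theorem sqrtTwoI_mul_self : sqrtTwoI * sqrtTwoI = -2 := by
  have : (Real.sqrt 2 : ℂ) * Real.sqrt 2 = 2 := by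
    rw [← Complex.ofReal_mul, Real.mul_self_sqrt (by norm_num)]; norm_num
  rw [sqrtTwoI, mul_mul_mul_comm, this, Complex.I_mul_I]
  norm_num

/-- Data in an associative algebra `R` satisfying the relations between `t`, `s = t⁻¹`, `τ` and
the elements of `Λ_h(4)` in `P⁺_h(4)`. -/
structure WeylData (h : ℂ) (R : Type*) [Ring R] [Algebra ℂ R] where
  j : Lam h →ₐ[ℂ] R
  t : R
  s : R
  τ : R
  t_mul_s : t * s = 1
  s_mul_t : s * t = 1
  τ_mul_t : τ * t = t * τ + h • 1
  j_mul_t : ∀ X, j X * t = t * j X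
  j_mul_s : ∀ X, j X * s = s * j X
  j_mul_τ : ∀ X, j X * τ = τ * j X

/-! ### The operators `∇`, `∇'` and the uniform description of the embedding. -/

namespace WeylData

variable {h : ℂ} {R : Type*} [Ring R] [Algebra ℂ R] (w : WeylData h R) (α : ℂ)

theorem t_mul_s_mul (z : R) : w.t * (w.s * z) = z := by rw [← mul_assoc, w.t_mul_s, one_mul]

theorem s_mul_t_mul (z : R) : w.s * (w.t * z) = z := by rw [← mul_assoc, w.s_mul_t, one_mul]

theorem τ_mul_s : w.τ * w.s = w.s * w.τ - h • (w.s * w.s) := by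
  -- The relation between `τ` and `t⁻¹` comes from the one between `τ` and `t`, multiplied by `t⁻¹`
  -- on both sides.
  have h1 : w.s * (w.τ * w.t) * w.s = w.τ * w.s + h • (w.s * w.s) := by
    rw [w.τ_mul_t]
    simp only [mul_add, add_mul, mul_assoc, s_mul_t_mul, mul_smul_comm, smul_mul_assoc, one_mul]
  rw [eq_sub_iff_add_eq, ← h1]
  simp only [mul_assoc, w.t_mul_s, mul_one]

theorem τ_mul_t_mul (z : R) : w.τ * (w.t * z) = w.t * (w.τ * z) + h • z := by
  rw [← mul_assoc, w.τ_mul_t, add_mul, mul_assoc, smul_mul_assoc, one_mul]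

theorem τ_mul_s_mul (z : R) : w.τ * (w.s * z) = w.s * (w.τ * z) - h • (w.s * (w.s * z)) := by
  rw [← mul_assoc, w.τ_mul_s, sub_mul, mul_assoc, smul_mul_assoc, mul_assoc]

theorem j_mul_t_mul (X : Lam h) (z : R) : w.j X * (w.t * z) = w.t * (w.j X * z) := by
  rw [← mul_assoc, w.j_mul_t, mul_assoc]

theorem j_mul_s_mul (X : Lam h) (z : R) : w.j X * (w.s * z) = w.s * (w.j X * z) := by
  rw [← mul_assoc, w.j_mul_s, mul_assoc]

theorem j_mul_τ_mul (X : Lam h) (z : R) : w.j X * (w.τ * z) = w.τ * (w.j X * z) := by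
  rw [← mul_assoc, w.j_mul_τ, mul_assoc]

theorem j_mul_j (X Y : Lam h) : w.j X * w.j Y = w.j (X * Y) := (map_mul w.j X Y).symm

/-- The operator `∇ = τ + α h t⁻¹ p`. -/
def nabla : R := w.τ + (α * h) • (w.s * w.j (evenProj h))

/-- The operator `∇' = τ + α h t⁻¹ (1 - p)`. -/
def nabla' : R := w.τ + (α * h) • (w.s * w.j (1 - evenProj h))

theorem nabla_mul_t : w.nabla α * w.t = w.t * w.nabla α + h • 1 := by
  simp only [nabla, add_mul, mul_add, smul_mul_assoc, mul_smul_comm, mul_assoc, w.j_mul_t,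
    s_mul_t_mul, t_mul_s_mul, w.τ_mul_t]
  abel

theorem nabla'_mul_t : w.nabla' α * w.t = w.t * w.nabla' α + h • 1 := by
  simp only [nabla', add_mul, mul_add, smul_mul_assoc, mul_smul_comm, mul_assoc, w.j_mul_t,
    s_mul_t_mul, t_mul_s_mul, w.τ_mul_t]
  abel

/-- A vector exchanges `p` and `1 - p`, hence `∇` and `∇'`. This exchange is what makes the odd
elements close up. -/
theorem j_vec_mul_nabla (hh : h ≠ 0) (y z : V) :
    w.j (vec h y z) * w.nabla α = w.nabla' α * w.j (vec h y z) := by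
  have h1 : (1 - evenProj h) * vec h y z = vec h y z * evenProj h := by
    rw [sub_mul, evenProj_mul_vec hh]; noncomm_ring
  simp only [nabla, nabla', mul_add, add_mul, mul_smul_comm, smul_mul_assoc, mul_assoc, j_mul_s_mul,
    w.j_mul_τ, j_mul_j, h1]

theorem j_vec_mul_nabla' (hh : h ≠ 0) (y z : V) :
    w.j (vec h y z) * w.nabla' α = w.nabla α * w.j (vec h y z) := by
  simp only [nabla, nabla', mul_add, add_mul, mul_smul_comm, smul_mul_assoc, mul_assoc, j_mul_s_mul,
    w.j_mul_τ, j_mul_j, evenProj_mul_vec hh]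

/-- The images of the basis of `Γ(2, -1-α, α-1)`. -/
def val : Gen → R
  | .E1 => w.t * w.t
  | .H1 => w.t * w.τ + ((α + 1) / 2 * h) • 1
  | .F1 => w.τ * w.τ - α • ((2 : ℂ) • (w.s * w.s * w.j (xi h 0 * xi h 1 * eta h 0 * eta h 1)) +
      h • (w.s * w.s * w.j (xi h 0 * eta h 0 + xi h 1 * eta h 1)) - h • (w.s * w.τ))
  | .E2 => w.j (xi h 0 * xi h 1)
  | .H2 => w.j (xi h 0 * eta h 0 + xi h 1 * eta h 1) - h • 1
  | .F2 => w.j (eta h 0 * eta h 1)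
  | .E3 => w.j (xi h 0 * eta h 1)
  | .H3 => w.j (xi h 0 * eta h 0 - xi h 1 * eta h 1)
  | .F3 => w.j (xi h 1 * eta h 0)
  | .T1 => w.t * w.j (eta h 0)
  | .T2 => w.t * w.j (eta h 1)
  | .T3 => w.t * w.j (xi h 0)
  | .T4 => w.t * w.j (xi h 1)
  | .D1 => w.τ * w.j (xi h 0) + α • (w.s * w.j (xi h 0 * xi h 1 * eta h 1))
  | .D2 => w.τ * w.j (xi h 1) - α • (w.s * w.j (xi h 0 * xi h 1 * eta h 0))
  | .D3 => w.τ * w.j (eta h 0) + α • (w.s * w.j (eta h 0 * eta h 1 * xi h 1))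
  | .D4 => w.τ * w.j (eta h 1) - α • (w.s * w.j (eta h 0 * eta h 1 * xi h 0))

/-- The image of `A ∈ sp(ψ₁)`. -/
def spOne (A : sp) : R :=
  entry 0 0 A • (w.t * w.τ + ((α + 1) / 2 * h) • 1) - entry 0 1 A • ((2⁻¹ : ℂ) • (w.t * w.t)) +
    entry 1 0 A • ((2⁻¹ : ℂ) • (w.nabla α * w.nabla' α))

/-- The image of `x ⊗ y ⊗ z ∈ V₁ ⊗ V₂ ⊗ V₃`, up to the factor `√2 i`. -/
def odd (x y z : V) : R := (x 0 • w.t + x 1 • w.nabla α) * w.j (vec h y z)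

/-- The `α²` term of the product contains `p(1 - p) = 0`. The rest is `τ² + αh t⁻¹τ - αh² t⁻²(1 -
p)`, and expanding `1 - p` gives the stated `F¹`. -/
theorem val_F1 (hh : h ≠ 0) : w.val α .F1 = w.nabla α * w.nabla' α := by
  have h0 : evenProj h * (1 - evenProj h) = 0 := by
    rw [mul_sub, evenProj_mul_self hh, mul_one, sub_self]
  simp only [val, nabla, nabla', mul_add, add_mul, mul_smul_comm, smul_mul_assoc, mul_assoc,
    j_mul_s_mul, j_mul_j, h0, map_zero, mul_zero, smul_zero, add_zero, τ_mul_s_mul, w.j_mul_τ]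
  simp only [evenProj, map_sub, map_add, map_smul, map_one, mul_sub, mul_add, mul_smul_comm,
    mul_one, mul_assoc]
  match_scalars <;> field_simp <;> ring

theorem ofGen_ev (hh : h ≠ 0) (A B C : sp) :
    ofGen (w.val α) (ev A B C) =
      w.spOne α A + w.j (spinTwo h B) + w.j (spinThree h C) := by
  rw [spOne, ← val_F1 w α hh]
  simp only [ofGen, ev, LinearMap.coprod_apply, map_zero, add_zero, LinearMap.add_apply,
    LinearMap.sub_apply, LinearMap.neg_apply, LinearMap.smulRight_apply, spinTwo, spinThree,
    map_sub, map_add, map_neg, map_smul, map_one]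
  simp only [val, map_sub, map_add]
  module

/-- The cubic corrections in `D¹, …, D⁴` are `αh t⁻¹ p v` for the corresponding vectors `v`; for
instance `h p ξ₁ = ξ₁ξ₂η₂`. Hence each `Dⁱ` is `∇` times a Clifford vector, just as each `Tⁱ` is `t`
times one. -/
theorem ofGen_od (hh : h ≠ 0) (x y z : V) :
    ofGen (w.val α) (od ((x ⊗ₜ y) ⊗ₜ z)) = sqrtTwoI • w.odd α x y z := by
  have hx : ∀ x : V, x = x 0 • e 0 + x 1 • e 1 := fun x => by
    ext i; fin_cases i <;> simp [e]
  have h1 : od ((x ⊗ₜ y) ⊗ₜ z) = ∑ i, ∑ j, ∑ k, (x i * y j * z k) • oddVec i j k := by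
    conv_lhs => rw [hx x, hx y, hx z]
    simp only [od, oddVec, Fin.sum_univ_two, TensorProduct.add_tmul, TensorProduct.tmul_add,
      ← TensorProduct.smul_tmul', TensorProduct.tmul_smul, Prod.smul_mk, smul_zero,
      Prod.mk_add_mk, add_zero]
    congr 1
    module
  rw [h1]
  simp only [map_add, map_smul, ofGen_oddVec, Fin.sum_univ_two, ofGenOdd]
  simp only [val, odd, nabla, vec, evenProj, map_sub, map_add, map_smul, map_one, mul_sub, mul_add,
    mul_smul_comm, smul_mul_assoc, add_mul, sub_mul, mul_one, mul_assoc, j_mul_j]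
  simp [mul_sub, mul_add]
  match_scalars <;> field_simp <;> ring

/-! ### The bracket relations of `Γ(2, -1-α, α-1)` in a Weyl datum. -/

theorem nabla_mul_nabla'_sub :
    w.nabla α * w.nabla' α - w.nabla' α * w.nabla α =
      (α * h ^ 2) • (w.s * (w.s * w.j ((2 : ℂ) • evenProj h - 1))) := by
  have h0 : evenProj h * (1 - evenProj h) = (1 - evenProj h) * evenProj h := by noncomm_ring
  simp only [nabla, nabla', mul_add, add_mul, mul_smul_comm, smul_mul_assoc, mul_assoc,
    j_mul_s_mul, j_mul_j, τ_mul_s_mul, w.j_mul_τ, h0]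
  simp only [map_sub, map_one, map_smul, mul_sub, mul_smul_comm, mul_one]
  module

theorem nabla_add_nabla' : w.nabla α + w.nabla' α = (2 : ℂ) • w.τ + (α * h) • w.s := by
  simp only [nabla, nabla', map_sub, map_one, mul_sub, mul_one]
  module

theorem nabla_nabla'_mul_t :
    w.nabla α * w.nabla' α * w.t =
      w.t * (w.nabla α * w.nabla' α) + h • (w.nabla α + w.nabla' α) := by
  rw [mul_assoc, nabla'_mul_t, mul_add, ← mul_assoc, nabla_mul_t, add_mul, mul_assoc,
    smul_mul_assoc, mul_smul_comm, one_mul, mul_one]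
  module

/-- `t²`, `tτ` and `∇∇'` form an `sl₂` triple: `∇` and `∇'` are homogeneous of degree `-1` under
`tτ`, and `[∇∇', t] = h(∇ + ∇') = h(2τ + αh t⁻¹)`. Commuting with a second `t` produces the constant
`(α + 1)h/2` in `H¹`. -/
theorem spOne_commutator (A B : sp) :
    w.spOne α A * w.spOne α B - w.spOne α B * w.spOne α A = h • w.spOne α (spBr A B) := by
  obtain ⟨h0, h1, h2⟩ := entry_spBr A B
  have hEH : w.t * w.τ * (w.t * w.t) = w.t * w.t * (w.t * w.τ) + (2 * h) • (w.t * w.t) := by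
    simp only [mul_assoc, τ_mul_t_mul, w.τ_mul_t, mul_add, mul_smul_comm, mul_one]
    module
  have hEF : w.nabla α * w.nabla' α * (w.t * w.t) =
      w.t * w.t * (w.nabla α * w.nabla' α) +
        (4 * h) • (w.t * w.τ + ((α + 1) / 2 * h) • 1) := by
    rw [← mul_assoc, nabla_nabla'_mul_t, add_mul, mul_assoc w.t, nabla_nabla'_mul_t,
      nabla_add_nabla']
    simp only [mul_add, add_mul, mul_smul_comm, smul_mul_assoc, w.τ_mul_t, w.t_mul_s, w.s_mul_t,
      mul_assoc]
    module
  have hn : w.t * w.τ * w.nabla α = w.nabla α * (w.t * w.τ) - h • w.nabla α := by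
    simp only [nabla, mul_add, add_mul, mul_smul_comm, smul_mul_assoc, mul_assoc, j_mul_t_mul,
      w.j_mul_τ, τ_mul_s_mul, τ_mul_t_mul, mul_sub, t_mul_s_mul, s_mul_t_mul]
    module
  have hn' : w.t * w.τ * w.nabla' α = w.nabla' α * (w.t * w.τ) - h • w.nabla' α := by
    simp only [nabla', mul_add, add_mul, mul_smul_comm, smul_mul_assoc, mul_assoc, j_mul_t_mul,
      w.j_mul_τ, τ_mul_s_mul, τ_mul_t_mul, mul_sub, t_mul_s_mul, s_mul_t_mul]
    module
  have hHF : w.t * w.τ * (w.nabla α * w.nabla' α) =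
      w.nabla α * w.nabla' α * (w.t * w.τ) - (2 * h) • (w.nabla α * w.nabla' α) := by
    rw [← mul_assoc, hn, sub_mul, mul_assoc, hn', mul_sub, mul_smul_comm, smul_mul_assoc,
      ← mul_assoc]
    module
  rw [spOne, spOne, spOne, h0, h1, h2]
  simp only [mul_add, add_mul, mul_sub, sub_mul, mul_smul_comm, smul_mul_assoc, one_mul, mul_one,
    hEH, hEF, hHF]
  module

theorem spOne_mul_j (A : sp) {X : Lam h} (hX : evenProj h * X = X * evenProj h) :
    w.spOne α A * w.j X = w.j X * w.spOne α A := by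
  have h1 : (1 - evenProj h) * X = X * (1 - evenProj h) := by rw [sub_mul, hX]; noncomm_ring
  have hn : w.nabla α * w.j X = w.j X * w.nabla α := by
    simp only [nabla, mul_add, add_mul, mul_smul_comm, smul_mul_assoc, mul_assoc, j_mul_s_mul,
      w.j_mul_τ, j_mul_j, hX]
  have hn' : w.nabla' α * w.j X = w.j X * w.nabla' α := by
    simp only [nabla', mul_add, add_mul, mul_smul_comm, smul_mul_assoc, mul_assoc, j_mul_s_mul,
      w.j_mul_τ, j_mul_j, h1]
  simp only [spOne, mul_add, add_mul, mul_sub, sub_mul, mul_smul_comm, smul_mul_assoc, mul_assoc,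
    j_mul_t_mul, w.j_mul_t, w.j_mul_τ, hn', one_mul, mul_one]
  rw [← mul_assoc (w.j X) (w.nabla α), ← hn, mul_assoc]

/-- The delicate case is `F¹` against `tv`. Moving `v` across `∇∇'` gives `∇'∇`, which differs from
`∇∇'` by `αh² t⁻²(2p - 1)`. Multiplied by `t`, this combines with `h(2τ + αh t⁻¹)` to give exactly
`2h∇`. -/
theorem spOne_odd (hh : h ≠ 0) (A : sp) (x y z : V) :
    w.spOne α A * w.odd α x y z - w.odd α x y z * w.spOne α A = h • w.odd α (A.1 x) y z := by
  set v := w.j (vec h y z) with hv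
  have hFt : w.nabla α * (w.nabla' α * (w.t * v)) - w.t * (v * (w.nabla α * w.nabla' α)) =
      (2 * h) • (w.nabla α * v) := by
    have h2 : v * (w.nabla α * w.nabla' α) = w.nabla' α * w.nabla α * v := by
      rw [← mul_assoc, hv, j_vec_mul_nabla w α hh, mul_assoc, j_vec_mul_nabla' w α hh, mul_assoc]
    have h3 := nabla_mul_nabla'_sub w α
    have h4 := nabla_nabla'_mul_t w α
    have h5 : w.nabla α * (w.nabla' α * (w.t * v)) = w.nabla α * w.nabla' α * w.t * v := by
      simp only [mul_assoc]
    rw [h2, h5, h4, nabla_add_nabla', sub_eq_iff_eq_add'.mp h3]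
    simp only [nabla, map_sub, map_smul, map_one, mul_sub, mul_smul_comm, mul_one, t_mul_s_mul,
      mul_add, add_mul, smul_mul_assoc, sub_mul, mul_assoc]
    module
  have hFn : v * (w.nabla α * w.nabla' α) = w.nabla' α * (w.nabla α * v) := by
    rw [← mul_assoc, hv, j_vec_mul_nabla w α hh, mul_assoc, j_vec_mul_nabla' w α hh]
  have hHn : w.τ * (w.nabla α * v) = w.nabla α * (w.τ * v) - h • (w.s * (w.nabla α * v) - w.s * (w.τ * v)) := by
    simp only [nabla, mul_add, add_mul, mul_smul_comm, smul_mul_assoc, mul_assoc, hv, j_mul_τ_mul,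
      τ_mul_s_mul]
    module
  have hnt : ∀ z, w.nabla α * (w.t * z) = w.t * (w.nabla α * z) + h • z := fun z => by
    rw [← mul_assoc, nabla_mul_t, add_mul, mul_assoc, smul_mul_assoc, one_mul]
  have hvt : v * w.t = w.t * v := w.j_mul_t _
  have hvt' : ∀ z, v * (w.t * z) = w.t * (v * z) := fun z => w.j_mul_t_mul _ z
  have hvτ : v * w.τ = w.τ * v := w.j_mul_τ _
  have hFt' := sub_eq_iff_eq_add.mp hFt
  simp only [odd, spOne, ← hv, sp_apply_zero, sp_apply_one, mul_add, add_mul, mul_sub, sub_mul,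
    mul_smul_comm, smul_mul_assoc, mul_assoc, hvt, hvt', hvτ, hnt, τ_mul_t_mul, one_mul, mul_one,
    hFt', hFn, hHn, t_mul_s_mul]
  module

/-- The products `a = vv'` and `b = v'v` carry all the Clifford information: `a + b` is a scalar and
yields the `sp(ψ₁)` term, while `p(b - a)` and `(1 - p)(b - a)` are the `sp(ψ₂)` and `sp(ψ₃)` terms.
The factor 2 and the signs anticipate `(√2 i)² = -2`. -/
theorem odd_mul_odd_add_swap (hh : h ≠ 0) (x y z x' y' z' : V) :
    (2 : ℂ) • (w.odd α x y z * w.odd α x' y' z' + w.odd α x' y' z' * w.odd α x y z) =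
      h • ((-2 * (psi y y' * psi z z')) • w.spOne α (pMap x x') +
        ((1 + α) * (psi x x' * psi z z')) • w.j (spinTwo h (pMap y y')) +
        ((1 - α) * (psi x x' * psi y y')) • w.j (spinThree h (pMap z z'))) := by
  set a := w.j (vec h y z) * w.j (vec h y' z') with ha
  set b := w.j (vec h y' z') * w.j (vec h y z) with hb
  obtain ⟨h0, h1, h2⟩ := entry_pMap x x'
  have hab : (h * (psi y y' * psi z z')) • (1 : R) = a + b := by
    rw [ha, hb, j_mul_j, j_mul_j, ← map_add, vec_mul_vec_add_swap, map_smul, map_one]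
  have hS : (psi z z') • w.j (spinTwo h (pMap y y')) = w.j (evenProj h) * (b - a) := by
    rw [ha, hb, j_mul_j, j_mul_j, ← map_sub, j_mul_j, evenProj_mul_vec_commutator hh, map_smul]
  have hS' : (psi y y') • w.j (spinThree h (pMap z z')) = (1 - w.j (evenProj h)) * (b - a) := by
    rw [ha, hb, j_mul_j, j_mul_j, ← map_sub, ← map_one w.j, ← map_sub, j_mul_j,
      one_sub_evenProj_mul_vec_commutator hh, map_smul]
  have hodd : ∀ x y z x' y' z', w.odd α x y z * w.odd α x' y' z' =
      ((x 0 * x' 0) • (w.t * w.t) + (x 0 * x' 1) • (w.t * w.nabla' α) +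
        (x 1 * x' 0) • (w.t * w.nabla α + h • 1) + (x 1 * x' 1) • (w.nabla α * w.nabla' α)) *
      (w.j (vec h y z) * w.j (vec h y' z')) := by
    intro x y z x' y' z'
    have hv : w.j (vec h y z) * (x' 0 • w.t + x' 1 • w.nabla α) =
        (x' 0 • w.t + x' 1 • w.nabla' α) * w.j (vec h y z) := by
      simp only [mul_add, add_mul, mul_smul_comm, smul_mul_assoc, w.j_mul_t,
        j_vec_mul_nabla w α hh]
    have : w.odd α x y z * w.odd α x' y' z' = (x 0 • w.t + x 1 • w.nabla α) *
        (w.j (vec h y z) * (x' 0 • w.t + x' 1 • w.nabla α)) * w.j (vec h y' z') := by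
      simp only [odd, mul_assoc]
    rw [this, hv, ← mul_assoc, mul_assoc, ← nabla_mul_t]
    congr 1
    simp only [mul_add, add_mul, mul_smul_comm, smul_mul_assoc]
    module
  have hn : w.t * w.nabla α = w.t * w.τ + (α * h) • w.j (evenProj h) := by
    simp only [nabla, mul_add, mul_smul_comm, t_mul_s_mul]
  have hn' : w.t * w.nabla' α = w.t * w.τ + (α * h) • (1 - w.j (evenProj h)) := by
    simp only [nabla', mul_add, mul_smul_comm, t_mul_s_mul, map_sub, map_one]
  have hR : h • ((-2 * (psi y y' * psi z z')) • w.spOne α (pMap x x') +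
        ((1 + α) * (psi x x' * psi z z')) • w.j (spinTwo h (pMap y y')) +
        ((1 - α) * (psi x x' * psi y y')) • w.j (spinThree h (pMap z z'))) =
      (-2 : ℂ) • (w.spOne α (pMap x x') * ((h * (psi y y' * psi z z')) • 1)) +
        (h * (1 + α) * psi x x') • ((psi z z') • w.j (spinTwo h (pMap y y'))) +
        (h * (1 - α) * psi x x') • ((psi y y') • w.j (spinThree h (pMap z z'))) := by
    rw [mul_smul_comm, mul_one]
    module
  rw [hR, hab, hS, hS', hodd, hodd, ← ha, ← hb, hn, hn', spOne, h0, h1, h2, psi_apply]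
  simp only [mul_add, add_mul, mul_sub, sub_mul, smul_mul_assoc, one_mul]
  module

theorem ofGen_br_ev_ev (hh : h ≠ 0) (A B C A' B' C' : sp) :
    h • ofGen (w.val α) (gamAlphaBr α (ev A B C) (ev A' B' C')) =
      ofGen (w.val α) (ev A B C) * ofGen (w.val α) (ev A' B' C') -
        ofGen (w.val α) (ev A' B' C') * ofGen (w.val α) (ev A B C) := by
  have c1 := w.spOne_commutator α A A'
  have c2 : w.j (spinTwo h B) * w.j (spinTwo h B') - w.j (spinTwo h B') * w.j (spinTwo h B) =
      h • w.j (spinTwo h (spBr B B')) := by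
    rw [j_mul_j, j_mul_j, ← map_sub, spinTwo_commutator, map_smul]
  have c3 : w.j (spinThree h C) * w.j (spinThree h C') -
      w.j (spinThree h C') * w.j (spinThree h C) = h • w.j (spinThree h (spBr C C')) := by
    rw [j_mul_j, j_mul_j, ← map_sub, spinThree_commutator, map_smul]
  have c12 := fun A B => w.spOne_mul_j α A (evenProj_commute_spinTwo hh B)
  have c13 := fun A B => w.spOne_mul_j α A (evenProj_commute_spinThree hh B)
  have c23 : ∀ B C, w.j (spinTwo h B) * w.j (spinThree h C) =
      w.j (spinThree h C) * w.j (spinTwo h B) := fun B C => by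
    rw [j_mul_j, spinTwo_mul_spinThree, j_mul_j]
  rw [gamAlphaBr, gamBr_ev_ev, ofGen_ev w α hh, ofGen_ev w α hh, ofGen_ev w α hh, smul_add,
    smul_add, ← c1, ← c2, ← c3]
  simp only [mul_add, add_mul, c12, c13, c23]
  abel

theorem ofGen_br_ev_od (hh : h ≠ 0) (A B C : sp) (u : OddPart) :
    h • ofGen (w.val α) (gamAlphaBr α (ev A B C) (od u)) =
      ofGen (w.val α) (ev A B C) * ofGen (w.val α) (od u) -
        ofGen (w.val α) (od u) * ofGen (w.val α) (ev A B C) := by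
  have hod : ∀ u v, od (u + v) = od u + od v := fun u v => by simp [od]
  rw [gamAlphaBr, gamBr_ev_od]
  induction u using oddPart_induction with
  | zero => simp [od, ← Prod.zero_eq_mk]
  | add u v hu hv => rw [map_add, hod, map_add, smul_add, hu, hv, hod, map_add]; noncomm_ring
  | tmul x y z =>
    have hv : ∀ (X : Lam h), evenProj h * X = X * evenProj h →
        w.j X * w.odd α x y z - w.odd α x y z * w.j X =
          (x 0 • w.t + x 1 • w.nabla α) * w.j (X * vec h y z - vec h y z * X) := by
      intro X hX
      have hn : w.j X * w.nabla α = w.nabla α * w.j X := by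
        simp only [nabla, mul_add, add_mul, mul_smul_comm, smul_mul_assoc, mul_assoc, j_mul_s_mul,
          w.j_mul_τ, j_mul_j, hX]
      have hn1 : w.j X * (x 0 • w.t + x 1 • w.nabla α) =
          (x 0 • w.t + x 1 • w.nabla α) * w.j X := by
        simp only [mul_add, add_mul, mul_smul_comm, smul_mul_assoc, w.j_mul_t, hn]
      rw [odd, ← mul_assoc, hn1, map_sub, map_mul, map_mul]
      noncomm_ring
    have c1 := w.spOne_odd α hh A x y z
    have c2 := hv _ (evenProj_commute_spinTwo hh B)
    have c3 := hv _ (evenProj_commute_spinThree hh C)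
    rw [spinTwo_vec, map_smul, mul_smul_comm] at c2
    rw [spinThree_vec, map_smul, mul_smul_comm] at c3
    simp only [act, LinearMap.add_apply, TensorProduct.map_tmul, LinearMap.id_apply, hod, map_add,
      ofGen_od w α hh, ofGen_ev w α hh]
    rw [smul_add, smul_add, smul_comm, ← c1, smul_comm h, smul_comm h]
    rw [show h • w.odd α x (B.1 y) z = _ from c2.symm, show h • w.odd α x y (C.1 z) = _ from c3.symm]
    simp only [mul_add, add_mul, mul_smul_comm, smul_mul_assoc]
    module

theorem ofGen_br_od_od (hh : h ≠ 0) (u v : OddPart) :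
    h • ofGen (w.val α) (gamAlphaBr α (od u) (od v)) =
      ofGen (w.val α) (od u) * ofGen (w.val α) (od v) +
        ofGen (w.val α) (od v) * ofGen (w.val α) (od u) := by
  have hod : ∀ u v, od (u + v) = od u + od v := fun u v => by simp [od]
  have hz : od 0 = 0 := rfl
  have hev : ∀ u u' v : OddPart, gamAlphaBr α (od (u + u')) (od v) =
      gamAlphaBr α (od u) (od v) + gamAlphaBr α (od u') (od v) := fun u u' v => by
    simp [gamAlphaBr, gamBr_od_od, ev]
  have hev' : ∀ u v v' : OddPart, gamAlphaBr α (od u) (od (v + v')) =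
      gamAlphaBr α (od u) (od v) + gamAlphaBr α (od u) (od v') := fun u u' v => by
    simp [gamAlphaBr, gamBr_od_od, ev]
  have hev0 : ∀ v : OddPart, gamAlphaBr α (od 0) (od v) = 0 := fun v => by
    simp [gamAlphaBr, gamBr_od_od, ev]
  have hev0' : ∀ v : OddPart, gamAlphaBr α (od v) (od 0) = 0 := fun v => by
    simp [gamAlphaBr, gamBr_od_od, ev]
  induction u using oddPart_induction with
  | zero => rw [hev0, hz, map_zero]; simp
  | add u u' hu hu' => rw [hev, map_add, smul_add, hu, hu', hod, map_add]; noncomm_ring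
  | tmul x y z =>
    induction v using oddPart_induction with
    | zero => rw [hev0', hz, map_zero]; simp
    | add u u' hu hu' => rw [hev', map_add, smul_add, hu, hu', hod, map_add]; noncomm_ring
    | tmul x' y' z' =>
      have hp := pOdd_tmul 2 (-1 - α) (α - 1) x y z x' y' z'
      have hbr : gamAlphaBr α (od ((x ⊗ₜ y) ⊗ₜ z)) (od ((x' ⊗ₜ y') ⊗ₜ z')) =
          ev ((2 * (psi y y' * psi z z')) • pMap x x')
            (((-1 - α) * (psi x x' * psi z z')) • pMap y y')
            (((α - 1) * (psi x x' * psi y y')) • pMap z z') := by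
        rw [gamAlphaBr, gamBr_od_od, ev, ← pOdd, hp, ev]
        simp only [smul_smul]
      have hO := w.odd_mul_odd_add_swap α hh x y z x' y' z'
      have h1 : ∀ (r : ℂ) A, w.spOne α (r • A) = r • w.spOne α A := fun r A => by
        simp only [spOne, map_smul, smul_eq_mul]; module
      have h2 : ∀ (r : ℂ) A, spinTwo h (r • A) = r • spinTwo h A := fun r A => by
        simp only [spinTwo, map_smul, smul_eq_mul]; module
      have h3 : ∀ (r : ℂ) A, spinThree h (r • A) = r • spinThree h A := fun r A => by
        simp only [spinThree, map_smul, smul_eq_mul]; module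
      rw [hbr, ofGen_ev w α hh, ofGen_od w α hh, ofGen_od w α hh, h1, h2, h3, map_smul, map_smul,
        smul_mul_smul_comm, smul_mul_smul_comm, sqrtTwoI_mul_self, ← smul_add, neg_smul, hO]
      module

end WeylData

/-! ### Linear maps on `Γ` -/

theorem sp_ext {A B : sp} (h00 : entry 0 0 A = entry 0 0 B) (h01 : entry 0 1 A = entry 0 1 B)
    (h10 : entry 1 0 A = entry 1 0 B) : A = B := by
  ext x i
  fin_cases i
  · simp [sp_apply_zero, h00, h01]
  · simp [sp_apply_one, h00, h10]

theorem sp_eq (A : sp) :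
    A = -entry 0 0 A • pMap (e 0) (e 1) + (2⁻¹ * entry 0 1 A) • pMap (e 0) (e 0) -
      (2⁻¹ * entry 1 0 A) • pMap (e 1) (e 1) := by
  have h1 := entry_pMap (e 0) (e 1)
  have h2 := entry_pMap (e 0) (e 0)
  have h3 := entry_pMap (e 1) (e 1)
  apply sp_ext <;> simp [h1, h2, h3] <;> simp [e] <;> ring

theorem eq_ev_add_od (X : Gam) : X = ev X.1.1 X.1.2.1 X.1.2.2 + od X.2 := by
  simp [ev, od]

theorem oddPart_hom_ext {W : Type*} [AddCommGroup W] [Module ℂ W] {f g : Gam →ₗ[ℂ] W}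
    (hfg : ∀ i j k, f (oddVec i j k) = g (oddVec i j k)) (u : OddPart) : f (od u) = g (od u) := by
  have h1 : f ∘ₗ LinearMap.inr ℂ _ _ = g ∘ₗ LinearMap.inr ℂ _ _ := by
    refine oddBasis.ext fun ijk => ?_
    obtain ⟨⟨i, j⟩, k⟩ := ijk
    have h2 : oddBasis ((i, j), k) = (e i ⊗ₜ[ℂ] e j) ⊗ₜ[ℂ] e k := by
      simp [oddBasis, e, Module.Basis.tensorProduct_apply]
    rw [h2]
    exact hfg i j k
  exact LinearMap.congr_fun h1 u

theorem oddVec_eq_smul_gen (i j k : Fin 2) : ∃ (g : Gen) (r : ℂ), oddVec i j k = r • gen g := by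
  have hs := sqrtTwoI_ne_zero
  have key : ∀ (i j k : Fin 2) (g : Gen) (r : ℂ), gen g = r • oddVec i j k → r ≠ 0 →
      ∃ (g : Gen) (r : ℂ), oddVec i j k = r • gen g := fun i j k g r hg hr =>
    ⟨g, r⁻¹, by rw [hg, smul_smul, inv_mul_cancel₀ hr, one_smul]⟩
  have hs' := inv_ne_zero hs
  have hs'' := neg_ne_zero.mpr hs'
  fin_cases i <;> fin_cases j <;> fin_cases k
  · exact key 0 0 0 .T1 _ rfl hs'
  · exact key 0 0 1 .T2 _ rfl hs'
  · exact key 0 1 0 .T4 _ rfl hs''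
  · exact key 0 1 1 .T3 _ rfl hs'
  · exact key 1 0 0 .D3 _ rfl hs'
  · exact key 1 0 1 .D4 _ rfl hs'
  · exact key 1 1 0 .D2 _ rfl hs''
  · exact key 1 1 1 .D1 _ rfl hs'

theorem ev_eq_sum_gen (A B C : sp) :
    ev A B C = entry 0 0 A • gen .H1 - (2⁻¹ * entry 0 1 A) • gen .E1 +
      (2⁻¹ * entry 1 0 A) • gen .F1 - entry 0 0 B • gen .H2 - entry 0 1 B • gen .F2 +
      entry 1 0 B • gen .E2 - entry 0 0 C • gen .H3 - entry 0 1 C • gen .F3 -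
      entry 1 0 C • gen .E3 := by
  have hA := sp_eq A
  have hB := sp_eq B
  have hC := sp_eq C
  simp only [gen, ev, Prod.smul_mk, Prod.mk_add_mk, Prod.mk_sub_mk, smul_zero, add_zero, sub_zero,
    zero_sub]
  congr 1
  refine Prod.ext ?_ (Prod.ext ?_ ?_)
  · conv_lhs => rw [hA]
    simp; module
  · conv_lhs => rw [hB]
    simp; module
  · conv_lhs => rw [hC]
    simp; module

/-- The 17 elements `gen g` span `Γ`. -/
theorem gam_hom_ext {W : Type*} [AddCommGroup W] [Module ℂ W] {f k : Gam →ₗ[ℂ] W}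
    (hfk : ∀ g, f (gen g) = k (gen g)) : f = k := by
  refine LinearMap.ext fun X => ?_
  rw [eq_ev_add_od X, map_add, map_add, ev_eq_sum_gen]
  simp only [map_add, map_sub, map_smul, hfk]
  congr 1
  refine oddPart_hom_ext (fun i j l => ?_) _
  obtain ⟨g, r, hg⟩ := oddVec_eq_smul_gen i j l
  rw [hg, map_smul, map_smul, hfk]

theorem mem_gamPart_zero {X : Gam} : X ∈ gamPart 0 ↔ ∃ A B C, X = ev A B C := by
  constructor
  · intro hX
    have : X.2 = 0 := by simpa [gamPart] using hX
    refine ⟨X.1.1, X.1.2.1, X.1.2.2, ?_⟩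
    rw [ev, ← this]
  · rintro ⟨A, B, C, rfl⟩
    simp [gamPart, ev]

theorem mem_gamPart_one {X : Gam} : X ∈ gamPart 1 ↔ ∃ u, X = od u := by
  constructor
  · intro hX
    have : X.1 = 0 := by simpa [gamPart] using hX
    exact ⟨X.2, by rw [od, ← this]⟩
  · rintro ⟨u, rfl⟩
    simp [gamPart, od]

theorem zmod_two_eq (q : ZMod 2) : q = 0 ∨ q = 1 := by
  revert q; decide

/-- The parity of the basis elements of `Γ`. -/
def genParity : Gen → ZMod 2
  | .E1 | .H1 | .F1 | .E2 | .H2 | .F2 | .E3 | .H3 | .F3 => 0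
  | _ => 1

theorem ofGen_mem_cochains {W : Type*} [AddCommGroup W] [Module ℂ W] {ℋ : ZMod 2 → Submodule ℂ W}
    {v : Gen → W} (hv : ∀ g, v g ∈ ℋ (genParity g)) : ofGen v ∈ cochains gamPart ℋ 0 := by
  intro q X hX
  rw [zero_add]
  obtain rfl | rfl := zmod_two_eq q
  · obtain ⟨A, B, C, rfl⟩ := mem_gamPart_zero.mp hX
    rw [ev_eq_sum_gen]
    simp only [map_add, map_sub, map_smul, ofGen_gen]
    have hv0 : ∀ g, genParity g = 0 → v g ∈ ℋ 0 := fun g hg => hg ▸ hv g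
    apply_rules [Submodule.add_mem, Submodule.sub_mem, Submodule.smul_mem, hv0]
  · obtain ⟨u, rfl⟩ := mem_gamPart_one.mp hX
    -- Modulo `ℋ 1` the values on odd generators vanish, so the composite is the extension of the
    -- values on even generators alone, and that extension is zero on the odd part.
    have h1 : (ℋ 1).mkQ ∘ₗ ofGen v = ofGen fun g => if genParity g = 0 then (ℋ 1).mkQ (v g) else 0 := by
      refine gam_hom_ext fun g => ?_
      rw [LinearMap.comp_apply, ofGen_gen, ofGen_gen]
      split_ifs with hg
      · rfl
      · have : genParity g = 1 := by cases g <;> simp_all [genParity]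
        exact (Submodule.Quotient.mk_eq_zero _).mpr (this ▸ hv g)
    have h2 := oddPart_hom_ext (f := (ℋ 1).mkQ ∘ₗ ofGen v) (g := 0) (fun i j k => by
      rw [h1, ofGen_oddVec]
      fin_cases i <;> fin_cases j <;> fin_cases k <;> simp [ofGenOdd, genParity]) u
    simpa using h2

/-! ### Bilinearity of the bracket of `Γ` -/

theorem spBr_add_left (A A' B : sp) : spBr (A + A') B = spBr A B + spBr A' B := by
  ext1; simp [spBr, add_mul, mul_add]; abel

theorem spBr_add_right (A B B' : sp) : spBr A (B + B') = spBr A B + spBr A B' := by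
  ext1; simp [spBr, add_mul, mul_add]; abel

theorem act_add (A A' : sp × sp × sp) (u : OddPart) : act (A + A') u = act A u + act A' u := by
  simp only [act, Prod.fst_add, Prod.snd_add, Submodule.coe_add, TensorProduct.map_add_left,
    TensorProduct.map_add_right, LinearMap.add_apply]
  abel

theorem gamBr_add_left (σ₁ σ₂ σ₃ : ℂ) (X X' Y : Gam) :
    gamBr σ₁ σ₂ σ₃ (X + X') Y = gamBr σ₁ σ₂ σ₃ X Y + gamBr σ₁ σ₂ σ₃ X' Y := by
  refine Prod.ext (Prod.ext ?_ (Prod.ext ?_ ?_)) ?_ <;>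
    simp only [gamBr, pOdd, Prod.fst_add, Prod.snd_add, map_add, LinearMap.add_apply, smul_add,
      spBr_add_left, act_add] <;> abel

theorem gamBr_add_right (σ₁ σ₂ σ₃ : ℂ) (X Y Y' : Gam) :
    gamBr σ₁ σ₂ σ₃ X (Y + Y') = gamBr σ₁ σ₂ σ₃ X Y + gamBr σ₁ σ₂ σ₃ X Y' := by
  refine Prod.ext (Prod.ext ?_ (Prod.ext ?_ ?_)) ?_ <;>
    simp only [gamBr, pOdd, Prod.fst_add, Prod.snd_add, map_add, smul_add,
      spBr_add_right, act_add] <;> abel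

theorem gamBr_od_ev (σ₁ σ₂ σ₃ : ℂ) (A B C : sp) (u : OddPart) :
    gamBr σ₁ σ₂ σ₃ (od u) (ev A B C) = -gamBr σ₁ σ₂ σ₃ (ev A B C) (od u) := by
  have h0 : ∀ A : sp, spBr 0 A = 0 := fun A => by ext1; simp [spBr]
  have h1 : ∀ A : sp, spBr A 0 = 0 := fun A => by ext1; simp [spBr]
  simp [gamBr, ev, od, pOdd, h0, h1]

/-! ### Parities in `P⁺_h(4)` -/

theorem mem_phPart {h : ℂ} {p : ZMod 2} {A : PH h} :
    A ∈ phPart h p ↔ parity h A = sgn p • A := by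
  simp [phPart, sub_eq_zero]

theorem el_mem_phPart {h : ℂ} {p : ZMod 2} (a : ℤ) (b : ℕ) {X : Lam h}
    (hX : CliffordAlgebra.involute X = sgn p • X) : el h a b X ∈ phPart h p := by
  rw [mem_phPart]
  simp [parity, el, hX]

theorem involute_xi (h : ℂ) (i : Fin 2) : CliffordAlgebra.involute (xi h i) = -xi h i :=
  CliffordAlgebra.involute_ι _

theorem involute_eta (h : ℂ) (i : Fin 2) : CliffordAlgebra.involute (eta h i) = -eta h i :=
  CliffordAlgebra.involute_ι _

theorem sgn_zero : sgn 0 = 1 := by simp [sgn]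

theorem sgn_one : sgn 1 = -1 := by simp [sgn]

theorem rhoVal_mem (α h : ℂ) (g : Gen) : rhoVal α h g ∈ phPart h (genParity g) := by
  cases g <;> simp only [rhoVal, genParity] <;>
    repeat' first
      | apply Submodule.add_mem
      | apply Submodule.sub_mem
      | apply Submodule.smul_mem
      | apply el_mem_phPart
  all_goals simp [involute_xi, involute_eta, sgn_zero, sgn_one]

theorem thetaVal_mem (α h : ℂ) (g : Gen) : thetaVal α h g ∈ phPart h (genParity g) := by
  cases g <;> simp only [thetaVal, genParity] <;>
    repeat' first
      | apply Submodule.zero_mem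
      | apply Submodule.add_mem
      | apply Submodule.smul_mem
      | apply el_mem_phPart
  all_goals simp [involute_xi, involute_eta, sgn_zero, sgn_one]

theorem rhoTwoVal_mem (h : ℂ) (g : Gen) : rhoTwoVal h g ∈ phPart h (genParity g) := by
  cases g <;> simp only [rhoTwoVal, genParity] <;>
    first
      | apply Submodule.zero_mem
      | apply el_mem_phPart
  simp [sgn_zero]

theorem rho_mem (α h : ℂ) : rho α h ∈ cochains gamPart (phPart h) 0 :=
  ofGen_mem_cochains (rhoVal_mem α h)

theorem theta_mem (α h : ℂ) : theta α h ∈ cochains gamPart (phPart h) 0 :=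
  ofGen_mem_cochains (thetaVal_mem α h)

theorem rhoTwo_mem (h : ℂ) : rhoTwo h ∈ cochains gamPart (phPart h) 0 :=
  ofGen_mem_cochains (rhoTwoVal_mem h)

/-! ### The deformed embedding -/

/-- The elements `t`, `t⁻¹`, `τ + β t⁻¹` and `Λ_h(4)` of `P⁺_h(4)`, acting by left
multiplication. -/
def weylData (h β : ℂ) : WeylData h (Module.End ℂ (PH h)) where
  j := AlgHom.ofLinearMap (mulH h ∘ₗ TensorProduct.mk ℂ PPlus (Lam h) (mon 0 0))
    (mulH_one_left h) fun X Y => by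
      have : el h 0 0 (X * Y) = mulH h (el h 0 0 X) (el h 0 0 Y) := by simp [mulH_el_zero]
      exact (congrArg (mulH h) this).trans (mulH_mulH h _ _)
  t := mulH h (el h 1 0 1)
  s := mulH h (el h (-1) 0 1)
  τ := mulH h (el h 0 1 1 + β • el h (-1) 0 1)
  t_mul_s := by rw [← mulH_mulH, mulH_el_zero]; simpa using mulH_one_left h
  s_mul_t := by rw [← mulH_mulH, mulH_el_zero]; simpa using mulH_one_left h
  τ_mul_t := by
    rw [← mulH_mulH, ← mulH_mulH, ← mulH_one_left, ← map_smul, ← map_add]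
    congr 1
    simp [mulH_el_zero, mulH_el_tau]
    abel
  j_mul_t X := by
    change mulH h (el h 0 0 X) * _ = _ * mulH h (el h 0 0 X)
    rw [← mulH_mulH, ← mulH_mulH]
    simp [mulH_el_zero]
  j_mul_s X := by
    change mulH h (el h 0 0 X) * _ = _ * mulH h (el h 0 0 X)
    rw [← mulH_mulH, ← mulH_mulH]
    simp [mulH_el_zero]
  j_mul_τ X := by
    change mulH h (el h 0 0 X) * _ = _ * mulH h (el h 0 0 X)
    rw [← mulH_mulH, ← mulH_mulH]
    simp [mulH_el_zero, mulH_el_tau]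

/-- The linear map `ρ_{α,h} + β θ̄₁ + β² ρ₂`. -/
def rhoDef (α h β : ℂ) : Gam →ₗ[ℂ] PH h := rho α h + β • theta α h + β ^ 2 • rhoTwo h

theorem rhoDef_mem (α h β : ℂ) : rhoDef α h β ∈ cochains gamPart (phPart h) 0 :=
  Submodule.add_mem _ (Submodule.add_mem _ (rho_mem α h) (Submodule.smul_mem _ _ (theta_mem α h)))
    (Submodule.smul_mem _ _ (rhoTwo_mem h))

/-- The deformed map is `ρ` with `τ` replaced by `τ + βt⁻¹`. Only `F¹` is quadratic in `τ`, which is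
why the series stops at `β²` and `ρ₂` is supported on `F¹`. -/
theorem mulH_rhoDef (α h β : ℂ) (X : Gam) :
    mulH h (rhoDef α h β X) = ofGen ((weylData h β).val α) X := by
  have : mulH h ∘ₗ rhoDef α h β = ofGen ((weylData h β).val α) := by
    refine gam_hom_ext fun g => ?_
    have hj : ∀ X, (weylData h β).j X = mulH h (el h 0 0 X) := fun X => rfl
    have ht : (weylData h β).t = mulH h (el h 1 0 1) := rfl
    have hs : (weylData h β).s = mulH h (el h (-1) 0 1) := rfl
    have hτ : (weylData h β).τ = mulH h (el h 0 1 1 + β • el h (-1) 0 1) := rfl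
    have h1 : (1 : Module.End ℂ (PH h)) = mulH h (el h 0 0 1) := (mulH_one_left h).symm
    rw [ofGen_gen, LinearMap.comp_apply, rhoDef, LinearMap.add_apply, LinearMap.add_apply,
      LinearMap.smul_apply, LinearMap.smul_apply, rho, theta, rhoTwo, ofGen_gen, ofGen_gen,
      ofGen_gen]
    cases g <;>
      simp only [rhoVal, thetaVal, rhoTwoVal, WeylData.val, hj, ht, hs, hτ, h1, ← mulH_mulH,
        ← map_add, ← map_sub, ← map_smul] <;> congr 1 <;>
      simp [mulH_el_zero, mulH_el_tau] <;> module
  exact LinearMap.congr_fun this X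

/-- Both sides are compared after left multiplication, which is faithful; there the identity is an
instance of the Weyl datum computation. Splitting `X` and `Y` into even and odd parts fixes the
signs of the superbracket. -/
theorem rhoDef_br (α : ℂ) {h : ℂ} (hh : h ≠ 0) (β : ℂ) (X Y : Gam) :
    rhoDef α h β (gamAlphaBr α X Y) = brH h (rhoDef α h β X) (rhoDef α h β Y) := by
  have hev : ∀ A B C, rhoDef α h β (ev A B C) ∈ phPart h 0 := fun A B C => by
    simpa using rhoDef_mem α h β 0 _ (mem_gamPart_zero.mpr ⟨A, B, C, rfl⟩)
  have hod : ∀ u, rhoDef α h β (od u) ∈ phPart h 1 := fun u => by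
    simpa using rhoDef_mem α h β 1 _ (mem_gamPart_one.mpr ⟨u, rfl⟩)
  have hee : ∀ A B C A' B' C', rhoDef α h β (gamAlphaBr α (ev A B C) (ev A' B' C')) =
      brH h (rhoDef α h β (ev A B C)) (rhoDef α h β (ev A' B' C')) := by
    intro A B C A' B' C'
    rw [brH_of_mem h 0 0 _ _ (hev A B C) (hev A' B' C'), eq_inv_smul_iff₀ hh]
    apply mulH_injective
    simp only [mul_zero, sgn_zero, one_smul, map_smul, map_sub, mulH_mulH]
    simp only [mulH_rhoDef, (weylData h β).ofGen_br_ev_ev α hh]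
  have heo : ∀ A B C u, rhoDef α h β (gamAlphaBr α (ev A B C) (od u)) =
      brH h (rhoDef α h β (ev A B C)) (rhoDef α h β (od u)) := by
    intro A B C u
    rw [brH_of_mem h 0 1 _ _ (hev A B C) (hod u), eq_inv_smul_iff₀ hh]
    apply mulH_injective
    simp only [zero_mul, sgn_zero, one_smul, map_smul, map_sub, mulH_mulH]
    simp only [mulH_rhoDef, (weylData h β).ofGen_br_ev_od α hh]
  have hoe : ∀ A B C u, rhoDef α h β (gamAlphaBr α (od u) (ev A B C)) =
      brH h (rhoDef α h β (od u)) (rhoDef α h β (ev A B C)) := by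
    intro A B C u
    rw [gamAlphaBr, gamBr_od_ev, map_neg, heo, brH_of_mem h 0 1 _ _ (hev A B C) (hod u),
      brH_of_mem h 1 0 _ _ (hod u) (hev A B C)]
    simp only [mul_zero, zero_mul, sgn_zero, one_smul]
    module
  have hoo : ∀ u v, rhoDef α h β (gamAlphaBr α (od u) (od v)) =
      brH h (rhoDef α h β (od u)) (rhoDef α h β (od v)) := by
    intro u v
    rw [brH_of_mem h 1 1 _ _ (hod u) (hod v), eq_inv_smul_iff₀ hh]
    apply mulH_injective
    simp only [mul_one, sgn_one, neg_smul, one_smul, sub_neg_eq_add, map_smul, map_add, mulH_mulH]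
    simp only [mulH_rhoDef, (weylData h β).ofGen_br_od_od α hh]
  rw [eq_ev_add_od X, eq_ev_add_od Y]
  simp only [gamAlphaBr, gamBr_add_left, gamBr_add_right, map_add, LinearMap.add_apply] at *
  rw [hee, heo, hoe, hoo]

/-- Five sample points `0, ±1, ±2` determine a quartic; the coefficients used are the rows of the
inverse Vandermonde matrix. -/
theorem eq_zero_of_forall_polynomial {W : Type*} [AddCommGroup W] [Module ℂ W]
    {a₀ a₁ a₂ a₃ a₄ : W}
    (hβ : ∀ β : ℂ, a₀ + β • a₁ + β ^ 2 • a₂ + β ^ 3 • a₃ + β ^ 4 • a₄ = 0) :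
    a₀ = 0 ∧ a₁ = 0 ∧ a₂ = 0 ∧ a₃ = 0 ∧ a₄ = 0 := by
  have e0 := hβ 0
  have e1 := hβ 1
  have e2 := hβ (-1)
  have e3 := hβ 2
  have e4 := hβ (-2)
  refine ⟨?_, ?_, ?_, ?_, ?_⟩
  · linear_combination (norm := module) e0
  · linear_combination (norm := module) (2 / 3 : ℂ) • e1 - (2 / 3 : ℂ) • e2 - (1 / 12 : ℂ) • e3 +
      (1 / 12 : ℂ) • e4
  · linear_combination (norm := module) (2 / 3 : ℂ) • e1 + (2 / 3 : ℂ) • e2 - (1 / 24 : ℂ) • e3 -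
      (1 / 24 : ℂ) • e4 - (5 / 4 : ℂ) • e0
  · linear_combination (norm := module) -(1 / 6 : ℂ) • e1 + (1 / 6 : ℂ) • e2 + (1 / 12 : ℂ) • e3 -
      (1 / 12 : ℂ) • e4
  · linear_combination (norm := module) -(1 / 6 : ℂ) • e1 - (1 / 6 : ℂ) • e2 + (1 / 24 : ℂ) • e3 +
      (1 / 24 : ℂ) • e4 + (1 / 4 : ℂ) • e0

theorem isFormalDeformation (α : ℂ) {h : ℂ} (hh : h ≠ 0) :
    IsFormalDeformation gamPart (gamAlphaBr α) (phPart h) (brH h) (rho α h) (deformation α h) where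
  zero := rfl
  even k := by
    match k with
    | 0 => exact rho_mem α h
    | 1 => exact theta_mem α h
    | 2 => exact rhoTwo_mem h
    | _ + 3 => exact Submodule.zero_mem _
  map_br k X Y := by
    have hz : ∀ k, 3 ≤ k → deformation α h k = 0 := fun k hk => by
      obtain ⟨k, rfl⟩ := Nat.exists_eq_add_of_le' hk
      rfl
    -- The bracket of two quadratic polynomials in `β` is quartic, and its five coefficients are the
    -- deformation equations for `k = 0, …, 4`. In the last two the left-hand side of the equation
    -- is zero.
    have key := eq_zero_of_forall_polynomial (W := PH h)
      (a₀ := rho α h (gamAlphaBr α X Y) - brH h (rho α h X) (rho α h Y))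
      (a₁ := theta α h (gamAlphaBr α X Y) -
        (brH h (rho α h X) (theta α h Y) + brH h (theta α h X) (rho α h Y)))
      (a₂ := rhoTwo h (gamAlphaBr α X Y) - (brH h (rho α h X) (rhoTwo h Y) +
        brH h (theta α h X) (theta α h Y) + brH h (rhoTwo h X) (rho α h Y)))
      (a₃ := -(brH h (theta α h X) (rhoTwo h Y) + brH h (rhoTwo h X) (theta α h Y)))
      (a₄ := -brH h (rhoTwo h X) (rhoTwo h Y)) fun β => by
        have := rhoDef_br α hh β X Y
        rw [← sub_eq_zero] at this
        rw [← this]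
        simp only [rhoDef, LinearMap.add_apply, LinearMap.smul_apply, map_add, map_smul]
        module
    obtain ⟨k0, k1, k2, k3, k4⟩ := key
    rw [sub_eq_zero] at k0 k1 k2
    rw [neg_eq_zero] at k3 k4
    match k with
    | 0 => simpa [deformation] using k0
    | 1 => simpa [deformation, Finset.Nat.antidiagonal_succ] using k1
    | 2 => simpa [deformation, Finset.Nat.antidiagonal_succ, add_assoc] using k2
    | 3 => simpa [deformation, Finset.Nat.antidiagonal_succ] using k3.symm
    | 4 => simpa [deformation, Finset.Nat.antidiagonal_succ] using k4.symm
    | k + 5 =>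
      rw [hz _ (by omega), LinearMap.zero_apply]
      refine (Finset.sum_eq_zero fun ij hij => ?_).symm
      have := Finset.HasAntidiagonal.mem_antidiagonal.mp hij
      rcases le_or_gt 3 ij.1 with h1 | h1
      · rw [hz _ h1]; simp
      · rw [hz ij.2 (by omega)]; simp

theorem rho_br (α : ℂ) {h : ℂ} (hh : h ≠ 0) (X Y : Gam) :
    rho α h (gamAlphaBr α X Y) = brH h (rho α h X) (rho α h Y) := by
  simpa [rhoDef] using rhoDef_br α hh 0 X Y

/-! ### Canonical anticommutation relations -/

section CAR

variable {ι M : Type*} [AddCommGroup M] [Module ℂ M]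
  {Δ R : ι → M →ₗ[ℂ] M}

/-- The filtration of `M` generated from `F₀` by the operators `R i`. -/
def carFiltration (R : ι → M →ₗ[ℂ] M) (F₀ : Submodule ℂ M) : ℕ → Submodule ℂ M
  | 0 => ⊥
  | n + 1 => F₀ ⊔ carFiltration R F₀ n ⊔ ⨆ i, (carFiltration R F₀ n).map (R i)

theorem carFiltration_le_succ (F₀ : Submodule ℂ M) (n : ℕ) :
    carFiltration R F₀ n ≤ carFiltration R F₀ (n + 1) :=
  le_sup_right.trans le_sup_left

theorem le_carFiltration_succ (F₀ : Submodule ℂ M) (n : ℕ) : F₀ ≤ carFiltration R F₀ (n + 1) :=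
  le_sup_left.trans le_sup_left

theorem apply_mem_carFiltration (F₀ : Submodule ℂ M) {n : ℕ} {m : M}
    (hm : m ∈ carFiltration R F₀ n) (i : ι) : R i m ∈ carFiltration R F₀ (n + 1) :=
  (le_iSup (fun i => (carFiltration R F₀ n).map (R i)) i |>.trans le_sup_right)
    (Submodule.mem_map_of_mem hm)

theorem carFiltration_mono (F₀ : Submodule ℂ M) : Monotone (carFiltration R F₀) :=
  monotone_nat_of_le_succ (carFiltration_le_succ F₀)

variable [Fintype ι] [DecidableEq ι]

/-- Exactness of the Koszul complex in degree one. -/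
theorem exists_forall_eq_of_car
    (hΔR : ∀ i j m, Δ i (R j m) + R j (Δ i m) = if i = j then m else 0)
    (hΔΔ : ∀ i j m, Δ i (Δ j m) + Δ j (Δ i m) = 0) (p : Submodule ℂ M)
    (hR : ∀ i, ∀ m ∈ p, R i m ∈ p) (hΔ : ∀ i, ∀ m ∈ p, Δ i m ∈ p)
    (c : ι → M) (hcp : ∀ i, c i ∈ p) (hc : ∀ i j, Δ i (c j) + Δ j (c i) = 0) :
    ∃ y ∈ p, ∀ i, Δ i y = c i := by
  suffices h : ∀ s : Finset ι, ∃ y ∈ p, ∀ i ∈ s, Δ i y = c i by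
    obtain ⟨y, hy, h⟩ := h Finset.univ
    exact ⟨y, hy, fun i => h i (Finset.mem_univ i)⟩
  intro s
  induction s using Finset.induction_on with
  | empty => exact ⟨0, p.zero_mem, by simp⟩
  | insert j s hj ih =>
    obtain ⟨y, hy, h⟩ := ih
    have hd : ∀ i k, Δ i (c k - Δ k y) + Δ k (c i - Δ i y) = 0 := fun i k => by
      rw [map_sub, map_sub, sub_add_sub_comm, hc, hΔΔ, sub_zero]
    -- With `d = c j - Δ j y`, the operator `Δ i` for `i ∈ s` sends `R j d` to `-R j (Δ i d)`, which
    -- vanishes by the closedness condition, so the equations already solved are kept. Closedness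
    -- with both indices equal to `j` gives `Δ j d = 0`, hence `Δ j (R j d) = d`.
    refine ⟨y + R j (c j - Δ j y),
      p.add_mem hy (hR j _ (p.sub_mem (hcp j) (hΔ j y hy))), fun i hi => ?_⟩
    rw [map_add, eq_sub_of_add_eq (hΔR i j (c j - Δ j y))]
    by_cases hij : i = j
    · subst hij
      have h2 : Δ i (c i - Δ i y) = 0 := by
        have h3 := hd i i
        rw [← two_smul ℂ] at h3
        exact (smul_eq_zero.mp h3).resolve_left two_ne_zero
      rw [if_pos rfl, h2, map_zero]
      abel
    · have hs : i ∈ s := (Finset.mem_insert.mp hi).resolve_left hij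
      have h2 := hd i j
      rw [h i hs, sub_self, map_zero, add_zero] at h2
      rw [if_neg hij, h2, map_zero, sub_self, add_zero, h i hs]

/-- The number operator `∑ R i Δ i` acts as the scalar `n` on the quotient of step `n + 1` by step
`n`; the shift comes from step `0` being zero. A filtration replaces a grading because the creation
operators anticommute only up to scalars. -/
theorem carFiltration_lower
    (hΔR : ∀ i j m, Δ i (R j m) + R j (Δ i m) = if i = j then m else 0)
    (c : ι → ι → ℂ) (hRR : ∀ i j m, R i (R j m) + R j (R i m) = c i j • m)
    (F₀ : Submodule ℂ M) (hF : ∀ i, ∀ m ∈ F₀, Δ i m = 0) (n : ℕ) :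
    ∀ m ∈ carFiltration R F₀ (n + 1), (∀ i, Δ i m ∈ carFiltration R F₀ n) ∧
      ∑ i, R i (Δ i m) - (n : ℂ) • m ∈ carFiltration R F₀ n := by
  induction n with
  | zero =>
    intro m hm
    have hm : m ∈ F₀ := by simpa [carFiltration] using hm
    simp [hF _ m hm]
  | succ n ih =>
    intro m hm
    let L : Submodule ℂ M :=
      { carrier := {m | (∀ i, Δ i m ∈ carFiltration R F₀ (n + 1)) ∧
          ∑ i, R i (Δ i m) - ((n + 1 : ℕ) : ℂ) • m ∈ carFiltration R F₀ (n + 1)}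
        zero_mem' := by simp
        add_mem' := fun {a b} ha hb => by
          refine ⟨fun i => by rw [map_add]; exact Submodule.add_mem _ (ha.1 i) (hb.1 i), ?_⟩
          have := Submodule.add_mem _ ha.2 hb.2
          simp only [map_add, Finset.sum_add_distrib, smul_add]
          convert this using 1
          abel
        smul_mem' := fun r a ha => by
          refine ⟨fun i => by rw [map_smul]; exact Submodule.smul_mem _ r (ha.1 i), ?_⟩
          have := Submodule.smul_mem _ r ha.2
          simpa only [map_smul, ← Finset.smul_sum, smul_comm _ r, ← smul_sub] using this }
    have hle : carFiltration R F₀ (n + 1 + 1) ≤ L := by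
      refine sup_le (sup_le (fun x hx => ?_) fun x hx => ?_) (iSup_le fun j => ?_)
      · refine ⟨fun i => by rw [hF i x hx]; exact Submodule.zero_mem _, ?_⟩
        simp only [hF _ x hx, map_zero, Finset.sum_const_zero, zero_sub]
        exact Submodule.neg_mem _ (Submodule.smul_mem _ _ (le_carFiltration_succ F₀ n hx))
      · obtain ⟨h1, h2⟩ := ih x hx
        refine ⟨fun i => carFiltration_le_succ F₀ n (h1 i), ?_⟩
        have h3 := Submodule.sub_mem _ (carFiltration_le_succ F₀ n h2) hx
        convert h3 using 1
        push_cast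
        module
      · rintro _ ⟨x, hx, rfl⟩
        obtain ⟨h1, h2⟩ := ih x hx
        have hΔ : ∀ i, Δ i (R j x) = (if i = j then x else 0) - R j (Δ i x) := fun i =>
          eq_sub_of_add_eq (hΔR i j x)
        refine ⟨fun i => ?_, ?_⟩
        · rw [hΔ]
          refine Submodule.sub_mem _ ?_ (apply_mem_carFiltration F₀ (h1 i) j)
          split_ifs
          · exact hx
          · exact Submodule.zero_mem _
        -- Moving the number operator past `R j` adds one copy of `R j x`. The scalar
        -- anticommutators contribute only the terms `c i j • Δ i x`, which lie lower in the
        -- filtration.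
        · have h3 : ∑ i, R i (Δ i (R j x)) - ((n + 1 : ℕ) : ℂ) • R j x =
              R j (∑ i, R i (Δ i x) - (n : ℂ) • x) - ∑ i, c i j • Δ i x := by
            have h4 : ∀ i, R i (Δ i (R j x)) =
                (if i = j then R j x else 0) + (R j (R i (Δ i x)) - c i j • Δ i x) := fun i => by
              rw [hΔ, map_sub, ← hRR i j]
              split_ifs with hij
              · subst hij; abel
              · rw [map_zero]; abel
            simp only [h4, Finset.sum_add_distrib, Finset.sum_sub_distrib, Finset.sum_ite_eq',
              Finset.mem_univ, if_true, map_sub, map_sum, map_smul]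
            push_cast
            module
          rw [h3]
          exact Submodule.sub_mem _ (apply_mem_carFiltration F₀ h2 j)
            (Submodule.sum_mem _ fun i _ => Submodule.smul_mem _ _ (carFiltration_le_succ F₀ n (h1 i)))
    exact hle hm

/-- If `F₀` generates `M` under the creation operators `R i` then every vacuum vector of the
annihilation operators `Δ i` lies in `F₀`. -/
theorem mem_of_forall_eq_zero_of_car
    (hΔR : ∀ i j m, Δ i (R j m) + R j (Δ i m) = if i = j then m else 0)
    (c : ι → ι → ℂ) (hRR : ∀ i j m, R i (R j m) + R j (R i m) = c i j • m)
    (F₀ : Submodule ℂ M) (hF : ∀ i, ∀ m ∈ F₀, Δ i m = 0) {m : M}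
    (hm : ∃ n, m ∈ carFiltration R F₀ n) (hΔ : ∀ i, Δ i m = 0) : m ∈ F₀ := by
  obtain ⟨n, hn⟩ := hm
  induction n with
  | zero =>
    have : m = 0 := by simpa [carFiltration] using hn
    rw [this]
    exact F₀.zero_mem
  | succ n ih =>
    rcases Nat.eq_zero_or_pos n with rfl | hpos
    · simpa [carFiltration] using hn
    -- On a vacuum vector the number operator is zero, so `n • m` lies one step lower and, as `n` is
    -- nonzero, so does `m`.
    · have h1 := (carFiltration_lower hΔR c hRR F₀ hF n m hn).2
      simp only [hΔ, map_zero, Finset.sum_const_zero, zero_sub] at h1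
      have h2 : ((n : ℂ)) ≠ 0 := by exact_mod_cast hpos.ne'
      have h3 := Submodule.smul_mem _ (-(n : ℂ)⁻¹) h1
      rw [smul_neg, neg_smul, neg_neg, smul_smul, inv_mul_cancel₀ h2, one_smul] at h3
      exact ih h3

end CAR

/-! ### Nilpotent perturbations of invertible operators -/

section Nilpotent

variable {M : Type*} [AddCommGroup M] [Module ℂ M] {T T' D : Module.End ℂ M}

/-- A geometric series written as an induction: if `x` solves the equation for `T' (D m)`, which has
smaller nilpotency order, then `T' m - x` solves it for `m`. Nilpotency is needed only at the given
vector. -/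
theorem exists_add_eq_of_pow_apply_eq_zero (hT : T * T' = 1) (hD : Commute T' D) (n : ℕ) :
    ∀ m : M, (D ^ n) m = 0 → ∃ x, T x + D x = m := by
  induction n with
  | zero => intro m hm; exact ⟨0, by simpa using hm.symm⟩
  | succ n ih =>
    intro m hm
    obtain ⟨x, hx⟩ := ih (T' (D m)) (by
      rw [← Module.End.mul_apply, ← (hD.pow_right n).eq, Module.End.mul_apply,
        ← Module.End.mul_apply (D ^ n), ← pow_succ, hm, map_zero])
    refine ⟨T' m - x, ?_⟩
    have h1 : T (T' m) = m := by rw [← Module.End.mul_apply, hT, Module.End.one_apply]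
    have h2 : D (T' m) = T' (D m) := by
      rw [← Module.End.mul_apply, ← hD.eq, Module.End.mul_apply]
    rw [map_sub, map_sub, h1, h2, ← hx]
    abel

theorem eq_zero_of_add_eq_zero_of_pow_apply_eq_zero (hT : T' * T = 1) (hD : Commute T D) {m : M}
    (hm : T m + D m = 0) {n : ℕ} (hn : (D ^ n) m = 0) : m = 0 := by
  induction n with
  | zero => simpa using hn
  | succ n ih =>
    apply ih
    have h1 : T ((D ^ n) m) = -((D ^ (n + 1)) m) := by
      rw [← Module.End.mul_apply, (hD.pow_right n).eq, Module.End.mul_apply,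
        eq_neg_of_add_eq_zero_left hm, map_neg, pow_succ, Module.End.mul_apply]
    have h2 : (D ^ n) m = T' (T ((D ^ n) m)) := by
      rw [← Module.End.mul_apply T', hT, Module.End.one_apply]
    rw [h2, h1, hn, neg_zero, map_zero]

end Nilpotent

/-! ### Brackets with `t²` and `t v` -/

theorem brH_even_right {h : ℂ} (m : PH h) {n : PH h} (hn : n ∈ phPart h 0) :
    brH h m n = h⁻¹ • (mulH h m n - mulH h n m) := by
  have h1 : oddProj h n = 0 := by
    rw [mem_phPart, sgn_zero, one_smul] at hn
    simp [oddProj, hn]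
  simp [brH, h1]

theorem brH_odd_right {h : ℂ} (m : PH h) {n : PH h} (hn : n ∈ phPart h 1) :
    brH h m n = h⁻¹ • (mulH h m n - mulH h n (parity h m)) := by
  have h1 : oddProj h n = n := by
    rw [mem_phPart, sgn_one] at hn
    simp only [oddProj, LinearMap.smul_apply, LinearMap.sub_apply, LinearMap.id_apply, hn]
    module
  simp only [brH, LinearMap.smul_apply, LinearMap.add_apply, LinearMap.sub_apply,
    LinearMap.flip_apply, LinearMap.compl₁₂_apply, h1]
  simp only [oddProj, LinearMap.smul_apply, LinearMap.sub_apply, LinearMap.id_apply, map_smul,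
    map_sub]
  module

theorem starH_t (h : ℂ) (A : PPlus) : starH h A (mon 1 0) = mon 1 0 * A + h • dtau A := by
  -- The truncated exponent `b - 1` at `b = 0` is harmless because of the factor `b` in front.
  have h1 : ∀ b : ℕ, (tauOp h ^ b) (mon 1 0) = mon 1 b + (h * b) • mon 0 (b - 1) := by
    intro b
    induction b with
    | zero => simp
    | succ b ih =>
      rw [pow_succ', Module.End.mul_apply, ih, map_add, map_smul, tauOp_mon, tauOp_mon]
      rcases b with _ | b
      · simp
      · simp only [Nat.add_sub_cancel, sub_self]
        push_cast
        module
  have h2 : (starH h).flip (mon 1 0) = mulL (mon 1 0) + h • dtau := by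
    refine pplus_hom_ext fun a b => ?_
    simp [starH_mon, Module.End.mul_apply, h1, dtau_mon, mon_mul_mon, mul_add, add_comm a, smul_smul]
  exact LinearMap.congr_fun h2 A

theorem pplus_induction {motive : PPlus → Prop} (zero : motive 0)
    (add : ∀ A B, motive A → motive B → motive (A + B))
    (smul : ∀ (r : ℂ) A, motive A → motive (r • A)) (mon : ∀ a b, motive (mon a b))
    (A : PPlus) : motive A := by
  have hA : A ∈ Submodule.span ℂ (Set.range monBasis) := monBasis.span_eq ▸ Submodule.mem_top
  induction hA using Submodule.span_induction with
  | mem x hx => obtain ⟨ab, rfl⟩ := hx; exact mon ab.1 ab.2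
  | zero => exact zero
  | add x y _ _ hx hy => exact add x y hx hy
  | smul r x _ hx => exact smul r x hx

/-- Integration with respect to `τ`. -/
def integ : PPlus →ₗ[ℂ] PPlus := monBasis.constr ℂ fun ab => ((ab.2 : ℂ) + 1)⁻¹ • mon ab.1 (ab.2 + 1)

theorem integ_mon (a : ℤ) (b : ℕ) : integ (mon a b) = ((b : ℂ) + 1)⁻¹ • mon a (b + 1) := by
  rw [← monBasis_apply, integ, Module.Basis.constr_basis]

theorem dtau_integ (A : PPlus) : dtau (integ A) = A := by
  have hJ : dtau ∘ₗ integ = LinearMap.id := by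
    refine pplus_hom_ext fun a b => ?_
    have h0 : (b : ℂ) + 1 ≠ 0 := by exact_mod_cast b.succ_ne_zero
    simp [integ_mon, dtau_mon, smul_smul, h0]
  exact LinearMap.congr_fun hJ A

section Operators

variable (h : ℂ)

/-- Multiplication by `tᵃ` on `P⁺_h(4)`. -/
def tOp (a : ℤ) : Module.End ℂ (PH h) := LinearMap.rTensor (Lam h) (mulL (mon a 0))

/-- `∂_τ` on `P⁺_h(4)`. -/
def dtauOp : Module.End ℂ (PH h) := LinearMap.rTensor (Lam h) dtau

/-- The supercommutator with `v` in `Λ_h(4)`, for odd `v`. -/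
def lamBr (v : Lam h) : Module.End ℂ (Lam h) :=
  h⁻¹ • (LinearMap.mulRight ℂ v -
    LinearMap.mulLeft ℂ v ∘ₗ (CliffordAlgebra.involute (Q := quad h)).toLinearMap)

theorem lamBr_apply (v X : Lam h) :
    lamBr h v X = h⁻¹ • (X * v - v * CliffordAlgebra.involute X) := rfl

theorem tOp_mul_tOp (a b : ℤ) : tOp h a * tOp h b = tOp h (a + b) := by
  refine TensorProduct.ext' fun A X => ?_
  simp [tOp, Module.End.mul_apply, ← mul_assoc, mon_mul_mon]

theorem tOp_zero : tOp h 0 = 1 := by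
  refine TensorProduct.ext' fun A X => ?_
  simp [tOp, mon_zero_zero]

theorem commute_tOp_dtauOp (a : ℤ) : Commute (tOp h a) (dtauOp h) := by
  have h1 : ∀ A, mon a 0 * dtau A = dtau (mon a 0 * A) := fun A => by
    have : mulL (mon a 0) ∘ₗ dtau = dtau ∘ₗ mulL (mon a 0) := by
      refine pplus_hom_ext fun c d => ?_
      simp [dtau_mon, mon_mul_mon]
    exact LinearMap.congr_fun this A
  refine TensorProduct.ext' fun A X => ?_
  simp [tOp, dtauOp, Module.End.mul_apply, h1]

theorem exists_dtauOp_pow_eq_zero (m : PH h) : ∃ n, (dtauOp h ^ n) m = 0 := by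
  have hmono : ∀ {m : PH h} {n k : ℕ}, (dtauOp h ^ n) m = 0 → n ≤ k → (dtauOp h ^ k) m = 0 := by
    intro m n k hm hnk
    obtain ⟨l, rfl⟩ := Nat.exists_eq_add_of_le' hnk
    rw [pow_add, Module.End.mul_apply, hm, map_zero]
  have hadd : ∀ m m' : PH h, (∃ n, (dtauOp h ^ n) m = 0) → (∃ n, (dtauOp h ^ n) m' = 0) →
      ∃ n, (dtauOp h ^ n) (m + m') = 0 := by
    rintro m m' ⟨n, hn⟩ ⟨n', hn'⟩
    exact ⟨max n n', by rw [map_add, hmono hn (le_max_left _ _), hmono hn' (le_max_right _ _),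
      add_zero]⟩
  have hpow : ∀ n A X, (dtauOp h ^ n) (A ⊗ₜ X) = ((dtau ^ n) A) ⊗ₜ X := by
    intro n A X
    induction n with
    | zero => rfl
    | succ n ih => rw [pow_succ', Module.End.mul_apply, ih, pow_succ', Module.End.mul_apply]; rfl
  induction m using TensorProduct.induction_on with
  | zero => exact ⟨0, by simp⟩
  | add m m' hm hm' => exact hadd m m' hm hm'
  | tmul A X =>
    induction A using pplus_induction with
    | zero => exact ⟨0, by simp⟩
    | add A B hA hB => rw [TensorProduct.add_tmul]; exact hadd _ _ hA hB
    | smul r A hA =>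
      obtain ⟨n, hn⟩ := hA
      exact ⟨n, by rw [← TensorProduct.smul_tmul', map_smul, hn, smul_zero]⟩
    | mon a b =>
      refine ⟨b + 1, ?_⟩
      rw [hpow, dtau_pow_mon, Nat.descFactorial_of_lt (Nat.lt_succ_self _)]
      simp

theorem dtauOp_surjective : Function.Surjective (dtauOp h) := by
  exact LinearMap.rTensor_surjective _ fun A => ⟨integ A, dtau_integ A⟩

theorem mulH_t_right (m : PH h) (v : Lam h) : mulH h m (el h 1 0 v) =
    (tOp h 1 + h • dtauOp h) (LinearMap.lTensor PPlus (LinearMap.mulRight ℂ v) m) := by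
  have : (mulH h).flip (el h 1 0 v) =
      (tOp h 1 + h • dtauOp h) ∘ₗ LinearMap.lTensor PPlus (LinearMap.mulRight ℂ v) := by
    refine TensorProduct.ext' fun A X => ?_
    simp [el, mulH_tmul, starH_t, tOp, dtauOp, TensorProduct.add_tmul, TensorProduct.smul_tmul']
  exact LinearMap.congr_fun this m

variable {h}

/-- Right multiplication by `t` is `t + h∂_τ` and left multiplication is `t`. The difference of
their squares, divided by `h`, factors as `(2t + h∂_τ)∂_τ`. -/
theorem brH_t_sq (hh : h ≠ 0) (m : PH h) :
    brH h m (el h 2 0 1) =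
      ((2 : ℂ) • tOp h 1) (dtauOp h m) + (h • dtauOp h) (dtauOp h m) := by
  have h1 : mulH h m (el h 2 0 1) = ((tOp h 1 + h • dtauOp h) * (tOp h 1 + h • dtauOp h)) m := by
    have h2 : el h 2 0 1 = mulH h (el h 1 0 1) (el h 1 0 1) := by rw [mulH_el_zero]; norm_num
    rw [h2, ← mulH_assoc, mulH_t_right, mulH_t_right, LinearMap.mulRight_one,
      LinearMap.lTensor_id, LinearMap.id_apply, LinearMap.id_apply, Module.End.mul_apply]
  have h2 : mulH h (el h 2 0 1) m = (tOp h 1 * tOp h 1) m := by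
    have : mulH h (el h 2 0 1) = tOp h 1 * tOp h 1 := by
      rw [tOp_mul_tOp]
      refine TensorProduct.ext' fun A X => ?_
      simp [el, mulH_tmul, starH_mon_zero, tOp]
    rw [this]
  rw [brH_even_right m (el_mem_phPart 2 0 (by simp [sgn_zero])), h1, h2, inv_smul_eq_iff₀ hh]
  simp only [mul_add, add_mul, mul_smul_comm, smul_mul_assoc, ← (commute_tOp_dtauOp h 1).eq,
    LinearMap.add_apply, LinearMap.smul_apply, Module.End.mul_apply]
  module

theorem two_smul_tOp_mul : ((2 : ℂ) • tOp h 1) * ((2⁻¹ : ℂ) • tOp h (-1)) = 1 := by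
  rw [smul_mul_smul_comm, tOp_mul_tOp]
  norm_num [tOp_zero]

theorem two_smul_tOp_mul' : ((2⁻¹ : ℂ) • tOp h (-1)) * ((2 : ℂ) • tOp h 1) = 1 := by
  rw [smul_mul_smul_comm, tOp_mul_tOp]
  norm_num [tOp_zero]

theorem exists_smul_dtauOp_pow_eq_zero (m : PH h) : ∃ n, ((h • dtauOp h) ^ n) m = 0 := by
  obtain ⟨n, hn⟩ := exists_dtauOp_pow_eq_zero h m
  exact ⟨n, by rw [smul_pow, LinearMap.smul_apply, hn, smul_zero]⟩

/-- `2t` is invertible and `h∂_τ` is a commuting, locally nilpotent perturbation, so `2t + h∂_τ` is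
onto; integration in `τ` inverts the remaining `∂_τ`. -/
theorem exists_brH_t_sq_eq (hh : h ≠ 0) (m : PH h) : ∃ x, brH h x (el h 2 0 1) = m := by
  obtain ⟨n, hn⟩ := exists_smul_dtauOp_pow_eq_zero m
  obtain ⟨y, hy⟩ := exists_add_eq_of_pow_apply_eq_zero two_smul_tOp_mul
    (((commute_tOp_dtauOp h (-1)).smul_left (2⁻¹ : ℂ)).smul_right h) n m hn
  obtain ⟨x, rfl⟩ := dtauOp_surjective h y
  exact ⟨x, by rw [brH_t_sq hh, hy]⟩

theorem dtauOp_eq_zero_of_brH_t_sq (hh : h ≠ 0) {m : PH h} (hm : brH h m (el h 2 0 1) = 0) :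
    dtauOp h m = 0 := by
  rw [brH_t_sq hh] at hm
  obtain ⟨n, hn⟩ := exists_smul_dtauOp_pow_eq_zero (dtauOp h m)
  exact eq_zero_of_add_eq_zero_of_pow_apply_eq_zero two_smul_tOp_mul'
    (((commute_tOp_dtauOp h 1).smul_left (2 : ℂ)).smul_right h) hm hn

/-- On `ker ∂_τ` the second term disappears, and bracketing with `tv` becomes `t` times an
annihilation operator on the Clifford factor. -/
theorem brH_t_mul (hh : h ≠ 0) (m : PH h) {v : Lam h} (hv : CliffordAlgebra.involute v = -v) :
    brH h m (el h 1 0 v) = tOp h 1 (LinearMap.lTensor PPlus (lamBr h v) m) +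
      LinearMap.lTensor PPlus (LinearMap.mulRight ℂ v) (dtauOp h m) := by
  rw [brH_odd_right m (el_mem_phPart 1 0 (by rw [hv, sgn_one, neg_smul, one_smul])),
    inv_smul_eq_iff₀ hh]
  induction m using TensorProduct.induction_on with
  | zero => simp
  | add m m' hm hm' =>
    simp only [map_add, LinearMap.add_apply, smul_add] at hm hm' ⊢
    rw [add_sub_add_comm, hm, hm']
    abel
  | tmul A X =>
    simp only [el, mulH_tmul, parity, LinearMap.lTensor_tmul, tOp, dtauOp, LinearMap.rTensor_tmul,
      starH_t, starH_mon_zero, lamBr_apply, LinearMap.mulRight_apply, AlgHom.toLinearMap_apply,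
      LinearMap.mul_apply', TensorProduct.add_tmul, TensorProduct.tmul_smul, map_smul, map_sub,
      TensorProduct.tmul_sub, smul_add, ← TensorProduct.smul_tmul', smul_smul,
      mul_inv_cancel₀ hh, one_smul]
    abel

/-! ### Anticommutation relations on `P⁺_h(4)` -/

/-- The basis of `V` dual to `e` with respect to `ψ`. -/
def dualVec : Fin 2 → V
  | 0 => e 1
  | 1 => -e 0

theorem psi_dualVec (i j : Fin 2) : psi (e i) (dualVec j) = if i = j then 1 else 0 := by
  fin_cases i <;> fin_cases j <;> simp [psi_apply, dualVec, e]

theorem involute_vec (y z : V) : CliffordAlgebra.involute (vec h y z) = -vec h y z := by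
  simp only [vec, map_add, map_sub, map_smul, involute_xi, involute_eta]
  module

/-- Annihilation operators on `P⁺_h(4)`. -/
def annih (h : ℂ) (i : Fin 2 × Fin 2) : PH h →ₗ[ℂ] PH h :=
  LinearMap.lTensor PPlus (lamBr h (vec h (e i.1) (e i.2)))

/-- Creation operators on `P⁺_h(4)`. -/
def creat (h : ℂ) (i : Fin 2 × Fin 2) : PH h →ₗ[ℂ] PH h :=
  LinearMap.lTensor PPlus (LinearMap.mulRight ℂ (vec h (dualVec i.1) (dualVec i.2)))

/-- Supercommutation with a vector is an odd derivation. Applied to a right factor `w` it produces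
`h⁻¹(vw + wv)`, which is `0` or `1` when `w` runs through the dual basis. -/
theorem annih_creat (hh : h ≠ 0) (i j : Fin 2 × Fin 2) (m : PH h) :
    annih h i (creat h j m) + creat h j (annih h i m) = if i = j then m else 0 := by
  have h1 : annih h i ∘ₗ creat h j + creat h j ∘ₗ annih h i =
      (if i = j then (1 : ℂ) else 0) • LinearMap.id := by
    refine TensorProduct.ext' fun A X => ?_
    have h2 := vec_mul_vec_add_swap h (e i.1) (e i.2) (dualVec j.1) (dualVec j.2)
    rw [psi_dualVec, psi_dualVec] at h2
    have h3 : (if i.1 = j.1 then (1 : ℂ) else 0) * (if i.2 = j.2 then 1 else 0) =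
        if i = j then 1 else 0 := by
      simp only [Prod.ext_iff]
      split_ifs <;> simp_all
    rw [h3] at h2
    simp only [annih, creat, LinearMap.add_apply, LinearMap.comp_apply, LinearMap.lTensor_tmul,
      LinearMap.smul_apply, LinearMap.id_apply, ← TensorProduct.tmul_add, lamBr_apply,
      LinearMap.mulRight_apply, map_mul, involute_vec, ← TensorProduct.tmul_smul]
    congr 1
    rw [smul_mul_assoc, ← smul_add, inv_smul_eq_iff₀ hh]
    have h4 := congrArg (X * ·) h2
    simp only [mul_smul_comm, mul_one, mul_add, ← mul_assoc] at h4
    rw [smul_smul, ← h4]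
    noncomm_ring
  have h2 := LinearMap.congr_fun h1 m
  split_ifs at h2 ⊢ <;> simpa using h2

theorem annih_annih (i j : Fin 2 × Fin 2) (m : PH h) :
    annih h i (annih h j m) + annih h j (annih h i m) = 0 := by
  have h1 : annih h i ∘ₗ annih h j + annih h j ∘ₗ annih h i = 0 := by
    refine TensorProduct.ext' fun A X => ?_
    have h2 := vec_mul_vec_add_swap h (e i.1) (e i.2) (e j.1) (e j.2)
    set v := vec h (e i.1) (e i.2)
    set w := vec h (e j.1) (e j.2)
    simp only [annih, LinearMap.add_apply, LinearMap.comp_apply, LinearMap.lTensor_tmul,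
      ← TensorProduct.tmul_add, lamBr_apply, map_smul, map_sub, map_mul, involute_vec,
      CliffordAlgebra.involute_involute, LinearMap.zero_apply]
    have h3 : X * (v * w + w * v) - (v * w + w * v) * X = 0 := by rw [h2]; simp
    have h4 : A ⊗ₜ[ℂ] ((h⁻¹ * h⁻¹) • (X * (v * w + w * v) - (v * w + w * v) * X)) = 0 := by
      rw [h3]; simp
    rw [← h4]
    congr 1
    simp only [← smul_sub, smul_smul, ← smul_add]
    congr 1
    noncomm_ring
  exact LinearMap.congr_fun h1 m

theorem creat_creat (i j : Fin 2 × Fin 2) (m : PH h) :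
    creat h i (creat h j m) + creat h j (creat h i m) =
      (h * (psi (dualVec i.1) (dualVec j.1) * psi (dualVec i.2) (dualVec j.2))) • m := by
  have h1 : creat h i ∘ₗ creat h j + creat h j ∘ₗ creat h i =
      (h * (psi (dualVec i.1) (dualVec j.1) * psi (dualVec i.2) (dualVec j.2))) •
        LinearMap.id := by
    refine TensorProduct.ext' fun A X => ?_
    have h2 := vec_mul_vec_add_swap h (dualVec i.1) (dualVec i.2) (dualVec j.1) (dualVec j.2)
    simp only [creat, LinearMap.add_apply, LinearMap.comp_apply, LinearMap.lTensor_tmul,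
      ← TensorProduct.tmul_add, LinearMap.mulRight_apply, LinearMap.smul_apply, LinearMap.id_apply,
      ← TensorProduct.tmul_smul]
    congr 1
    rw [mul_assoc, mul_assoc, ← mul_add, add_comm, h2, mul_smul_comm, mul_one]
  exact LinearMap.congr_fun h1 m

/-- The subspace `P⁺ ⊗ 1` of `P⁺_h(4)`. -/
def scalarPart (h : ℂ) : Submodule ℂ (PH h) :=
  LinearMap.range ((TensorProduct.mk ℂ PPlus (Lam h)).flip 1)

theorem mem_scalarPart {m : PH h} : m ∈ scalarPart h ↔ ∃ A : PPlus, m = A ⊗ₜ 1 := by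
  simp [scalarPart, eq_comm]

theorem annih_tmul_one (i : Fin 2 × Fin 2) (A : PPlus) : annih h i (A ⊗ₜ 1) = 0 := by
  simp [annih, lamBr_apply]

theorem exists_mem_carFiltration (m : PH h) :
    ∃ n, m ∈ carFiltration (creat h) (scalarPart h) n := by
  have hadd : ∀ m m' : PH h, (∃ n, m ∈ carFiltration (creat h) (scalarPart h) n) →
      (∃ n, m' ∈ carFiltration (creat h) (scalarPart h) n) →
      ∃ n, m + m' ∈ carFiltration (creat h) (scalarPart h) n := by
    rintro m m' ⟨n, hn⟩ ⟨n', hn'⟩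
    exact ⟨max n n', Submodule.add_mem _ (carFiltration_mono _ (le_max_left _ _) hn)
      (carFiltration_mono _ (le_max_right _ _) hn')⟩
  induction m using TensorProduct.induction_on with
  | zero => exact ⟨0, Submodule.zero_mem _⟩
  | add m m' hm hm' => exact hadd m m' hm hm'
  | tmul A X =>
    induction X using CliffordAlgebra.right_induction with
    | algebraMap r =>
      refine ⟨1, le_carFiltration_succ _ 0 (mem_scalarPart.mpr ⟨r • A, ?_⟩)⟩
      rw [Algebra.algebraMap_eq_smul_one, TensorProduct.tmul_smul, TensorProduct.smul_tmul']
    | add X Y hX hY => rw [TensorProduct.tmul_add]; exact hadd _ _ hX hY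
    | mul_ι v X hX =>
      obtain ⟨n, hn⟩ := hX
      refine ⟨n + 1, ?_⟩
      have hv : CliffordAlgebra.ι (quad h) v =
          v.1 0 • vec h (dualVec 0) (dualVec 0) + v.1 1 • vec h (dualVec 0) (dualVec 1) -
            v.2 1 • vec h (dualVec 1) (dualVec 0) + v.2 0 • vec h (dualVec 1) (dualVec 1) := by
        have h1 : v = v.1 0 • (Pi.single 0 1, 0) + v.1 1 • (Pi.single 1 1, 0) +
            v.2 1 • (0, Pi.single 1 1) + v.2 0 • (0, Pi.single 0 1) := by
          ext i <;> fin_cases i <;> simp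
        conv_lhs => rw [h1]
        simp only [map_add, map_smul, vec, dualVec, e, xi, eta]
        simp
      rw [hv]
      simp only [mul_add, mul_sub, mul_smul_comm, TensorProduct.tmul_add, TensorProduct.tmul_sub,
        TensorProduct.tmul_smul]
      have h2 : ∀ i j, A ⊗ₜ[ℂ] (X * vec h (dualVec i) (dualVec j)) ∈
          carFiltration (creat h) (scalarPart h) (n + 1) := fun i j =>
        apply_mem_carFiltration (R := creat h) _ hn (i, j)
      exact Submodule.add_mem _ (Submodule.sub_mem _ (Submodule.add_mem _
        (Submodule.smul_mem _ _ (h2 _ _)) (Submodule.smul_mem _ _ (h2 _ _)))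
        (Submodule.smul_mem _ _ (h2 _ _))) (Submodule.smul_mem _ _ (h2 _ _))

/-- The elements of `P⁺_h(4)` that supercommute with `t²` and with all `t v` are the Laurent
polynomials in `t`. -/
theorem exists_eq_tmul_one (hh : h ≠ 0) {m : PH h} (h2 : brH h m (el h 2 0 1) = 0)
    (h1 : ∀ i j, brH h m (el h 1 0 (vec h (e i) (e j))) = 0) :
    ∃ A : PPlus, dtau A = 0 ∧ m = A ⊗ₜ 1 := by
  have hd := dtauOp_eq_zero_of_brH_t_sq hh h2
  have hann : ∀ i, annih h i m = 0 := fun i => by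
    have h3 := h1 i.1 i.2
    rw [brH_t_mul hh m (involute_vec _ _), hd, map_zero, add_zero] at h3
    have h4 : (tOp h (-1) * tOp h 1) (annih h i m) = 0 := by
      rw [Module.End.mul_apply, annih, h3, map_zero]
    simpa [tOp_mul_tOp, tOp_zero] using h4
  have h0 : ∀ i, ∀ m ∈ scalarPart h, annih h i m = 0 := fun i m hm => by
    obtain ⟨A, rfl⟩ := mem_scalarPart.mp hm
    exact annih_tmul_one i A
  obtain ⟨A, rfl⟩ := mem_scalarPart.mp (mem_of_forall_eq_zero_of_car (annih_creat hh) _ creat_creat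
    (scalarPart h) h0 (exists_mem_carFiltration m) hann)
  -- What is known is that `dtau A ⊗ 1` vanishes. Subtracting the integral of `dtau A` changes `A`
  -- but not `A ⊗ 1`, so injectivity of `A ↦ A ⊗ 1` is not needed.
  refine ⟨A - integ (dtau A), by rw [map_sub, dtau_integ, sub_self], ?_⟩
  have h5 := congrArg (LinearMap.rTensor (Lam h) integ) hd
  simp only [dtauOp, LinearMap.rTensor_tmul, map_zero] at h5
  rw [TensorProduct.sub_tmul, h5, sub_zero]

end Operators

/-! ### The super Jacobi identity in `P⁺_h(4)` -/

theorem parity_mulH (h : ℂ) (A B : PH h) :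
    parity h (mulH h A B) = mulH h (parity h A) (parity h B) := by
  induction A using TensorProduct.induction_on with
  | zero => simp
  | add A A' hA hA' => simp only [map_add, LinearMap.add_apply, hA, hA']
  | tmul A X =>
    induction B using TensorProduct.induction_on with
    | zero => simp
    | add B B' hB hB' => simp only [map_add, hB, hB']
    | tmul B Y => simp [parity, mulH_tmul]

theorem parity_parity (h : ℂ) (A : PH h) : parity h (parity h A) = A := by
  induction A using TensorProduct.induction_on with
  | zero => simp
  | add A A' hA hA' => simp only [map_add, hA, hA']
  | tmul A X => simp [parity]

theorem sgn_add (p q : ZMod 2) : sgn (p + q) = sgn p * sgn q := by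
  have h11 : (1 : ZMod 2) + 1 = 0 := by decide
  rcases zmod_two_eq p with rfl | rfl <;> rcases zmod_two_eq q with rfl | rfl <;>
    simp [sgn_zero, sgn_one, h11]

theorem mulH_mem {h : ℂ} {p q : ZMod 2} {A B : PH h} (hA : A ∈ phPart h p)
    (hB : B ∈ phPart h q) : mulH h A B ∈ phPart h (p + q) := by
  rw [mem_phPart] at *
  rw [parity_mulH, hA, hB, sgn_add]
  simp [smul_smul, mul_comm]

theorem brH_mem {h : ℂ} {p q : ZMod 2} {A B : PH h} (hA : A ∈ phPart h p)
    (hB : B ∈ phPart h q) : brH h A B ∈ phPart h (p + q) := by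
  rw [brH_of_mem h p q A B hA hB]
  exact Submodule.smul_mem _ _ (Submodule.sub_mem _ (mulH_mem hA hB)
    (Submodule.smul_mem _ _ (add_comm q p ▸ mulH_mem hB hA)))

theorem brH_swap {h : ℂ} {p q : ZMod 2} {A B : PH h} (hA : A ∈ phPart h p)
    (hB : B ∈ phPart h q) : brH h A B = -(sgn (p * q) • brH h B A) := by
  rw [brH_of_mem h p q A B hA hB, brH_of_mem h q p B A hB hA, mul_comm q p]
  rcases zmod_two_eq (p * q) with h0 | h0 <;> rw [h0] <;> simp only [sgn_zero, sgn_one] <;> module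

/-- In terms of the right action `m ↦ [m, Y]` the signs do not involve the parity of `m`. The
identity therefore extends by linearity from homogeneous `m` to all `m`, through the components `m ±
parity h m`. -/
theorem brH_jacobi {h : ℂ} (m : PH h) {q r : ZMod 2} {Y Z : PH h} (hY : Y ∈ phPart h q)
    (hZ : Z ∈ phPart h r) :
    brH h m (brH h Y Z) = brH h (brH h m Y) Z - sgn (q * r) • brH h (brH h m Z) Y := by
  have key : ∀ p, ∀ m ∈ phPart h p,
      brH h m (brH h Y Z) = brH h (brH h m Y) Z - sgn (q * r) • brH h (brH h m Z) Y := by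
    intro p m hm
    rw [brH_of_mem h _ _ _ _ hm (brH_mem hY hZ), brH_of_mem h _ _ _ _ (brH_mem hm hY) hZ,
      brH_of_mem h _ _ _ _ (brH_mem hm hZ) hY, brH_of_mem h _ _ _ _ hY hZ,
      brH_of_mem h _ _ _ _ hm hY, brH_of_mem h _ _ _ _ hm hZ]
    simp only [map_smul, map_sub, LinearMap.smul_apply, LinearMap.sub_apply, mulH_assoc, add_mul,
      mul_add, sgn_add]
    rcases zmod_two_eq p with rfl | rfl <;> rcases zmod_two_eq q with rfl | rfl <;>
      rcases zmod_two_eq r with rfl | rfl <;>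
      simp only [mul_zero, mul_one, sgn_zero, sgn_one] <;> module
  have h0 : m + parity h m ∈ phPart h 0 := by
    rw [mem_phPart, map_add, parity_parity, sgn_zero, one_smul, add_comm]
  have h1 : m - parity h m ∈ phPart h 1 := by
    rw [mem_phPart, map_sub, parity_parity, sgn_one]
    module
  have hm : m = (2⁻¹ : ℂ) • (m + parity h m) + (2⁻¹ : ℂ) • (m - parity h m) := by module
  have k0 := key 0 _ h0
  have k1 := key 1 _ h1
  rw [hm]
  simp only [map_add (brH h), map_smul (brH h), LinearMap.add_apply, LinearMap.smul_apply] at k0 k1 ⊢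
  simp only [k0, k1]
  module

/-! ### Values of the embedding -/

theorem rho_E1 (α h : ℂ) : rho α h (gen .E1) = el h 2 0 1 := by
  rw [rho, ofGen_gen, rhoVal]

theorem rho_oddVec_zero (α h : ℂ) (i j : Fin 2) :
    rho α h (oddVec 0 i j) = sqrtTwoI • el h 1 0 (vec h (e i) (e j)) := by
  rw [rho, ofGen_oddVec]
  fin_cases i <;> fin_cases j <;> simp [ofGenOdd, rhoVal, vec, e, el, TensorProduct.tmul_neg]

theorem rho_ev_zero (α h : ℂ) (B C : sp) :
    rho α h (ev 0 B C) = el h 0 0 (spinTwo h B + spinThree h C) := by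
  rw [rho, ev_eq_sum_gen]
  simp only [map_add, map_sub, map_smul, map_zero, zero_smul, mul_zero, ofGen_gen, rhoVal,
    spinTwo, spinThree, el, TensorProduct.tmul_add, TensorProduct.tmul_sub,
    TensorProduct.tmul_smul, TensorProduct.tmul_neg]
  module

/-! ### Injectivity of the embedding -/

/-- Anticommuting with the dual generator extracts each coefficient, multiplied by `h`. -/
theorem vec_lin_eq_zero {h : ℂ} (hh : h ≠ 0) [Nontrivial (Lam h)] {a b c d : ℂ}
    (h0 : a • eta h 0 + b • eta h 1 - c • xi h 1 + d • xi h 0 = 0) :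
    a = 0 ∧ b = 0 ∧ c = 0 ∧ d = 0 := by
  have key : ∀ (v : Lam h) (r : ℂ),
      (a • eta h 0 + b • eta h 1 - c • xi h 1 + d • xi h 0) * v +
        v * (a • eta h 0 + b • eta h 1 - c • xi h 1 + d • xi h 0) = (r * h) • 1 → r = 0 := by
    intro v r hv
    rw [h0, zero_mul, mul_zero, add_zero] at hv
    exact ((smul_eq_zero.mp hv.symm).resolve_right one_ne_zero |> mul_eq_zero.mp).resolve_right hh
  refine ⟨key (xi h 0) a ?_, key (xi h 1) b ?_, neg_eq_zero.mp (key (eta h 1) (-c) ?_), key (eta h 0) d ?_⟩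
  · simp [mul_add, add_mul, mul_sub, sub_mul]
    module
  · simp [mul_add, add_mul, mul_sub, sub_mul]
    module
  · simp [mul_add, add_mul, mul_sub, sub_mul]
    module
  · simp [mul_add, add_mul, mul_sub, sub_mul]
    module

theorem nontrivial_lam (h : ℂ) : Nontrivial (Lam h) :=
  haveI : Invertible (2 : ℂ) := invertibleOfNonzero two_ne_zero
  inferInstance

/-- The coefficient of `tᵃ τᵇ`. -/
def coeffAt (h : ℂ) (a : ℤ) (b : ℕ) : PH h →ₗ[ℂ] Lam h :=
  (TensorProduct.lid ℂ (Lam h)).toLinearMap ∘ₗ LinearMap.rTensor (Lam h) (monBasis.coord (a, b))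

theorem coeffAt_el (h : ℂ) (a a' : ℤ) (b b' : ℕ) (X : Lam h) :
    coeffAt h a b (el h a' b' X) = if a' = a ∧ b' = b then X else 0 := by
  have h1 : monBasis.coord (a, b) (mon a' b') = if a' = a ∧ b' = b then 1 else 0 := by
    rw [← monBasis_apply, Module.Basis.coord_apply, Module.Basis.repr_self,
      Finsupp.single_apply]
    simp only [Prod.ext_iff]
  simp [coeffAt, el, h1]

theorem od_eq_sum (u : OddPart) :
    ∃ r : Fin 2 → Fin 2 → Fin 2 → ℂ, od u = ∑ i, ∑ j, ∑ k, r i j k • oddVec i j k := by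
  refine ⟨fun i j k => oddBasis.repr u ((i, j), k), ?_⟩
  have h1 := oddBasis.sum_repr u
  have h2 : ∀ i j k, oddVec i j k = od (oddBasis ((i, j), k)) := fun i j k => by
    simp [oddVec, od, oddBasis, e, Module.Basis.tensorProduct_apply]
  conv_lhs => rw [← h1]
  have h3 : ∀ u, od u = LinearMap.inr ℂ (sp × sp × sp) OddPart u := fun u => rfl
  simp only [h2, h3, map_sum, map_smul, Fintype.sum_prod_type]

/-- Commuting with all vectors forces `B ⊗ 1 + 1 ⊗ C = 0` on `V ⊗ V`. Hence `B` and `C` are opposite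
scalars, and being traceless they vanish. -/
theorem spin_eq_zero {h : ℂ} (hh : h ≠ 0) {B C : sp} (h0 : spinTwo h B + spinThree h C = 0) :
    B = 0 ∧ C = 0 := by
  have := nontrivial_lam h
  have key : ∀ y z, vec h (B.1 y) z + vec h y (C.1 z) = 0 := fun y z => by
    have h1 := spinTwo_vec h B y z
    have h2 := spinThree_vec h C y z
    have h3 : h • (vec h (B.1 y) z + vec h y (C.1 z)) = 0 := by
      rw [smul_add, ← h1, ← h2]
      have h4 : (spinTwo h B + spinThree h C) * vec h y z -
        vec h y z * (spinTwo h B + spinThree h C) = 0 := by rw [h0]; simp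
      rw [← h4]
      noncomm_ring
    exact (smul_eq_zero.mp h3).resolve_left hh
  have key' : ∀ y z : V, B.1 y 0 * z 0 + y 0 * C.1 z 0 = 0 ∧ B.1 y 0 * z 1 + y 0 * C.1 z 1 = 0 ∧
      B.1 y 1 * z 0 + y 1 * C.1 z 0 = 0 ∧ B.1 y 1 * z 1 + y 1 * C.1 z 1 = 0 := fun y z => by
    refine vec_lin_eq_zero hh ?_
    rw [← key y z, vec, vec]
    module
  have k00 := key' (e 0) (e 0)
  have k10 := key' (e 1) (e 0)
  have k01 := key' (e 0) (e 1)
  simp only [sp_apply_zero, sp_apply_one] at k00 k10 k01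
  simp [e] at k00 k10 k01
  constructor <;> apply sp_ext <;> rw [map_zero]
  · linear_combination (1 / 2 : ℂ) * k00.1 - (1 / 2 : ℂ) * k10.2.1
  · exact k10.1
  · exact k00.2.2
  · linear_combination (1 / 2 : ℂ) * k00.1 + (1 / 2 : ℂ) * k10.2.1
  · exact k01.1
  · exact k00.2.1

/-- The components are separated by monomials in `t` and `τ`: `t²`, `tτ`, `τ²` detect `sp(ψ₁)`,
while `t` and `τ` detect the odd part. Once these vanish, the constant coefficient detects `sp(ψ₂) ⊕
sp(ψ₃)`. -/
theorem rho_injective (α : ℂ) {h : ℂ} (hh : h ≠ 0) : Function.Injective (rho α h) := by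
  have := nontrivial_lam h
  have hs := sqrtTwoI_ne_zero
  rw [injective_iff_map_eq_zero]
  intro X hX
  obtain ⟨A, B, C, u, rfl⟩ : ∃ A B C u, X = ev A B C + od u := ⟨_, _, _, _, eq_ev_add_od X⟩
  obtain ⟨r, hr⟩ := od_eq_sum u
  have hX' := hX
  rw [hr, ev_eq_sum_gen, rho] at hX
  simp only [map_add, map_sub, map_smul, ofGen_gen, Fin.sum_univ_two, ofGen_oddVec, ofGenOdd,
    rhoVal] at hX
  have h20 := congrArg (coeffAt h 2 0) hX
  have h11 := congrArg (coeffAt h 1 1) hX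
  have h02 := congrArg (coeffAt h 0 2) hX
  have h10 := congrArg (coeffAt h 1 0) hX
  have h01 := congrArg (coeffAt h 0 1) hX
  simp [coeffAt_el] at h20 h11 h02
  have hA : A = 0 := sp_ext (by simpa using h11) (by simpa using h20) (by simpa using h02)
  have hu : od u = 0 := by
    simp only [map_add, map_sub, map_smul, coeffAt_el, map_zero] at h10 h01
    norm_num at h10 h01
    have h10' : r 0 0 0 = 0 ∧ r 0 0 1 = 0 ∧ r 0 1 0 = 0 ∧ r 0 1 1 = 0 := by
      refine vec_lin_eq_zero hh ?_
      rw [← smul_eq_zero_iff_right hs, ← h10]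
      module
    have h01' : r 1 0 0 = 0 ∧ r 1 0 1 = 0 ∧ r 1 1 0 = 0 ∧ r 1 1 1 = 0 := by
      refine vec_lin_eq_zero hh ?_
      rw [← smul_eq_zero_iff_right hs, ← h01]
      module
    rw [hr]
    simp [Fin.sum_univ_two, h10', h01']
  rw [hu, add_zero, hA, rho_ev_zero] at hX'
  have h00 := congrArg (coeffAt h 0 0) hX'
  simp only [coeffAt_el, map_zero, and_self, if_true] at h00
  obtain ⟨rfl, rfl⟩ := spin_eq_zero hh h00
  rw [hu, hA, add_zero]
  rfl

theorem isEmbedding (α : ℂ) {h : ℂ} (hh : h ≠ 0) :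
    IsEmbedding gamPart (gamAlphaBr α) (phPart h) (brH h) (rho α h) :=
  ⟨rho_mem α h, rho_br α hh, rho_injective α hh⟩

/-! ### Laurent polynomials in `t` -/

theorem starH_of_dtau_eq_zero (h : ℂ) {A : PPlus} (hA : dtau A = 0) (B : PPlus) :
    starH h A B = A * B := by
  -- `id - integ ∘ dtau` kills monomials with positive power of `τ` and is the identity on `ker
  -- ∂_τ`, so the claim can be checked on powers of `t`.
  have h1 : starH h ∘ₗ (LinearMap.id - integ ∘ₗ dtau) = mulL ∘ₗ (LinearMap.id - integ ∘ₗ dtau) := by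
    refine pplus_hom_ext fun a b => ?_
    rcases b with _ | b
    · refine LinearMap.ext fun B => ?_
      simp [dtau_mon, starH_mon_zero]
    · have h0 : (b : ℂ) + 1 ≠ 0 := by exact_mod_cast b.succ_ne_zero
      simp [dtau_mon, integ_mon, smul_smul, h0]
  have h2 := LinearMap.congr_fun (LinearMap.congr_fun h1 A) B
  simpa [hA] using h2

theorem brH_tmul_one_el_zero {h : ℂ} {A : PPlus} {X : Lam h}
    (hX : CliffordAlgebra.involute X = X) : brH h (A ⊗ₜ 1) (el h 0 0 X) = 0 := by
  rw [brH_even_right _ (el_mem_phPart 0 0 (by rw [hX, sgn_zero, one_smul])), el, mulH_tmul,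
    mulH_tmul, starH_one_right, starH_mon_zero, mon_zero_zero, one_mul, one_mul, mul_one, sub_self, smul_zero]

theorem rho_H1 (α h : ℂ) :
    rho α h (gen .H1) = el h 1 1 1 + ((α + 1) / 2 * h) • el h 0 0 1 := by
  rw [rho, ofGen_gen, rhoVal]

theorem brH_tmul_one_H1 (α : ℂ) {h : ℂ} (hh : h ≠ 0) {A : PPlus} (hA : dtau A = 0) :
    brH h (A ⊗ₜ 1) (rho α h (gen .H1)) = -((mon 1 0 * dt A) ⊗ₜ 1) := by
  have h1 : starH h (mon 1 1) A = mon 1 1 * A + h • (mon 1 0 * dt A) := by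
    rw [starH_mon, pow_one, Module.End.mul_apply, tauOp]
    simp [mul_add, ← mul_assoc, mon_mul_mon]
  rw [rho_H1, map_add, map_smul, brH_tmul_one_el_zero (map_one _), smul_zero, add_zero,
    brH_even_right _ (el_mem_phPart 1 1 (by rw [map_one, sgn_zero, one_smul])), el, mulH_tmul,
    mulH_tmul, h1, starH_of_dtau_eq_zero h hA, mul_one, mul_comm A, inv_smul_eq_iff₀ hh,
    TensorProduct.add_tmul, ← TensorProduct.smul_tmul']
  module

theorem exists_eq_const_add_t_mul_dt {A : PPlus} (hA : dtau A = 0) :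
    ∃ (r : ℂ) (B : PPlus), dtau B = 0 ∧ A = r • mon 0 0 + mon 1 0 * dt B := by
  -- A partial inverse of `t∂_t`, which scales `tᵃ` by `a`. The convention that the inverse of `0`
  -- is `0` makes `G` kill the constant term, the one direction `t∂_t` misses.
  let G : PPlus →ₗ[ℂ] PPlus := monBasis.constr ℂ fun ab =>
    if ab.2 = 0 then (ab.1 : ℂ)⁻¹ • mon ab.1 0 else 0
  have hG : ∀ a b, G (mon a b) = if b = 0 then (a : ℂ)⁻¹ • mon a 0 else 0 := fun a b => by
    rw [← monBasis_apply, Module.Basis.constr_basis]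
  have hG0 : dtau ∘ₗ G = 0 := by
    refine pplus_hom_ext fun a b => ?_
    rw [LinearMap.comp_apply, hG]
    split_ifs <;> simp [dtau_mon]
  have hG1 : LinearMap.id - integ ∘ₗ dtau =
      (monBasis.coord (0, 0)).smulRight (mon 0 0) + mulL (mon 1 0) ∘ₗ dt ∘ₗ G := by
    refine pplus_hom_ext fun a b => ?_
    have hc : monBasis.coord (0, 0) (mon a b) = if a = 0 ∧ b = 0 then 1 else 0 := by
      rw [← monBasis_apply, Module.Basis.coord_apply, Module.Basis.repr_self, Finsupp.single_apply]
      simp only [Prod.ext_iff]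
    rcases b with _ | b
    · rcases eq_or_ne a 0 with rfl | ha
      · simp [hc, hG, dtau_mon]
      · have ha' : (a : ℂ) ≠ 0 := by exact_mod_cast ha
        simp [hc, hG, dtau_mon, dt_mon, ha, mon_mul_mon, smul_smul, ha']
    · have h0 : (b : ℂ) + 1 ≠ 0 := by exact_mod_cast b.succ_ne_zero
      simp [hc, hG, dtau_mon, integ_mon, smul_smul, h0]
  refine ⟨monBasis.coord (0, 0) A, G A, LinearMap.congr_fun hG0 A, ?_⟩
  have h1 := LinearMap.congr_fun hG1 A
  simpa [hA] using h1

/-! ### One-dimensional quotients -/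

section Quotient

variable {M : Type*} [AddCommGroup M] [Module ℂ M] {N : Submodule ℂ M} {x : M}

theorem span_mk_eq_top (hx : ∀ c, ∃ r : ℂ, r • x - c ∈ N) :
    Submodule.span ℂ {(Submodule.Quotient.mk x : M ⧸ N)} = ⊤ := by
  rw [eq_top_iff]
  rintro y -
  obtain ⟨c, rfl⟩ := Submodule.Quotient.mk_surjective _ y
  obtain ⟨r, hr⟩ := hx c
  exact Submodule.mem_span_singleton.mpr ⟨r, (Submodule.Quotient.eq N).mpr hr⟩

theorem finrank_quotient_eq_one (hxN : x ∉ N) (hx : ∀ c, ∃ r : ℂ, r • x - c ∈ N) :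
    Module.finrank ℂ (M ⧸ N) = 1 :=
  finrank_eq_one_iff'.mpr ⟨Submodule.Quotient.mk x, mt (Submodule.Quotient.mk_eq_zero N).mp hxN,
    fun _ => Submodule.mem_span_singleton.mp (span_mk_eq_top hx ▸ Submodule.mem_top)⟩

end Quotient

/-! ### Cocycles -/

section Cocycles

variable (α h : ℂ)

/-- The 1-cocycles of arbitrary, not necessarily homogeneous, parity, written with the right
action `m ↦ [m, ρ X]`. -/
def rightCocycles : Submodule ℂ (Gam →ₗ[ℂ] PH h) where
  carrier := {c | ∀ q r : ZMod 2, ∀ X ∈ gamPart q, ∀ Y ∈ gamPart r,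
    c (gamAlphaBr α X Y) =
      brH h (c X) (rho α h Y) - sgn (q * r) • brH h (c Y) (rho α h X)}
  add_mem' {a b} ha hb q r X hX Y hY := by
    simp only [LinearMap.add_apply, map_add, ha q r X hX Y hY, hb q r X hX Y hY]
    module
  zero_mem' q r X _ Y _ := by simp
  smul_mem' s a ha q r X hX Y hY := by
    simp only [LinearMap.smul_apply, map_smul, ha q r X hX Y hY]
    module

variable {α h} in
theorem mem_rightCocycles {c : Gam →ₗ[ℂ] PH h} :
    c ∈ rightCocycles α h ↔ ∀ q r : ZMod 2, ∀ X ∈ gamPart q, ∀ Y ∈ gamPart r,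
      c (gamAlphaBr α X Y) =
        brH h (c X) (rho α h Y) - sgn (q * r) • brH h (c Y) (rho α h X) :=
  Iff.rfl

/-- Rewriting the left action as a right action absorbs all signs depending on the parity of the
cochain, so even and odd cocycles can be treated together. -/
theorem homCocycles_le_rightCocycles (p : ZMod 2) :
    homCocycles gamPart (gamAlphaBr α) (phPart h) (brH h) (rho α h) p ≤ rightCocycles α h := by
  intro c hc
  obtain ⟨hcp, hc⟩ : c ∈ cochains gamPart (phPart h) p ∧ ∀ q r : ZMod 2, ∀ X ∈ gamPart q,
      ∀ Y ∈ gamPart r, coboundary (gamAlphaBr α) (brH h) (rho α h) p q r c X Y = 0 := hc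
  rw [mem_rightCocycles]
  intro q r X hX Y hY
  have h1 := hc q r X hX Y hY
  have hρX : rho α h X ∈ phPart h q := by simpa using rho_mem α h q X hX
  have hρY : rho α h Y ∈ phPart h r := by simpa using rho_mem α h r Y hY
  have e1 := brH_swap hρX (hcp r Y hY)
  have e2 := brH_swap hρY (hcp q X hX)
  rw [coboundary, e1, e2, sub_eq_zero] at h1
  rw [← h1]
  generalize brH h (c Y) (rho α h X) = a
  generalize brH h (c X) (rho α h Y) = b
  clear * -
  rcases zmod_two_eq p with rfl | rfl <;> rcases zmod_two_eq q with rfl | rfl <;>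
    rcases zmod_two_eq r with rfl | rfl <;>
    simp only [mul_add, mul_zero, mul_one, sgn_add, sgn_zero, sgn_one] <;> module

theorem cocyclesAlpha_le_rightCocycles : cocyclesAlpha α h ≤ rightCocycles α h :=
  sup_le (homCocycles_le_rightCocycles α h 0) (homCocycles_le_rightCocycles α h 1)

variable {α h}

theorem coboundary_mem_rightCocycles (hh : h ≠ 0) (m : PH h) :
    (brH h).compl₂ (rho α h) m ∈ rightCocycles α h := by
  rw [mem_rightCocycles]
  intro q r X hX Y hY
  have hρX : rho α h X ∈ phPart h q := by simpa using rho_mem α h q X hX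
  have hρY : rho α h Y ∈ phPart h r := by simpa using rho_mem α h r Y hY
  simp only [LinearMap.compl₂_apply, rho_br α hh, brH_jacobi m hρX hρY]

/-- The cocycle condition is the coefficient of `β` in the deformation equation. -/
theorem theta_mem_cocyclesAlpha (hh : h ≠ 0) : theta α h ∈ cocyclesAlpha α h := by
  refine Submodule.mem_sup_left ⟨theta_mem α h, fun q r X hX Y hY => ?_⟩
  have hρY : rho α h Y ∈ phPart h r := by simpa using rho_mem α h r Y hY
  have h1 := (isFormalDeformation α hh).map_br 1 X Y
  simp only [deformation, Finset.Nat.antidiagonal_succ] at h1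
  simp at h1
  rw [coboundary, h1, brH_swap (theta_mem α h q X hX) hρY]
  simp only [zero_mul, zero_add, sgn_zero, one_smul, mul_comm r q]
  abel

/-! ### Rigidity of cocycles that vanish on `E¹` and the `Tⁱ`. -/

section Normalized

variable {c : Gam →ₗ[ℂ] PH h}

/-- A cocycle that vanishes on `E¹` and on the `Tⁱ` takes values in `ℂ[t, t⁻¹]` on every element
whose brackets with `E¹` and the `Tⁱ` it annihilates. -/
theorem exists_eq_tmul_one_of_mem (hh : h ≠ 0) (hc : c ∈ rightCocycles α h)
    (hE : c (gen .E1) = 0) (hT : ∀ i j, c (oddVec 0 i j) = 0) {q : ZMod 2} {X : Gam}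
    (hX : X ∈ gamPart q) (hEX : c (gamAlphaBr α (gen .E1) X) = 0)
    (hTX : ∀ i j, c (gamAlphaBr α (oddVec 0 i j) X) = 0) :
    ∃ A : PPlus, dtau A = 0 ∧ c X = A ⊗ₜ 1 := by
  have hs : ∀ q, sgn q ≠ 0 := fun q => by simp only [sgn]; split_ifs <;> simp
  refine exists_eq_tmul_one hh ?_ fun i j => ?_
  · have h1 := mem_rightCocycles.mp hc 0 q (gen .E1) (mem_gamPart_zero.mpr ⟨_, _, _, rfl⟩) X hX
    rw [hEX, hE, rho_E1] at h1
    simpa [hs] using h1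
  · have h1 := mem_rightCocycles.mp hc 1 q (oddVec 0 i j) (mem_gamPart_one.mpr ⟨_, rfl⟩) X hX
    rw [hTX, hT, rho_oddVec_zero] at h1
    simpa [hs, sqrtTwoI_ne_zero] using h1

theorem eq_zero_od_zero (hT : ∀ i j, c (oddVec 0 i j) = 0) (y z : V) :
    c (od ((e 0 ⊗ₜ y) ⊗ₜ z)) = 0 := by
  have hx : ∀ x : V, x = x 0 • e 0 + x 1 • e 1 := fun x => by
    ext i; fin_cases i <;> simp [e]
  have h1 : od ((e 0 ⊗ₜ y) ⊗ₜ z) = ∑ j, ∑ k, (y j * z k) • oddVec 0 j k := by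
    conv_lhs => rw [hx y, hx z]
    simp only [od, oddVec, Fin.sum_univ_two, TensorProduct.add_tmul, TensorProduct.tmul_add,
      ← TensorProduct.smul_tmul', TensorProduct.tmul_smul, Prod.smul_mk, smul_zero,
      Prod.mk_add_mk, add_zero]
    congr 1
    module
  simp [h1, hT]

theorem ev_eq_smul_E1 {A : sp} (h00 : entry 0 0 A = 0) (h10 : entry 1 0 A = 0) :
    ev A 0 0 = -(2⁻¹ * entry 0 1 A) • gen .E1 := by
  rw [ev_eq_sum_gen, h00, h10]
  simp

theorem gamBr_oddVec_zero_ev {A : sp} (hA : entry 1 0 A = 0) (B C : sp) (i j : Fin 2) :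
    gamAlphaBr α (oddVec 0 i j) (ev A B C) =
      -(entry 0 0 A • od ((e 0 ⊗ₜ e i) ⊗ₜ e j) + od ((e 0 ⊗ₜ B.1 (e i)) ⊗ₜ e j) +
        od ((e 0 ⊗ₜ e i) ⊗ₜ C.1 (e j))) := by
  have h1 : A.1 (e 0) = entry 0 0 A • e 0 := by
    ext k
    fin_cases k
    · simp [sp_apply_zero, e]
    · simp [sp_apply_one, e, hA]
  change gamBr _ _ _ (od _) _ = _
  rw [gamBr_od_ev, gamBr_ev_od]
  simp [act, h1, od, ← TensorProduct.smul_tmul']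

theorem gamBr_E1_ev {A : sp} (hA : entry 1 0 A = 0) (B C : sp) :
    gamAlphaBr α (gen .E1) (ev A B C) = (-2 * entry 0 0 A) • gen .E1 := by
  have h0 : ∀ A : sp, spBr 0 A = 0 := fun A => by ext1; simp [spBr]
  have hp := entry_pMap (e 0) (e 0)
  have hb := entry_spBr (-pMap (e 0) (e 0)) A
  change gamBr _ _ _ (ev _ 0 0) _ = _
  rw [gamBr_ev_ev, h0, h0, ev_eq_smul_E1]
  · rw [hb.2.1]
    congr 1
    simp [hp]
    simp [e]
    ring
  · rw [hb.1]
    simp [hp, hA]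
    simp [e]
  · rw [hb.2.2]
    simp [hp, hA]
    simp [e]

theorem exists_eq_tmul_one_ev (hh : h ≠ 0) (hc : c ∈ rightCocycles α h)
    (hE : c (gen .E1) = 0) (hT : ∀ i j, c (oddVec 0 i j) = 0) {A : sp} (hA : entry 1 0 A = 0)
    (B C : sp) : ∃ F : PPlus, dtau F = 0 ∧ c (ev A B C) = F ⊗ₜ 1 := by
  refine exists_eq_tmul_one_of_mem hh hc hE hT (mem_gamPart_zero.mpr ⟨A, B, C, rfl⟩) ?_ fun i j => ?_
  · rw [gamBr_E1_ev hA, map_smul, hE, smul_zero]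
  · rw [gamBr_oddVec_zero_ev hA]
    simp [eq_zero_od_zero hT]

theorem involute_spin (B C : sp) :
    CliffordAlgebra.involute (spinTwo h B + spinThree h C) = spinTwo h B + spinThree h C := by
  simp [spinTwo, spinThree, involute_xi, involute_eta]

/-- The values are Laurent polynomials in `t`, which commute with the image of `sp(ψ₂) ⊕ sp(ψ₃)`.
The cocycle therefore kills all brackets in this algebra, and the algebra is perfect. -/
theorem eq_zero_ev_zero (hh : h ≠ 0) (hc : c ∈ rightCocycles α h)
    (hE : c (gen .E1) = 0) (hT : ∀ i j, c (oddVec 0 i j) = 0) (B C : sp) :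
    c (ev 0 B C) = 0 := by
  have key : ∀ B C B' C', c (ev 0 (spBr B B') (spBr C C')) = 0 := by
    intro B C B' C'
    have h1 := mem_rightCocycles.mp hc 0 0 (ev 0 B C) (mem_gamPart_zero.mpr ⟨_, _, _, rfl⟩) (ev 0 B' C')
      (mem_gamPart_zero.mpr ⟨_, _, _, rfl⟩)
    obtain ⟨F, -, hF⟩ := exists_eq_tmul_one_ev hh hc hE hT (map_zero _) B C
    obtain ⟨F', -, hF'⟩ := exists_eq_tmul_one_ev hh hc hE hT (map_zero _) B' C'
    have h0 : spBr 0 0 = 0 := by ext1; simp [spBr]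
    rw [hF, hF', rho_ev_zero, rho_ev_zero, brH_tmul_one_el_zero (involute_spin _ _),
      brH_tmul_one_el_zero (involute_spin _ _), gamAlphaBr, gamBr_ev_ev, h0] at h1
    simpa using h1
  -- Root vectors are brackets with the Cartan element `pMap (e 0) (e 1)`, of weights `±2`, and the
  -- diagonal part is a bracket of opposite root vectors.
  have hsp : ∀ B : sp, ∃ P Q P' Q', B = spBr P Q + spBr P' Q' := by
    intro B
    refine ⟨pMap (e 0) (e 1), -(4⁻¹ * entry 0 1 B) • pMap (e 0) (e 0) -
      (4⁻¹ * entry 1 0 B) • pMap (e 1) (e 1), (-4⁻¹ * entry 0 0 B) • pMap (e 0) (e 0),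
      pMap (e 1) (e 1), ?_⟩
    have h1 := entry_pMap (e 0) (e 1)
    have h2 := entry_pMap (e 0) (e 0)
    have h3 := entry_pMap (e 1) (e 1)
    have hb := fun A B => (entry_spBr A B).1
    have hb' := fun A B => (entry_spBr A B).2.1
    have hb'' := fun A B => (entry_spBr A B).2.2
    apply sp_ext <;> simp [hb, hb', hb'', h1, h2, h3] <;> simp [e] <;> ring
  obtain ⟨P, Q, P', Q', hB⟩ := hsp B
  obtain ⟨S, U, S', U', hC⟩ := hsp C
  have h1 : ev 0 B C = ev 0 (spBr P Q) (spBr S U) + ev 0 (spBr P' Q') (spBr S' U') := by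
    rw [hB, hC]
    simp [ev]
  rw [h1, map_add, key, key, add_zero]

/-- `E¹`, `H¹`, the `Tⁱ` and `sp(ψ₂) ⊕ sp(ψ₃)` contain all brackets of the `Dⁱ` with `E¹` and the
`Tⁱ`, so the values on the `Dⁱ` are Laurent polynomials. A weight argument makes them zero, and `F¹`
is a bracket of two of the `Dⁱ` up to scalar. -/
theorem eq_zero_of_normalized (hh : h ≠ 0) (hc : c ∈ rightCocycles α h)
    (hE : c (gen .E1) = 0) (hT : ∀ i j, c (oddVec 0 i j) = 0) (hH : c (gen .H1) = 0) : c = 0 := by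
  have hev : ∀ {A : sp}, entry 1 0 A = 0 → ∀ B C, c (ev A B C) = 0 := by
    intro A hA B C
    have h1 : ev A B C = ev A 0 0 + ev 0 B C := by simp [ev]
    rw [h1, map_add, eq_zero_ev_zero hh hc hE hT, add_zero, ev_eq_sum_gen]
    simp [hA, hE, hH]
  have hp00 := entry_pMap (e 0) (e 0)
  have hp01 := entry_pMap (e 0) (e 1)
  have hD : ∀ i j, c (oddVec 1 i j) = 0 := by
    intro i j
    obtain ⟨F, -, hF⟩ := exists_eq_tmul_one_of_mem hh hc hE hT (X := oddVec 1 i j)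
      (mem_gamPart_one.mpr ⟨_, rfl⟩) (by
        change c (gamBr _ _ _ (ev _ 0 0) (od _)) = 0
        rw [gamBr_ev_od]
        have h1 : (pMap (e 0) (e 0)).1 (e 1) = (2 : ℂ) • e 0 := by
          ext k
          fin_cases k
          · simp [sp_apply_zero, hp00]; simp [e]
          · simp [sp_apply_one, hp00]; simp [e]
        have h2 : act (-pMap (e 0) (e 0), 0, 0) ((e 1 ⊗ₜ[ℂ] e i) ⊗ₜ[ℂ] e j) =
            -(2 : ℂ) • ((e 0 ⊗ₜ[ℂ] e i) ⊗ₜ[ℂ] e j) := by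
          simp [act, h1, ← TensorProduct.smul_tmul', TensorProduct.neg_tmul]
        have h3 : ∀ (r : ℂ) u, od (r • u) = r • od u := fun r u => by simp [od]
        rw [h2, h3, map_smul, eq_zero_od_zero hT, smul_zero]) (fun k l => by
        change c (gamBr _ _ _ (od _) (od _)) = 0
        rw [gamBr_od_od]
        refine hev ?_ _ _
        have h1 : pOne ((e 0 ⊗ₜ[ℂ] e k) ⊗ₜ[ℂ] e l) ((e 1 ⊗ₜ[ℂ] e i) ⊗ₜ[ℂ] e j) =
            (psi (e k) (e i) * psi (e l) (e j)) • pMap (e 0) (e 1) := by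
          simp [pOne, smul_smul, mul_comm]
        rw [h1, map_smul, map_smul, hp01.2.2]
        simp [e])
    -- A Cartan element of `sp(ψ₂)` acts on `oddVec 1 i j` with weight `±1`, but its image commutes
    -- with the Laurent polynomial `c (oddVec 1 i j)`.
    have h1 := mem_rightCocycles.mp hc 0 1 (ev 0 (pMap (e 0) (e 1)) 0) (mem_gamPart_zero.mpr ⟨_, _, _, rfl⟩)
      (oddVec 1 i j) (mem_gamPart_one.mpr ⟨_, rfl⟩)
    rw [hF, eq_zero_ev_zero hh hc hE hT, rho_ev_zero,
      brH_tmul_one_el_zero (involute_spin _ _)] at h1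
    have h2 : ∃ r : ℂ, r ≠ 0 ∧ (pMap (e 0) (e 1)).1 (e i) = r • e i := by
      fin_cases i
      · refine ⟨-1, by norm_num, ?_⟩
        ext k
        fin_cases k
        · simp [sp_apply_zero, hp01]; simp [e]
        · simp [sp_apply_one, hp01]; simp [e]
      · refine ⟨1, by norm_num, ?_⟩
        ext k
        fin_cases k
        · simp [sp_apply_zero, hp01]; simp [e]
        · simp [sp_apply_one, hp01]; simp [e]
    obtain ⟨r, hr, h2⟩ := h2
    have h3 : gamAlphaBr α (ev 0 (pMap (e 0) (e 1)) 0) (oddVec 1 i j) = r • oddVec 1 i j := by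
      change gamBr _ _ _ (ev _ _ _) (od _) = _
      rw [gamBr_ev_od]
      simp [act, h2, od, oddVec, ← TensorProduct.smul_tmul']
    rw [h3, map_smul] at h1
    simpa [hr] using h1
  have hF1 : c (gen .F1) = 0 := by
    have h1 := mem_rightCocycles.mp hc 1 1 (oddVec 1 0 0) (mem_gamPart_one.mpr ⟨_, rfl⟩)
      (oddVec 1 1 1) (mem_gamPart_one.mpr ⟨_, rfl⟩)
    rw [hD, hD] at h1
    have h2 : gamAlphaBr α (oddVec 1 0 0) (oddVec 1 1 1) = (-2 : ℂ) • gen .F1 := by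
      change gamBr _ _ _ (od _) (od _) = _
      have h3 := pOdd_tmul 2 (-1 - α) (α - 1) (e 1) (e 0) (e 0) (e 1) (e 1) (e 1)
      rw [gamBr_od_od, ev, ← pOdd, h3, gen]
      simp [psi_apply, e]
    rw [h2, map_smul] at h1
    simpa using h1
  refine LinearMap.ext fun X => ?_
  rw [eq_ev_add_od X, map_add, LinearMap.zero_apply]
  have h1 : c (od X.2) = 0 := oddPart_hom_ext (f := c) (g := 0) (fun i j k => by
    rcases Fin.exists_fin_two.mp ⟨i, rfl⟩ with rfl | rfl
    · exact hT j k
    · exact hD j k) X.2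
  have h2 : ∀ A B C, ev A B C = ev A 0 0 + ev 0 B C := fun A B C => by simp [ev]
  rw [h1, add_zero, h2 X.1.1, map_add, eq_zero_ev_zero hh hc hE hT, add_zero, ev_eq_sum_gen]
  simp [hE, hH, hF1]

end Normalized

/-! ### Normalization of arbitrary cocycles and the class of `θ̄₁`. -/

theorem theta_E1 : theta α h (gen .E1) = 0 := ofGen_gen _ _

theorem theta_H1 : theta α h (gen .H1) = el h 0 0 1 := ofGen_gen _ _

theorem theta_oddVec_zero (i j : Fin 2) : theta α h (oddVec 0 i j) = 0 := by
  rw [theta, ofGen_oddVec]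
  fin_cases i <;> fin_cases j <;> simp [ofGenOdd, thetaVal]

theorem brH_tmul_one_E1 (hh : h ≠ 0) {A : PPlus} (hA : dtau A = 0) :
    brH h (A ⊗ₜ 1) (rho α h (gen .E1)) = 0 := by
  rw [rho_E1, brH_t_sq hh]
  simp [dtauOp, hA]

theorem brH_tmul_one_oddVec (hh : h ≠ 0) {A : PPlus} (hA : dtau A = 0) (i j : Fin 2) :
    brH h (A ⊗ₜ 1) (rho α h (oddVec 0 i j)) = 0 := by
  have h1 := annih_tmul_one (h := h) (i, j) A
  rw [annih] at h1
  rw [rho_oddVec_zero, map_smul, brH_t_mul hh _ (involute_vec _ _), h1]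
  simp [dtauOp, hA]

/-- Every cocycle is cohomologous to one that vanishes on `E¹` and on the `Tⁱ`. -/
theorem exists_normalize (hh : h ≠ 0) {c : Gam →ₗ[ℂ] PH h} (hc : c ∈ rightCocycles α h) :
    ∃ m : PH h, (c - (brH h).compl₂ (rho α h) m) (gen .E1) = 0 ∧
      ∀ i j, (c - (brH h).compl₂ (rho α h) m) (oddVec 0 i j) = 0 := by
  have hs := sqrtTwoI_ne_zero
  obtain ⟨m₀, hm₀⟩ := exists_brH_t_sq_eq hh (c (gen .E1))
  set c₁ := c - (brH h).compl₂ (rho α h) m₀ with hc₁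
  have hc₁c : c₁ ∈ rightCocycles α h :=
    Submodule.sub_mem _ hc (coboundary_mem_rightCocycles hh m₀)
  have hE : c₁ (gen .E1) = 0 := by
    rw [hc₁, LinearMap.sub_apply, LinearMap.compl₂_apply, rho_E1, hm₀, sub_self]
  -- The `Tⁱ` commute with `E¹` and `c₁` vanishes on `E¹`, so `c₁(Tⁱ)` commutes with `t²`.
  have hd : ∀ i j, dtauOp h (c₁ (oddVec 0 i j)) = 0 := by
    intro i j
    refine dtauOp_eq_zero_of_brH_t_sq hh ?_
    have h1 := mem_rightCocycles.mp hc₁c 1 0 (oddVec 0 i j) (mem_gamPart_one.mpr ⟨_, rfl⟩) (gen .E1)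
      (mem_gamPart_zero.mpr ⟨_, _, _, rfl⟩)
    have hp := entry_pMap (e 0) (e 0)
    have h2 : gamAlphaBr α (oddVec 0 i j) (gen .E1) = 0 := by
      change gamAlphaBr α (oddVec 0 i j) (ev _ 0 0) = 0
      rw [gamBr_oddVec_zero_ev (by simp [hp]; simp [e])]
      simp [hp, od]
      simp [e]
    rw [h2, hE, rho_E1] at h1
    simpa using h1.symm
  -- Brackets of the `Tⁱ` are multiples of `E¹`, where `c₁` vanishes; the cocycle identity reduces
  -- to the closedness condition of the Koszul complex.
  have hTT : ∀ i j k l, brH h (c₁ (oddVec 0 i j)) (rho α h (oddVec 0 k l)) +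
      brH h (c₁ (oddVec 0 k l)) (rho α h (oddVec 0 i j)) = 0 := by
    intro i j k l
    have h1 := mem_rightCocycles.mp hc₁c 1 1 (oddVec 0 i j) (mem_gamPart_one.mpr ⟨_, rfl⟩) (oddVec 0 k l)
      (mem_gamPart_one.mpr ⟨_, rfl⟩)
    have h2 : gamAlphaBr α (oddVec 0 i j) (oddVec 0 k l) =
        (-2 * (psi (e i) (e k) * psi (e j) (e l))) • gen .E1 := by
      change gamBr _ _ _ (od _) (od _) = _
      have h3 := pOdd_tmul 2 (-1 - α) (α - 1) (e 0) (e i) (e j) (e 0) (e k) (e l)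
      have h4 : psi (e 0) (e 0) = 0 := by simp [psi_apply, mul_comm]
      rw [gamBr_od_od, ev, ← pOdd, h3, h4, gen]
      simp [smul_smul]
    rw [h2, map_smul, hE, smul_zero, mul_one, sgn_one] at h1
    rw [h1]
    module
  have hbr : ∀ m, dtauOp h m = 0 → ∀ i j, brH h m (rho α h (oddVec 0 i j)) =
      sqrtTwoI • tOp h 1 (annih h (i, j) m) := by
    intro m hm i j
    rw [rho_oddVec_zero, map_smul, brH_t_mul hh _ (involute_vec _ _), hm, map_zero, add_zero, annih]
  have hinj : ∀ m, tOp h 1 m = 0 → m = 0 := fun m hm => by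
    have h4 : (tOp h (-1) * tOp h 1) m = 0 := by rw [Module.End.mul_apply, hm, map_zero]
    simpa [tOp_mul_tOp, tOp_zero] using h4
  have hcomm : ∀ a (i : Fin 2 × Fin 2) m, annih h i (tOp h a m) = tOp h a (annih h i m) := by
    intro a i m
    rw [annih, tOp, ← LinearMap.comp_apply, ← LinearMap.comp_apply, LinearMap.lTensor_comp_rTensor,
      LinearMap.rTensor_comp_lTensor]
  have hcommd : ∀ f : Module.End ℂ (Lam h), ∀ m ∈ LinearMap.ker (dtauOp h),
      LinearMap.lTensor PPlus f m ∈ LinearMap.ker (dtauOp h) := by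
    intro f m hm
    rw [LinearMap.mem_ker] at hm ⊢
    rw [dtauOp, ← LinearMap.comp_apply, LinearMap.rTensor_comp_lTensor,
      ← LinearMap.lTensor_comp_rTensor, LinearMap.comp_apply, ← dtauOp, hm, map_zero]
  -- On `ker ∂_τ` the coboundary of `y` has value `√2 i · t · annih y` on the odd vectors, so the
  -- prescribed annihilations are `c₁` divided by `√2 i · t`. Solving inside `ker ∂_τ` keeps the
  -- value on `E¹` equal to zero.
  obtain ⟨y, hy, hyc⟩ := exists_forall_eq_of_car (annih_creat hh) annih_annih
    (LinearMap.ker (dtauOp h)) (fun i m hm => hcommd _ m hm) (fun i m hm => hcommd _ m hm)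
    (fun i => sqrtTwoI⁻¹ • tOp h (-1) (c₁ (oddVec 0 i.1 i.2)))
    (fun i => by
      refine Submodule.smul_mem _ _ ?_
      rw [LinearMap.mem_ker, ← Module.End.mul_apply, ← (commute_tOp_dtauOp h (-1)).eq,
        Module.End.mul_apply, hd, map_zero])
    (fun i j => by
      have h1 := hTT i.1 i.2 j.1 j.2
      rw [hbr _ (hd _ _), hbr _ (hd _ _), ← smul_add, ← map_add] at h1
      have h2 := hinj _ ((smul_eq_zero.mp h1).resolve_left hs)
      rw [map_smul, map_smul, hcomm, hcomm, ← smul_add, ← map_add, add_comm, h2, map_zero,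
        smul_zero])
  have hy' : dtauOp h y = 0 := hy
  refine ⟨m₀ + y, ?_, fun i j => ?_⟩
  · rw [map_add, ← sub_sub, ← hc₁, LinearMap.sub_apply, hE, LinearMap.compl₂_apply, rho_E1,
      brH_t_sq hh, hy']
    simp
  · rw [map_add, ← sub_sub, ← hc₁, LinearMap.sub_apply, LinearMap.compl₂_apply, hbr y hy', hyc,
      map_smul, smul_smul, mul_inv_cancel₀ hs, one_smul, ← Module.End.mul_apply, tOp_mul_tOp]
    simp [tOp_zero]

/-- After normalization the value on `H¹` is a Laurent polynomial `r + tB'`. The coboundary of `B`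
takes the value `-tB'` there without disturbing the normalization, and what remains agrees with `r •
theta α h` on `E¹`, the `Tⁱ` and `H¹`, hence everywhere. -/
theorem exists_eq_coboundary_add_smul_theta (hh : h ≠ 0) {c : Gam →ₗ[ℂ] PH h}
    (hc : c ∈ rightCocycles α h) :
    ∃ (m : PH h) (r : ℂ), c = (brH h).compl₂ (rho α h) m + r • theta α h := by
  obtain ⟨m, hE, hT⟩ := exists_normalize hh hc
  obtain ⟨c₁, hc₁⟩ : ∃ c₁, c₁ = c - (brH h).compl₂ (rho α h) m := ⟨_, rfl⟩
  rw [← hc₁] at hE hT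
  have hc₁c : c₁ ∈ rightCocycles α h :=
    hc₁ ▸ Submodule.sub_mem _ hc (coboundary_mem_rightCocycles hh m)
  have hθ : theta α h ∈ rightCocycles α h :=
    cocyclesAlpha_le_rightCocycles α h (theta_mem_cocyclesAlpha hh)
  obtain ⟨F, hF, hcF⟩ : ∃ F : PPlus, dtau F = 0 ∧ c₁ (gen .H1) = F ⊗ₜ 1 := by
    have hg : gen .H1 = ev (-pMap (e 0) (e 1)) 0 0 := rfl
    rw [hg]
    refine exists_eq_tmul_one_ev hh hc₁c hE hT ?_ 0 0
    rw [map_neg, (entry_pMap (e 0) (e 1)).2.2]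
    simp [e]
  obtain ⟨r, B, hB, hFB⟩ := exists_eq_const_add_t_mul_dt hF
  refine ⟨m - B ⊗ₜ 1, r, ?_⟩
  have h0 : c₁ + (brH h).compl₂ (rho α h) (B ⊗ₜ 1) - r • theta α h = 0 := by
    refine eq_zero_of_normalized hh (Submodule.sub_mem _ (Submodule.add_mem _ hc₁c
      (coboundary_mem_rightCocycles hh _)) (Submodule.smul_mem _ r hθ)) ?_ (fun i j => ?_) ?_
    · simp [hE, theta_E1, brH_tmul_one_E1 hh hB]
    · simp [hT, theta_oddVec_zero, brH_tmul_one_oddVec hh hB]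
    · simp only [LinearMap.sub_apply, LinearMap.add_apply, LinearMap.smul_apply, hcF,
        LinearMap.compl₂_apply, brH_tmul_one_H1 α hh hB, theta_H1, el]
      rw [hFB, TensorProduct.add_tmul, ← TensorProduct.smul_tmul']
      module
  rw [map_sub]
  have h1 : c = c₁ + (brH h).compl₂ (rho α h) m := by rw [hc₁]; abel
  rw [h1, ← sub_eq_zero, ← h0]
  abel

/-- If `θ̄₁` were the coboundary of `m`, its vanishing on `E¹` and the `Tⁱ` would make `m` a Laurent
polynomial. Then the value on `H¹` would be `-t∂_t m`, which has no constant term, whereas `θ̄₁(H¹)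
= 1`. -/
theorem theta_notMem_B1 (hh : h ≠ 0) : theta α h ∉ B1 (brH h) (rho α h) := by
  rintro ⟨m, hm⟩
  have hm' : ∀ X, brH h m (rho α h X) = theta α h X := fun X => LinearMap.congr_fun hm X
  obtain ⟨A, hA, rfl⟩ := exists_eq_tmul_one hh (m := m)
    (by rw [← rho_E1 α, hm', theta_E1]) (fun i j => by
      have h1 := hm' (oddVec 0 i j)
      rw [theta_oddVec_zero, rho_oddVec_zero, map_smul] at h1
      exact (smul_eq_zero.mp h1).resolve_left sqrtTwoI_ne_zero)
  have h1 := hm' (gen .H1)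
  rw [brH_tmul_one_H1 α hh hA, theta_H1] at h1
  have h2 : monBasis.coord (0, 0) ∘ₗ mulL (mon 1 0) ∘ₗ dt = 0 := by
    refine pplus_hom_ext fun a b => ?_
    rw [LinearMap.comp_apply, LinearMap.comp_apply, dt_mon, map_smul, LinearMap.mul_apply',
      mon_mul_mon, map_smul, ← monBasis_apply, Module.Basis.coord_apply, Module.Basis.repr_self,
      Finsupp.single_apply]
    rcases eq_or_ne a 0 with rfl | ha <;> simp [*]
  have h3 : monBasis.coord (0, 0) (mon 1 0 * dt A) = 0 := LinearMap.congr_fun h2 A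
  have h4 := congrArg (coeffAt h 0 0) h1
  rw [coeffAt_el, map_neg] at h4
  have h5 : coeffAt h 0 0 ((mon 1 0 * dt A) ⊗ₜ 1) = 0 := by
    simp only [coeffAt, LinearMap.comp_apply, LinearMap.rTensor_tmul, h3]
    simp
  rw [h5] at h4
  have := nontrivial_lam h
  simp at h4

theorem exists_smul_theta_sub_mem (hh : h ≠ 0) (c : cocyclesAlpha α h) :
    ∃ r : ℂ, r • (⟨theta α h, theta_mem_cocyclesAlpha hh⟩ : cocyclesAlpha α h) - c ∈
      (B1 (brH h) (rho α h)).submoduleOf (cocyclesAlpha α h) := by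
  obtain ⟨m, r, hmr⟩ := exists_eq_coboundary_add_smul_theta hh
    (cocyclesAlpha_le_rightCocycles α h c.2)
  refine ⟨r, ?_⟩
  rw [Submodule.submoduleOf, Submodule.mem_comap]
  refine ⟨-m, ?_⟩
  rw [map_neg, Submodule.subtype_apply, Submodule.coe_sub, Submodule.coe_smul, hmr]
  abel

theorem span_classOf_theta (hh : h ≠ 0) :
    Submodule.span ℂ {classOf α h ⟨theta α h, theta_mem_cocyclesAlpha hh⟩} = ⊤ :=
  span_mk_eq_top (exists_smul_theta_sub_mem hh)

theorem finrank_cohomologyAlpha (hh : h ≠ 0) : Module.finrank ℂ (cohomologyAlpha α h) = 1 := by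
  refine finrank_quotient_eq_one (x := ⟨theta α h, theta_mem_cocyclesAlpha hh⟩) ?_
    (exists_smul_theta_sub_mem hh)
  rw [Submodule.submoduleOf, Submodule.mem_comap]
  exact theta_notMem_B1 hh

end Cocycles

end DTwoOne

end

open DTwoOne in
theorem theorem4p5 (α : ℂ) (h : ℝ) (h_pos : 0 < h) (h_le : h ≤ 1) :
    IsEmbedding gamPart (gamAlphaBr α) (phPart (h : ℂ)) (brH (h : ℂ)) (rho α (h : ℂ)) ∧
    Module.finrank ℂ (cohomologyAlpha α (h : ℂ)) = 1 ∧
    (∃ hθ : theta α (h : ℂ) ∈ cocyclesAlpha α (h : ℂ),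
      Submodule.span ℂ {classOf α (h : ℂ) ⟨theta α (h : ℂ), hθ⟩} = ⊤) ∧
    IsFormalDeformation gamPart (gamAlphaBr α) (phPart (h : ℂ)) (brH (h : ℂ)) (rho α (h : ℂ))
      (deformation α (h : ℂ)) := by
  have hh : (h : ℂ) ≠ 0 := by exact_mod_cast h_pos.ne'
  exact ⟨isEmbedding α hh, finrank_cohomologyAlpha hh,
    ⟨theta_mem_cocyclesAlpha hh, span_classOf_theta hh⟩, isFormalDeformation α hh⟩
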